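/- Let $f:\mathbb R\to(0,\infty]$ and $h:\mathbb R\to\mathbb R$ be such that: $f$ is even, $f(0)=1$, $f$ is (finite and) continuously differentiable on some interval $[-\delta,\delta]$ with $\delta>0$, and for some $c_f\in(0,1)$ one has $f(k)\ge 2c_f$ for all $k>0$ and $\sup_{t>0}|b_t|_{BV}<\infty$, where $b_t(k)=\exp(-k^2(f(k)-c_f)t)$; $h$ is even and bounded, $h^2/f$ has bounded variation, and $h$ is twice differentiable at $0$ with $h(0)=1$, $h'(0)=0$. (We use $e^{-\infty}=0$ and $1/\infty=0$.) Let $(w_k)_{k\in\mathbb Z}$ be $\mathbb C^n$-valued standard Brownian motions (the real and imaginary parts of all components are independent real Brownian motions, normalised by $\mathbb E|w_k^i(t)|^2=t$), independent up to the constraint $w_{-k}=\overline{w_k}$. For $\varepsilon\ge 0$, $t\ge 0$ and $x,y\in[-\pi,\pi]$ let $$X_\varepsilon(t,x)=\frac1{\sqrt{2\pi}}\sum_{k\in\mathbb Z}e^{ikx}Z^\varepsilon_k(t),\qquad Z^\varepsilon_k(t)=\int_0^t e^{-k^2f(\varepsilon k)(t-s)}h(\varepsilon k)\,dw_k(s),$$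 the solution of the approximate stochastic heat equation with zero initial condition, and let $$\mathbf X_\varepsilon(t;x,y)=\frac1{2\pi}\sum_{k,l\in\mathbb Z}Z^\varepsilon_k(t)\otimes Z^\varepsilon_l(t)\int_x^y\big(e^{ikz}-e^{ikx}\big)\,il\,e^{ilz}\,dz$$ be its iterated integral $\int_x^y(X_\varepsilon(t,z)-X_\varepsilon(t,x))\otimes d_zX_\varepsilon(t,z)$; both series are limits in $L^2(\Omega)$ of the truncations $|k|,|l|\le N$ as $N\to\infty$. Write $X=X_0$, $\mathbf X=\mathbf X_0$. For $\alpha>0$ put $|u|_{\mathcal C^\alpha}=\sup_x|u(x)|+\sup_{x\ne y}\frac{|u(x)-u(y)|}{|x-y|^\alpha}$ for functions $u$ on $[-\pi,\pi]$ and $|R|_{\mathcal B^\alpha}=\sup_{x\neq y}\frac{|R(x,y)|}{|x-y|^\alpha}$ for functions $R$ on $[-\pi,\pi]^2$; matrices carry the Hilbert–Schmidt norm. For a space $E$ with norm $|\cdot|_E$ and $\alpha_1>0$, $T\ge0$ put $\|F\|_{\mathcal C^{\alpha_1}_T(E)}=\sup_{t\le T}|F(t)|_E+\sup_{s\ne t\le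 T}\frac{|F(t)-F(s)|_E}{|t-s|^{\alpha_1}}$. A geometric $\alpha$-rough path is a pair of continuous functions $Y:[-\pi,\pi]\to\mathbb R^n$, $\mathbf Y:[-\pi,\pi]^2\to\mathbb R^n\otimes\mathbb R^n$ with $|Y|_{\mathcal C^\alpha}<\infty$, $|\mathbf Y|_{\mathcal B^{2\alpha}}<\infty$, $\mathbf Y(x,x)=0$, such that for all $x,y,z$ $$\mathbf Y(x,z)-\mathbf Y(x,y)-\mathbf Y(y,z)=(Y(y)-Y(x))\otimes(Y(z)-Y(y)),$$ $$\tfrac12\big(\mathbf Y(x,y)+\mathbf Y(x,y)^T\big)=\tfrac12(Y(y)-Y(x))\otimes(Y(y)-Y(x)).$$ **Lemma.** For every $\varepsilon\ge0$, $X_\varepsilon$ and $\mathbf X_\varepsilon$ have versions that are continuous in $(t,x)$ and in $(t,x,y)$. For all such versions the following holds. (1) For every $\alpha\in(\frac13,\frac12)$ and every $\varepsilon\ge0$, almost surely, for every $t\ge0$ the pair $(X_\varepsilon(t,\cdot),\mathbf X_\varepsilon(t;\cdot,\cdot))$ is a geometric $\alpha$-rough path. (2) Let $T\ge0$, $p\in[1,\infty)$,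 and let $\alpha_1,\alpha_2>0$ satisfy $\alpha_1<\frac{\lambda_1}4$ and $\alpha_2<\frac{\lambda_2}2$ for some $\lambda_1,\lambda_2>0$ with $\lambda_1+\lambda_2\le1$. Then there is a finite constant $C$, independent of $\varepsilon$, such that for all $\varepsilon\ge0$ $$\mathbb E\|X_\varepsilon\|^p_{\mathcal C^{\alpha_1}_T(\mathcal C^{\alpha_2})}\le C,\qquad \mathbb E\|X_\varepsilon-X\|^p_{\mathcal C^{\alpha_1}_T(\mathcal C^{\alpha_2})}\le C\,\varepsilon^{\frac12(1-\lambda_1-\lambda_2)p},$$ $$\mathbb E\|\mathbf X_\varepsilon\|^p_{\mathcal C^{\alpha_1}_T(\mathcal B^{2\alpha_2})}\le C,\qquad \mathbb E\|\mathbf X_\varepsilon-\mathbf X\|^p_{\mathcal C^{\alpha_1}_T(\mathcal B^{2\alpha_2})}\le C\,\varepsilon^{\frac12(1-\lambda_1-\lambda_2)p},$$ where $0^0=1$. -/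

import Mathlib

open MeasureTheory ProbabilityTheory Filter Topology Set
open scoped NNReal ENNReal BigOperators

noncomputable section

namespace RoughHeat

/-! ### Cut-off functions -/

/-- `exp (-a)` for `a ∈ [0, ∞]`, with `exp (-∞) = 0`. -/
def expNeg (a : ℝ≥0∞) : ℝ := if a = ⊤ then 0 else Real.exp (-a.toReal)

/-- The standing assumptions on the cut-off functions `f : ℝ → (0, ∞]` (of the approximate
Laplacian, with symbol `-k² f(εk)`) and `h : ℝ → ℝ` (of the noise, with symbol `h(εk)`).
The functions in the two bounded variation conditions are automatically bounded, so that a bound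
on the total variation is the same as a bound on the BV norm. -/
structure CutoffAssumptions (f : ℝ → ℝ≥0∞) (h : ℝ → ℝ) : Prop where
  f_pos : ∀ k, 0 < f k
  f_even : ∀ k, f (-k) = f k
  f_zero : f 0 = 1
  f_smooth : ∃ δ : ℝ, 0 < δ ∧ (∀ k ∈ Icc (-δ) δ, f k ≠ ⊤) ∧
    ContDiffOn ℝ 1 (fun k => (f k).toReal) (Icc (-δ) δ)
  /-- The lower bound `f ≥ 2 c`, and the uniform bound on the variation of
  `b_t(k) = exp (-k² (f(k) - c) t)`, with the same constant `c`. -/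
  f_lower : ∃ c : ℝ, 0 < c ∧ c < 1 ∧ (∀ k, 0 < k → ENNReal.ofReal (2 * c) ≤ f k) ∧
    ∃ V : ℝ≥0, ∀ t : ℝ, 0 < t →
      eVariationOn (fun k : ℝ =>
        expNeg (ENNReal.ofReal (k ^ 2) * (f k - ENNReal.ofReal c) * ENNReal.ofReal t)) univ ≤ V
  h_even : ∀ k, h (-k) = h k
  h_bounded : ∃ M : ℝ, ∀ k, |h k| ≤ M
  h_sq_div_f : BoundedVariationOn (fun k => h k ^ 2 * ((f k)⁻¹).toReal) univ
  h_diff : ∀ᶠ k in 𝓝 (0 : ℝ), DifferentiableAt ℝ h k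
  h_diff_two : DifferentiableAt ℝ (deriv h) 0
  h_zero : h 0 = 1
  h_deriv_zero : deriv h 0 = 0

/-! ### The noise -/

section Noise

variable {Ω : Type*} [MeasurableSpace Ω] {n : ℕ}

/-- The real processes that make up the Fourier modes `w k`: `w 0` itself, and the real and
imaginary parts of `w k`, `k > 0`, multiplied by `√2`, which are indexed by `k` and `-k`. -/
def realMode (w : ℤ → Fin n → ℝ≥0 → Ω → ℂ) (i : ℤ × Fin n) (t : ℝ≥0) (ω : Ω) : ℝ :=
  if i.1 = 0 then (w 0 i.2 t ω).re
  else if 0 < i.1 then √2 * (w i.1 i.2 t ω).re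
  else √2 * (w (-i.1) i.2 t ω).im

/-- `w` is the family of Fourier modes of an `n`-dimensional cylindrical Brownian motion on
`L²[-π, π]`: the `w k` are `ℂⁿ`-valued standard Brownian motions (the real and imaginary parts of
all components are independent real Brownian motions, normalised by `E |w k j t|² = t`),
independent up to the constraint `w (-k) = conj (w k)`. -/
structure IsFourierNoise (P : Measure Ω) (w : ℤ → Fin n → ℝ≥0 → Ω → ℂ) : Prop where
  meas : ∀ k j t, Measurable (w k j t)
  conj_symm : ∀ k j t, ∀ᵐ ω ∂P, w (-k) j t ω = (starRingEnd ℂ) (w k j t ω)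
  brownian : ∀ i, IsBrownianReal (realMode w i) P
  indep : iIndepFun (fun i ω => fun t : ℝ≥0 => realMode w i t ω) P

/-- `I` is the stochastic (Itô) integral `∫₀ᵗ g(s) dw(s)` of the deterministic continuous function
`g`: the limit in `L²(Ω)` of the left-endpoint Riemann sums. -/
def IsWienerIntegral (P : Measure Ω) (g : ℝ≥0 → ℝ) (t : ℝ≥0) (w : ℝ≥0 → Ω → ℂ) (I : Ω → ℂ) :
    Prop :=
  MemLp I 2 P ∧
  Tendsto (fun m : ℕ => eLpNorm (fun ω =>
      (∑ i ∈ Finset.range m, (g (t * i / m) : ℂ) * (w (t * (i + 1) / m) ω - w (t * i / m) ω))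
        - I ω) 2 P)
    atTop (𝓝 0)

/-- The integrand `s ↦ exp (-k² f(εk) (t - s)) h(εk)`, for `s ≤ t`. -/
def modeKernel (f : ℝ → ℝ≥0∞) (h : ℝ → ℝ) (ε : ℝ≥0) (k : ℤ) (t s : ℝ≥0) : ℝ :=
  expNeg (ENNReal.ofReal ((k : ℝ) ^ 2) * f (ε * k) * ((t - s : ℝ≥0) : ℝ≥0∞)) * h (ε * k)

/-- `Z k j t = ∫₀ᵗ exp (-k² f(εk) (t - s)) h(εk) dw_k^j(s)` for all `k`, `j`, `t`. -/
def IsModeFamily (P : Measure Ω) (f : ℝ → ℝ≥0∞) (h : ℝ → ℝ) (w : ℤ → Fin n → ℝ≥0 → Ω → ℂ)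
    (ε : ℝ≥0) (Z : ℤ → Fin n → ℝ≥0 → Ω → ℂ) : Prop :=
  ∀ k j t, IsWienerIntegral P (modeKernel f h ε k t) t (w k j) (Z k j t)

end Noise

/-! ### Function spaces and rough paths -/

/-- The space interval `[-π, π]`. -/
abbrev Seg : Type := Icc (-Real.pi) Real.pi

/-- `ℝⁿ` with the Euclidean norm. -/
abbrev Vec (n : ℕ) : Type := EuclideanSpace ℝ (Fin n)

/-- `ℝⁿ ⊗ ℝⁿ`, the `n × n` matrices, with the Hilbert-Schmidt norm. -/
abbrev Ten (n : ℕ) : Type := EuclideanSpace ℝ (Fin n × Fin n)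

/-- `u ⊗ v`. -/
def tensor {n : ℕ} (u v : Vec n) : Ten n := WithLp.toLp 2 fun ij => u ij.1 * v ij.2

/-- The transpose of a matrix. -/
def transp {n : ℕ} (A : Ten n) : Ten n := WithLp.toLp 2 fun ij => A (ij.2, ij.1)

section Norms

variable {V : Type*} [NormedAddCommGroup V]

/-- The seminorm `|u|_α = sup_{x ≠ y} |u(x) - u(y)| / |x - y|^α`, with values in `[0, ∞]`. -/
def holderSemi (α : ℝ) (u : Seg → V) : ℝ≥0∞ :=
  ⨆ (x : Seg) (y : Seg) (_ : x ≠ y), ‖u x - u y‖ₑ / edist x y ^ α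

/-- The norm of `𝒞^α`: the supremum norm plus `|u|_α`. -/
def cNorm (α : ℝ) (u : Seg → V) : ℝ≥0∞ := (⨆ x : Seg, ‖u x‖ₑ) + holderSemi α u

/-- The norm of `ℬ^α`: `|R|_α = sup_{x ≠ y} |R(x, y)| / |x - y|^α`. -/
def bNorm (α : ℝ) (R : Seg → Seg → V) : ℝ≥0∞ :=
  ⨆ (x : Seg) (y : Seg) (_ : x ≠ y), ‖R x y‖ₑ / edist x y ^ α

/-- The norm of `𝒞^α([0, T], E)` where `N` is the norm of `E`. -/
def timeNorm {E : Type*} [AddCommGroup E] (N : E → ℝ≥0∞) (α : ℝ) (T : ℝ≥0) (F : ℝ≥0 → E) :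
    ℝ≥0∞ :=
  (⨆ t ∈ Icc 0 T, N (F t)) +
    ⨆ (s ∈ Icc 0 T) (t ∈ Icc 0 T) (_ : s ≠ t), N (F t - F s) / edist s t ^ α

end Norms

/-- An `α`-rough path `(X, 𝐗)`, where `X ∈ 𝒞^α(ℝⁿ)` and `𝐗 ∈ ℬ^{2α}(ℝⁿ ⊗ ℝⁿ)`. -/
structure IsRoughPath {n : ℕ} (α : ℝ) (X : Seg → Vec n) (XX : Seg → Seg → Ten n) : Prop where
  cont : Continuous X
  holder : holderSemi α X < ⊤
  cont₂ : Continuous fun q : Seg × Seg => XX q.1 q.2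
  diag : ∀ x, XX x x = 0
  holder₂ : bNorm (2 * α) XX < ⊤
  consistency : ∀ x y z, XX x z - XX x y - XX y z = tensor (X y - X x) (X z - X y)

/-- A geometric `α`-rough path. -/
structure IsGeometricRoughPath {n : ℕ} (α : ℝ) (X : Seg → Vec n) (XX : Seg → Seg → Ten n) : Prop
    extends IsRoughPath α X XX where
  symm_part : ∀ x y, (1 / 2 : ℝ) • (XX x y + transp (XX x y)) =
    (1 / 2 : ℝ) • tensor (X y - X x) (X y - X x)

/-! ### The approximate stochastic heat equation and its iterated integral -/

section Lift

variable {Ω : Type*} [MeasurableSpace Ω] {n : ℕ}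

/-- `(2π)^{-1/2} ∑_{|k| ≤ N} e^{ikx} Z_k(t)`, component `j`. -/
def partialX (Z : ℤ → Fin n → ℝ≥0 → Ω → ℂ) (N : ℕ) (t : ℝ≥0) (x : ℝ) (j : Fin n) (ω : Ω) : ℂ :=
  ((√(2 * Real.pi))⁻¹ : ℝ) *
    ∑ k ∈ Finset.Icc (-(N : ℤ)) N, Complex.exp (Complex.I * k * x) * Z k j t ω

/-- The partial sum `|k|, |l| ≤ N` of the double series for the iterated integral,
`(2π)^{-1} ∑_{k, l} Z_k(t) ⊗ Z_l(t) ∫_x^y (e^{ikz} - e^{ikx}) i l e^{ilz} dz`, entry `(i, j)`. -/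
def partialXX (Z : ℤ → Fin n → ℝ≥0 → Ω → ℂ) (N : ℕ) (t : ℝ≥0) (x y : ℝ) (i j : Fin n) (ω : Ω) :
    ℂ :=
  ((2 * Real.pi)⁻¹ : ℝ) *
    ∑ k ∈ Finset.Icc (-(N : ℤ)) N, ∑ l ∈ Finset.Icc (-(N : ℤ)) N,
      Z k i t ω * Z l j t ω *
        ∫ z in x..y, (Complex.exp (Complex.I * k * z) - Complex.exp (Complex.I * k * x)) *
          (Complex.I * l * Complex.exp (Complex.I * l * z))

/-- `X` is (a continuous version of) the solution
`X_ε(t, x) = (2π)^{-1/2} ∑_k e^{ikx} ∫₀ᵗ exp (-k² f(εk) (t - s)) h(εk) dw_k(s)` of the approximate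
stochastic heat equation with zero initial condition, and `XX` is (a continuous version of) its
iterated integral `∫_x^y (X_ε(t, z) - X_ε(t, x)) ⊗ d_z X_ε(t, z)`, where for all fixed arguments
both series converge in `L²(Ω)` along the truncations `|k|, |l| ≤ N`. For `ε = 0` this is the
stochastic heat equation. As the paths are continuous, the Hölder norms of `X` and `XX` below
are measurable functions of `ω`. -/
structure IsHeatLift (P : Measure Ω) (f : ℝ → ℝ≥0∞) (h : ℝ → ℝ)
    (w : ℤ → Fin n → ℝ≥0 → Ω → ℂ) (ε : ℝ≥0)
    (X : Ω → ℝ≥0 → Seg → Vec n) (XX : Ω → ℝ≥0 → Seg → Seg → Ten n) : Prop where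
  meas : ∀ t x, Measurable fun ω => X ω t x
  meas₂ : ∀ t x y, Measurable fun ω => XX ω t x y
  cont : ∀ ω, Continuous fun q : ℝ≥0 × Seg => X ω q.1 q.2
  cont₂ : ∀ ω, Continuous fun q : ℝ≥0 × Seg × Seg => XX ω q.1 q.2.1 q.2.2
  series : ∃ Z : ℤ → Fin n → ℝ≥0 → Ω → ℂ, IsModeFamily P f h w ε Z ∧
    (∀ t (x : Seg) j, Tendsto
      (fun N : ℕ => eLpNorm (fun ω => partialX Z N t x j ω - (X ω t x j : ℂ)) 2 P)
      atTop (𝓝 0)) ∧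
    (∀ t (x y : Seg) i j, Tendsto
      (fun N : ℕ => eLpNorm (fun ω => partialXX Z N t x y i j ω - (XX ω t x y (i, j) : ℂ)) 2 P)
      atTop (𝓝 0))

end Lift

end RoughHeat

end

/-! In real coordinates X_ε becomes (2π)^{-1/2} ∑ φ_k(x) Z_k(t), with φ_k the functions `trig` and
Z_k independent Ornstein-Uhlenbeck integrals driven by the Brownian motions `realMode`. A system is
then a list of decay rates k² f(εk) and noise strengths h(εk) (`Modes`), and every estimate is a
comparison of two systems at two times. Such a comparison enters only through the variances `kerVar`
of differences of single modes, and these always obey the same bound C min(m², 1/(1+k²)): with m =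
|t-s|^{1/2} for a time increment, m = ε for the parameter ε against the limit, m = 1/(N+1) for a
truncation to |k| ≤ N, and m = 1 against the system without noise, that is, for absolute bounds.

Since ∑ min(m², 1/(1+k²)) ≤ 9m, first-order sums have variance of order m, and their spatial
increments have variance of order min(m, |x-y|). Off-diagonal entries of the iterated integral are
bilinear in two independent Gaussian families; freezing one family reduces their moments to Gaussian
ones (`IsGaussArray.mom_bilin_le`), and Bessel's inequality sums the coefficients
(`sum_trigCoeff_sq_mul_le`), with variance of order |x-y| min(m, |x-y|). Diagonal entries are half
the squared increments of the path.

The increment in time of a difference of two systems at distance η is small with each of η,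
|t-s|^{1/2} and, for spatial increments, |x-y|. Splitting the exponent 1/2 as (1-λ₁-λ₂)/2 + λ₁/2 +
λ₂/2 yields the rate in ε together with the exponents λ₁/4 in time and λ₂/2 in space
(`exists_increment_bounds`). Kolmogorov's criterion, in time and then in space for path-valued
functionals, turns these moments into norms; Chen's relation makes the iterated integral additive up
to a product of increments, which is enough for chaining (`chain_bound`,
`exists_iterated_majorant`).

All this is done for truncated series. Successive dyadic truncations have summable differences, so a
continuous limit exists (`exists_isLimitLift`); it inherits the bounds by Fatou's lemma. Any lift in
the sense of the theorem agrees with it almost surely: at fixed arguments both are the same mean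
square limit, and continuity does the rest (`IsHeatLift.ae_eq`). -/

namespace RoughHeat

/-! ### Dyadic chaining -/

/-- The lower dyadic approximation of `x` at level `m`. -/
noncomputable def dyad (m : ℕ) (x : ℝ) : ℝ := (⌊x * 2 ^ m⌋₊ : ℝ) / 2 ^ m

lemma dyad_le {x : ℝ} (hx : 0 ≤ x) (m : ℕ) : dyad m x ≤ x := by
  unfold dyad
  rw [div_le_iff₀ (by positivity)]
  exact Nat.floor_le (by positivity)

lemma dyad_nonneg (m : ℕ) (x : ℝ) : 0 ≤ dyad m x := by unfold dyad; positivity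

lemma lt_dyad_add (x : ℝ) (m : ℕ) : x < dyad m x + (2 ^ m)⁻¹ := by
  unfold dyad
  rw [← one_div, ← add_div, lt_div_iff₀ (by positivity)]
  exact Nat.lt_floor_add_one _

lemma tendsto_dyad {x : ℝ} (hx : 0 ≤ x) : Tendsto (fun m => dyad m x) atTop (𝓝 x) := by
  have h : Tendsto (fun m : ℕ => x - ((2 : ℝ) ^ m)⁻¹) atTop (𝓝 (x - 0)) := by
    refine tendsto_const_nhds.sub ?_
    simpa using (tendsto_pow_atTop_nhds_zero_of_lt_one (r := (1 / 2 : ℝ)) (by norm_num)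
      (by norm_num))
  rw [sub_zero] at h
  exact tendsto_of_tendsto_of_tendsto_of_le_of_le h tendsto_const_nhds
    (fun m => by have := lt_dyad_add x m; simp only; linarith) (fun m => dyad_le hx m)

/-- The next dyadic approximation either agrees with the previous one, or is its neighbour. -/
lemma dyad_succ {x : ℝ} (hx : 0 ≤ x) (m : ℕ) : ∃ i : ℕ, dyad m x = (i : ℝ) / 2 ^ (m + 1) ∧
    (dyad (m + 1) x = (i : ℝ) / 2 ^ (m + 1) ∨ dyad (m + 1) x = ((i : ℝ) + 1) / 2 ^ (m + 1)) := by
  refine ⟨2 * ⌊x * 2 ^ m⌋₊, ?_, ?_⟩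
  · unfold dyad
    push_cast
    rw [pow_succ]
    field_simp
  · have h1 : 2 * ⌊x * 2 ^ m⌋₊ ≤ ⌊x * 2 ^ (m + 1)⌋₊ := by
      apply Nat.le_floor
      push_cast
      have := Nat.floor_le (a := x * 2 ^ m) (by positivity)
      rw [pow_succ]; linarith
    have h2 : ⌊x * 2 ^ (m + 1)⌋₊ < 2 * ⌊x * 2 ^ m⌋₊ + 2 := by
      rw [Nat.floor_lt (by positivity)]
      push_cast
      have := Nat.lt_floor_add_one (x * 2 ^ m)
      rw [pow_succ]; linarith
    unfold dyad
    obtain h | h : ⌊x * 2 ^ (m + 1)⌋₊ = 2 * ⌊x * 2 ^ m⌋₊ ∨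
        ⌊x * 2 ^ (m + 1)⌋₊ = 2 * ⌊x * 2 ^ m⌋₊ + 1 := by omega
    · left; rw [h]
    · right; rw [h]; push_cast; rfl

/-- The ratio of the chaining argument. -/
noncomputable def chainRatio (γ : ℝ) : ℝ≥0∞ := 2 ^ (-(γ / 2))

/-- The constant of the chaining argument. -/
noncomputable def chainConst (γ : ℝ) : ℝ≥0∞ :=
  2 + (2 + 2 * 4 ^ (γ / 2)) * (1 - chainRatio γ)⁻¹

lemma chainRatio_lt_one {γ : ℝ} (hγ : 0 < γ) : chainRatio γ < 1 :=
  ENNReal.rpow_lt_one_of_one_lt_of_neg (by norm_num) (by linarith)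

lemma chainConst_ne_top {γ : ℝ} (hγ : 0 < γ) : chainConst γ ≠ ⊤ := by
  unfold chainConst
  have h1 : (1 - chainRatio γ)⁻¹ ≠ ⊤ := by
    rw [ENNReal.inv_ne_top]
    exact (tsub_pos_of_lt (chainRatio_lt_one hγ)).ne'
  have h2 : (4 : ℝ≥0∞) ^ (γ / 2) ≠ ⊤ := ENNReal.rpow_ne_top_of_nonneg (by linarith) (by norm_num)
  finiteness

lemma ofReal_inv_two_pow_rpow (γ : ℝ) (m : ℕ) :
    ENNReal.ofReal (((2 : ℝ) ^ m)⁻¹) ^ (γ / 2) = chainRatio γ ^ m := by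
  unfold chainRatio
  rw [ENNReal.ofReal_inv_of_pos (by positivity), ENNReal.ofReal_pow (by norm_num),
    ENNReal.ofReal_ofNat, ENNReal.inv_rpow, ← ENNReal.rpow_natCast, ← ENNReal.rpow_natCast,
    ← ENNReal.rpow_mul, ← ENNReal.rpow_mul, ← ENNReal.rpow_neg]
  congr 1; ring

variable {F : ℝ → ℝ → ℝ≥0∞} {γ : ℝ} {K G : ℝ≥0∞}

/-- Deterministic chaining: a lower semicontinuous, approximately additive functional of intervals
that is bounded by `|I| ^ γ` on dyadic intervals is bounded in this way on all intervals. -/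
theorem chain_bound (hγ : 0 < γ)
    (hF : LowerSemicontinuous fun q : ℝ × ℝ => F q.1 q.2) (h0 : ∀ x, F x x = 0)
    (h1 : ∀ x y z, 0 ≤ x → x ≤ y → y ≤ z → z ≤ 1 → F x z ≤ F x y + F y z +
      G * (ENNReal.ofReal (y - x) ^ (γ / 2) * ENNReal.ofReal (z - y) ^ (γ / 2)))
    (h2 : ∀ x y z, 0 ≤ x → x ≤ y → y ≤ z → z ≤ 1 → F y z ≤ F x z + F x y +
      G * (ENNReal.ofReal (y - x) ^ (γ / 2) * ENNReal.ofReal (z - y) ^ (γ / 2)))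
    (hK : ∀ m i : ℕ, i < 2 ^ m →
      F ((i : ℝ) / 2 ^ m) (((i : ℝ) + 1) / 2 ^ m) ≤ K * chainRatio γ ^ (2 * m))
    {x y : ℝ} (hx : 0 ≤ x) (hxy : x ≤ y) (hy : y ≤ 1) :
    F x y ≤ chainConst γ * (K + G) * ENNReal.ofReal (y - x) ^ γ := by
  rcases hxy.eq_or_lt with rfl | hlt
  · simp [h0]
  have hy0 : 0 ≤ y := hx.trans hxy
  set q := chainRatio γ with hq
  have hq1 : q ≤ 1 := (chainRatio_lt_one hγ).le
  -- The starting level is the one whose cells are comparable with `[x, y]`: the dyadic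
  -- approximations of `x` and `y` are then one or two cells apart.
  obtain ⟨m0, hm1, hm2⟩ : ∃ m : ℕ, ((2 : ℝ) ^ m)⁻¹ ≤ y - x ∧ y - x < 2 * ((2 : ℝ) ^ m)⁻¹ := by
    obtain ⟨k, hk1, hk2⟩ := exists_nat_pow_near_of_lt_one (x := y - x) (y := (1 / 2 : ℝ))
      (by linarith) (by linarith) (by norm_num) (by norm_num)
    rcases hk2.eq_or_lt with h | h
    · refine ⟨k, ?_, ?_⟩
      · rw [h]; simp
      · rw [h]; simp [pow_pos]
    · refine ⟨k + 1, ?_, ?_⟩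
      · simpa using hk1.le
      · have : (2:ℝ) * (2 ^ (k + 1))⁻¹ = (1/2) ^ k := by
          rw [pow_succ, one_div, inv_pow]; field_simp
        rw [this]; exact h
  -- a single dyadic step
  have step : ∀ m, ∀ z, 0 ≤ z → z ≤ 1 →
      F (dyad m z) (dyad (m + 1) z) ≤ K * q ^ (2 * (m + 1)) ∧
      dyad m z ≤ dyad (m + 1) z ∧ dyad (m + 1) z - dyad m z ≤ (2 ^ (m + 1))⁻¹ := by
    intro m z hz hz1
    obtain ⟨i, hi, h | h⟩ := dyad_succ hz m
    · rw [h, hi]; simp [h0]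
    · have hi2 : i < 2 ^ (m + 1) := by
        have := (dyad_le hz (m + 1)).trans hz1
        rw [h, div_le_one (by positivity)] at this
        have : ((i + 1 : ℕ) : ℝ) ≤ ((2 ^ (m + 1) : ℕ) : ℝ) := by push_cast; exact this
        exact Nat.lt_of_succ_le (by exact_mod_cast this)
      rw [h, hi]
      refine ⟨hK _ _ hi2, by gcongr; linarith, le_of_eq ?_⟩
      field_simp
      ring
  have hx1 : x ≤ 1 := hxy.trans hy
  -- base case
  have hbase : F (dyad m0 x) (dyad m0 y) ≤ (2 * K + G) * q ^ (2 * m0) := by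
    set i := ⌊x * 2 ^ m0⌋₊ with hi
    set j := ⌊y * 2 ^ m0⌋₊ with hj
    have hpow : (0 : ℝ) < 2 ^ m0 := by positivity
    have hm1' : 1 ≤ (y - x) * 2 ^ m0 := by
      have := mul_le_mul_of_nonneg_right hm1 hpow.le
      rwa [inv_mul_cancel₀ hpow.ne'] at this
    have hm2' : (y - x) * 2 ^ m0 < 2 := by
      have := mul_lt_mul_of_pos_right hm2 hpow
      rwa [mul_assoc, inv_mul_cancel₀ hpow.ne', mul_one] at this
    have hij1 : i + 1 ≤ j := by
      apply Nat.le_floor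
      push_cast
      have := Nat.floor_le (a := x * 2 ^ m0) (by positivity)
      nlinarith
    have hij2 : j < i + 3 := by
      rw [hj, Nat.floor_lt (by positivity)]
      push_cast
      have := Nat.lt_floor_add_one (x * 2 ^ m0)
      nlinarith
    have hj2 : j ≤ 2 ^ m0 := by
      have : (j : ℝ) ≤ ((2 ^ m0 : ℕ) : ℝ) := by
        push_cast
        refine (Nat.floor_le (by positivity)).trans ?_
        nlinarith
      exact_mod_cast this
    have ex : dyad m0 x = (i : ℝ) / 2 ^ m0 := rfl
    have ey : dyad m0 y = (j : ℝ) / 2 ^ m0 := rfl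
    obtain h | h : j = i + 1 ∨ j = i + 1 + 1 := by omega
    · rw [ex, ey, h]
      push_cast
      refine (hK m0 i (by omega)).trans ?_
      gcongr
      rw [two_mul, add_assoc]
      exact le_self_add
    · rw [ex, ey, h]
      have e1 : ((i : ℝ) + 1) / 2 ^ m0 - i / 2 ^ m0 = (2 ^ m0)⁻¹ := by field_simp; ring
      have e2 : (((i + 1 + 1 : ℕ)) : ℝ) / 2 ^ m0 - ((i : ℝ) + 1) / 2 ^ m0 = (2 ^ m0)⁻¹ := by
        push_cast; field_simp; ring
      have := h1 ((i : ℝ) / 2 ^ m0) (((i : ℝ) + 1) / 2 ^ m0) ((i + 1 + 1 : ℕ) / 2 ^ m0)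
        (by positivity) (by gcongr; linarith) (by push_cast; gcongr; linarith)
        (by rw [div_le_one hpow]; rw [h] at hj2; exact_mod_cast hj2)
      refine this.trans ?_
      rw [e1, e2, ofReal_inv_two_pow_rpow, ← hq]
      have k1 := hK m0 i (by omega)
      have k2 := hK m0 (i + 1) (by omega)
      push_cast at k2 ⊢
      calc _ ≤ K * q ^ (2 * m0) + K * q ^ (2 * m0) + G * (q ^ m0 * q ^ m0) := by gcongr
        _ = _ := by ring
  set c := (2 * K + 2 * 4 ^ (γ / 2) * G) * q ^ (2 * m0) with hc
  -- Passing to the next level adds at most one cell at the right end (`h1`) and removes at most one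
  -- at the left end (`h2`). In the error term one length is at most four cells of level `m0`, the
  -- other one cell of level `m + 1`; with the exponent `γ` halved this is of order `q ^ m0 * q ^ (m
  -- + 1)`, hence geometrically summable.
  have hrec : ∀ d, F (dyad (m0 + d) x) (dyad (m0 + d) y) ≤
      (2 * K + G) * q ^ (2 * m0) + c * ∑ j ∈ Finset.range d, q ^ j := by
    intro d
    induction d with
    | zero => simpa using hbase
    | succ d ih =>
      set m := m0 + d with hm
      obtain ⟨sx1, sx2, sx3⟩ := step m x hx hx1
      obtain ⟨sy1, sy2, sy3⟩ := step m y hy0 hy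
      have hle : (2 ^ m : ℝ)⁻¹ ≤ (2 ^ m0)⁻¹ := by
        exact inv_anti₀ (by positivity) (pow_le_pow_right₀ (by norm_num) (by omega))
      -- The ends stay ordered: `x` lies at least `2^{-m0}` to the left of `y`, and rounding `y`
      -- down loses less than `2^{-m}`.
      have hsep : dyad (m + 1) x ≤ dyad m y := by
        have a1 := dyad_le hx (m + 1)
        have a2 := lt_dyad_add y m
        linarith
      have dx0 := dyad_nonneg m x
      have dy1 := (dyad_le hy0 (m + 1)).trans hy
      have dyb := dyad_le hy0 m
      have dyb' := dyad_le hy0 (m + 1)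
      have dxb := lt_dyad_add x m
      have b1 := h1 (dyad m x) (dyad m y) (dyad (m + 1) y) dx0 (sx2.trans hsep) sy2 dy1
      have b2 := h2 (dyad m x) (dyad (m + 1) x) (dyad (m + 1) y) dx0 sx2 (hsep.trans sy2) dy1
      have far : ∀ s, s ≤ 4 * (2 ^ m0 : ℝ)⁻¹ → ENNReal.ofReal s ^ (γ / 2) ≤ 4 ^ (γ / 2) * q ^ m0 := by
        intro s hs
        calc ENNReal.ofReal s ^ (γ / 2) ≤ ENNReal.ofReal (4 * (2 ^ m0 : ℝ)⁻¹) ^ (γ / 2) := by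
              gcongr
          _ = _ := by
              rw [ENNReal.ofReal_mul (by norm_num), ENNReal.mul_rpow_of_nonneg _ _ (by linarith),
                ofReal_inv_two_pow_rpow, ENNReal.ofReal_ofNat]
      have near : ∀ s, s ≤ (2 ^ (m + 1) : ℝ)⁻¹ → ENNReal.ofReal s ^ (γ / 2) ≤ q ^ (m + 1) := by
        intro s hs
        rw [hq, ← ofReal_inv_two_pow_rpow]
        gcongr
      have f1 := far (dyad m y - dyad m x) (by linarith)
      have n1 := near _ sy3
      have f2 := far (dyad (m + 1) y - dyad (m + 1) x) (by linarith)
      have n2 := near _ sx3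
      have hqm : q ^ (m + 1) ≤ q ^ m0 * q ^ d := by
        rw [← pow_add]
        exact pow_le_pow_right_of_le_one' hq1 (by omega)
      have hqm2 : q ^ (2 * (m + 1)) ≤ q ^ (2 * m0) * q ^ d := by
        rw [← pow_add]
        exact pow_le_pow_right_of_le_one' hq1 (by omega)
      rw [← add_assoc]
      calc F (dyad (m + 1) x) (dyad (m + 1) y)
          ≤ (F (dyad m x) (dyad m y) + K * q ^ (2 * (m + 1)) +
              G * ((4 ^ (γ / 2) * q ^ m0) * q ^ (m + 1))) + K * q ^ (2 * (m + 1)) +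
              G * (q ^ (m + 1) * (4 ^ (γ / 2) * q ^ m0)) := by
            refine b2.trans ?_
            gcongr
            refine b1.trans ?_
            gcongr
        _ = F (dyad m x) (dyad m y) + (2 * K * q ^ (2 * (m + 1)) +
              2 * 4 ^ (γ / 2) * G * (q ^ m0 * q ^ (m + 1))) := by ring
        _ ≤ ((2 * K + G) * q ^ (2 * m0) + c * ∑ j ∈ Finset.range d, q ^ j) +
              (2 * K * (q ^ (2 * m0) * q ^ d) +
              2 * 4 ^ (γ / 2) * G * (q ^ m0 * (q ^ m0 * q ^ d))) := by gcongr
        _ = _ := by rw [Finset.sum_range_succ, hc]; ring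
  have hfin : ∀ d, F (dyad (m0 + d) x) (dyad (m0 + d) y) ≤
      chainConst γ * (K + G) * ENNReal.ofReal (y - x) ^ γ := by
    intro d
    have hg : ∑ j ∈ Finset.range d, q ^ j ≤ (1 - q)⁻¹ := by
      rw [← ENNReal.tsum_geometric]
      exact ENNReal.sum_le_tsum _
    have hqq : q ^ (2 * m0) ≤ ENNReal.ofReal (y - x) ^ γ := by
      have : q ^ (2 * m0) = ENNReal.ofReal (((2 : ℝ) ^ m0)⁻¹) ^ γ := by
        rw [mul_comm, pow_mul, hq, ← ofReal_inv_two_pow_rpow, ← ENNReal.rpow_natCast,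
          ← ENNReal.rpow_mul]
        congr 1; push_cast; ring
      rw [this]
      gcongr
    calc _ ≤ (2 * K + G) * q ^ (2 * m0) + c * (1 - q)⁻¹ := by
          refine (hrec d).trans ?_
          gcongr
      _ = (2 * K + G + (2 * K + 2 * 4 ^ (γ / 2) * G) * (1 - q)⁻¹) * q ^ (2 * m0) := by
          rw [hc]; ring
      _ ≤ (2 * (K + G) + (2 * (K + G) + 2 * 4 ^ (γ / 2) * (K + G)) * (1 - q)⁻¹) *
            ENNReal.ofReal (y - x) ^ γ := by
          have i1 : K ≤ K + G := le_self_add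
          have i2 : G ≤ K + G := le_add_self
          have i3 : 2 * K + G ≤ 2 * (K + G) := by
            rw [mul_add, two_mul G]; gcongr; exact le_self_add
          gcongr
      _ = _ := by unfold chainConst; ring
  have hlim : Tendsto (fun d => (dyad (m0 + d) x, dyad (m0 + d) y)) atTop (𝓝 (x, y)) := by
    have := ((tendsto_dyad hx).prodMk_nhds (tendsto_dyad hy0)).comp (tendsto_add_atTop_nat m0)
    simpa [Function.comp_def, add_comm] using this
  -- Lower semicontinuity makes sublevel sets closed, so the bound survives the limit of dyadic end
  -- points.
  have hcl := hF.isClosed_preimage (chainConst γ * (K + G) * ENNReal.ofReal (y - x) ^ γ)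
  exact hcl.mem_of_tendsto hlim (Eventually.of_forall hfin)

end RoughHeat

namespace RoughHeat

/-! ### Moments -/

section Moments

variable {Ω : Type*} [MeasurableSpace Ω] {P : Measure Ω}

/-- The `L^r(P)` norm of a function with values in `[0, ∞]`. -/
noncomputable def mom (P : Measure Ω) (r : ℝ) (f : Ω → ℝ≥0∞) : ℝ≥0∞ :=
  (∫⁻ ω, f ω ^ r ∂P) ^ (1 / r)

lemma mom_rpow {r : ℝ} (hr : 0 < r) (f : Ω → ℝ≥0∞) : mom P r f ^ r = ∫⁻ ω, f ω ^ r ∂P := by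
  unfold mom
  rw [← ENNReal.rpow_mul, one_div_mul_cancel hr.ne', ENNReal.rpow_one]

lemma mom_le_iff {r : ℝ} (hr : 0 < r) {f : Ω → ℝ≥0∞} {M : ℝ≥0∞} :
    mom P r f ≤ M ↔ ∫⁻ ω, f ω ^ r ∂P ≤ M ^ r := by
  rw [← mom_rpow hr, ENNReal.rpow_le_rpow_iff hr]

lemma mom_mono_ae {r : ℝ} (hr : 0 < r) {f g : Ω → ℝ≥0∞} (h : ∀ᵐ ω ∂P, f ω ≤ g ω) :
    mom P r f ≤ mom P r g := by
  refine ENNReal.rpow_le_rpow (lintegral_mono_ae ?_) (by positivity)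
  filter_upwards [h] with ω hω
  gcongr

lemma mom_mono {r : ℝ} (hr : 0 < r) {f g : Ω → ℝ≥0∞} (h : ∀ ω, f ω ≤ g ω) :
    mom P r f ≤ mom P r g := mom_mono_ae hr (Eventually.of_forall h)

lemma mom_const_mul {r : ℝ} (hr : 0 < r) {c : ℝ≥0∞} (hc : c ≠ ⊤) (f : Ω → ℝ≥0∞) :
    mom P r (fun ω => c * f ω) = c * mom P r f := by
  unfold mom
  simp_rw [ENNReal.mul_rpow_of_nonneg _ _ hr.le]
  rw [lintegral_const_mul' _ _ (ENNReal.rpow_ne_top_of_nonneg hr.le hc),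
    ENNReal.mul_rpow_of_nonneg _ _ (by positivity), ← ENNReal.rpow_mul, mul_one_div_cancel hr.ne',
    ENNReal.rpow_one]

lemma mom_zero {r : ℝ} (hr : 0 < r) : mom P r (fun _ => 0) = 0 := by
  simp [mom, hr]

lemma mom_add_le {r : ℝ} (hr : 1 ≤ r) {f g : Ω → ℝ≥0∞} (hf : AEMeasurable f P)
    (hg : AEMeasurable g P) : mom P r (fun ω => f ω + g ω) ≤ mom P r f + mom P r g :=
  ENNReal.lintegral_Lp_add_le hf hg hr

lemma mom_sum_le {ι : Type*} {r : ℝ} (hr : 1 ≤ r) (s : Finset ι) {f : ι → Ω → ℝ≥0∞}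
    (hf : ∀ i ∈ s, AEMeasurable (f i) P) :
    mom P r (fun ω => ∑ i ∈ s, f i ω) ≤ ∑ i ∈ s, mom P r (f i) := by
  classical
  induction s using Finset.induction_on with
  | empty => simp [mom_zero (zero_lt_one.trans_le hr)]
  | insert a s ha ih =>
    simp_rw [Finset.sum_insert ha]
    refine (mom_add_le hr (hf a (by simp)) ?_).trans ?_
    · exact Finset.aemeasurable_fun_sum _ fun i hi => hf i (by simp [hi])
    · gcongr
      exact ih fun i hi => hf i (by simp [hi])

/-- Cauchy–Schwarz for the `r`-th powers. Because of this, paths are controlled in `L^{2r}` and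
iterated integrals in `L^r`. -/
lemma mom_mul_le {r : ℝ} (hr : 0 < r) {f g : Ω → ℝ≥0∞} (hf : AEMeasurable f P)
    (hg : AEMeasurable g P) :
    mom P r (fun ω => f ω * g ω) ≤ mom P (2 * r) f * mom P (2 * r) g := by
  rw [mom_le_iff hr]
  have h := ENNReal.lintegral_mul_le_Lp_mul_Lq P (p := 2) (q := 2) (by constructor <;> norm_num)
    (hf.pow_const r) (hg.pow_const r)
  simp only [Pi.mul_apply, ← ENNReal.rpow_mul, mul_comm r 2] at h
  simp_rw [ENNReal.mul_rpow_of_nonneg _ _ hr.le]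
  refine h.trans (le_of_eq ?_)
  unfold mom
  rw [← ENNReal.rpow_mul, ← ENNReal.rpow_mul]
  congr 2 <;> field_simp

lemma mom_le_mom [IsProbabilityMeasure P] {p r : ℝ} (hp : 0 < p) (hpr : p ≤ r) {f : Ω → ℝ≥0∞}
    (hf : AEMeasurable f P) : mom P p f ≤ mom P r f := by
  have := eLpNorm'_le_eLpNorm'_of_exponent_le (μ := P) hp hpr (f := f) hf.aestronglyMeasurable
  simpa [eLpNorm', mom] using this

/-- Fatou's lemma for moments. -/
lemma mom_le_of_tendsto {r : ℝ} (hr : 0 < r) {f : ℕ → Ω → ℝ≥0∞} {g : Ω → ℝ≥0∞}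
    {M : ℕ → ℝ≥0∞} {M' : ℝ≥0∞}
    (hf : ∀ m, AEMeasurable (f m) P) (hfg : ∀ᵐ ω ∂P, Tendsto (fun m => f m ω) atTop (𝓝 (g ω)))
    (hM : ∀ m, mom P r (f m) ≤ M m) (hM' : Tendsto M atTop (𝓝 M')) :
    mom P r g ≤ M' := by
  rw [mom_le_iff hr]
  calc ∫⁻ ω, g ω ^ r ∂P = ∫⁻ ω, liminf (fun m => f m ω ^ r) atTop ∂P := by
        refine lintegral_congr_ae ?_
        filter_upwards [hfg] with ω hω
        exact ((ENNReal.continuous_rpow_const.tendsto _).comp hω).liminf_eq.symm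
    _ ≤ liminf (fun m => ∫⁻ ω, f m ω ^ r ∂P) atTop :=
        lintegral_liminf_le' fun m => (hf m).pow_const r
    _ ≤ liminf (fun m => M m ^ r) atTop :=
        liminf_le_liminf (Eventually.of_forall fun m => (mom_le_iff hr).1 (hM m))
    _ = M' ^ r := ((ENNReal.continuous_rpow_const.tendsto _).comp hM').liminf_eq

/-- The constant of the Kolmogorov criterion; here `κ = r (β - γ)`. -/
noncomputable def kolConst (r κ : ℝ) : ℝ≥0∞ := ((1 - 2 ^ (1 - κ))⁻¹) ^ (1 / r)

lemma kolConst_ne_top {r κ : ℝ} (hr : 0 < r) (hκ : 1 < κ) : kolConst r κ ≠ ⊤ := by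
  refine ENNReal.rpow_ne_top_of_nonneg (by positivity) ?_
  rw [ENNReal.inv_ne_top]
  exact (tsub_pos_of_lt (ENNReal.rpow_lt_one_of_one_lt_of_neg (by norm_num) (by linarith))).ne'

lemma chainRatio_ne_zero (γ : ℝ) : chainRatio γ ≠ 0 := by
  unfold chainRatio
  simp [ENNReal.rpow_eq_zero_iff]

lemma chainRatio_ne_top (γ : ℝ) : chainRatio γ ≠ ⊤ := by
  unfold chainRatio
  simp [ENNReal.rpow_eq_top_iff]

/-- The probabilistic part of the Kolmogorov criterion: random variables indexed by the dyadic
intervals have a common majorant, relative to the lengths of the intervals. -/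
theorem exists_dyadic_majorant {A : ℕ → ℕ → Ω → ℝ≥0∞} (hA : ∀ m i, Measurable (A m i))
    {r β γ : ℝ} (hr : 0 < r) {M : ℝ≥0∞}
    (hM : ∀ m i, i < 2 ^ m → mom P r (A m i) ≤ M * chainRatio β ^ (2 * m)) :
    ∃ K : Ω → ℝ≥0∞, Measurable K ∧ mom P r K ≤ kolConst r (r * (β - γ)) * M ∧
      ∀ ω m i, i < 2 ^ m → A m i ω ≤ K ω * chainRatio γ ^ (2 * m) := by
  set q := chainRatio γ with hq
  have hq0 : ∀ m, q ^ m ≠ 0 := fun m => pow_ne_zero _ (chainRatio_ne_zero γ)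
  have hqt : ∀ m, q ^ m ≠ ⊤ := fun m => ENNReal.pow_ne_top (chainRatio_ne_top γ)
  -- The majorant is the `ℓ^r` norm, over all dyadic cells, of the values divided by the cell length
  -- to the power `γ`: it dominates each of them, and its `r`-th moment is a sum of moments.
  refine ⟨fun ω => (∑' m, ∑ i ∈ Finset.range (2 ^ m), ((q ^ (2 * m))⁻¹ * A m i ω) ^ r) ^ (1 / r),
    ?_, ?_, ?_⟩
  · refine (Measurable.tsum fun m => ?_).pow_const _
    exact Finset.measurable_fun_sum _ fun i _ => ((hA m i).const_mul _).pow_const _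
  · rw [mom_le_iff hr]
    simp_rw [← ENNReal.rpow_mul, one_div_mul_cancel hr.ne', ENNReal.rpow_one]
    have hmeas : ∀ m i, Measurable fun ω => ((q ^ (2 * m))⁻¹ * A m i ω) ^ r :=
      fun m i => ((hA m i).const_mul _).pow_const _
    rw [lintegral_tsum fun m => (Finset.measurable_fun_sum _ fun i _ => hmeas m i).aemeasurable]
    -- Level `m` has `2 ^ m` cells, each contributing at most `M ^ r 2^{-r(β-γ)m}`. The geometric
    -- series is summed in `[0, ∞]`; the condition `r (β - γ) > 1` matters only for finiteness of
    -- the constant.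
    have key : ∀ m, ∫⁻ ω, ∑ i ∈ Finset.range (2 ^ m), ((q ^ (2 * m))⁻¹ * A m i ω) ^ r ∂P ≤
        M ^ r * (2 ^ (1 - r * (β - γ))) ^ m := by
      intro m
      rw [lintegral_finsetSum _ fun i _ => hmeas m i]
      have h1 : ∀ i ∈ Finset.range (2 ^ m), ∫⁻ ω, ((q ^ (2 * m))⁻¹ * A m i ω) ^ r ∂P ≤
          ((q ^ (2 * m))⁻¹ * (M * chainRatio β ^ (2 * m))) ^ r := by
        intro i hi
        rw [← mom_le_iff hr, mom_const_mul hr (ENNReal.inv_ne_top.2 (hq0 _))]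
        gcongr
        exact hM m i (Finset.mem_range.1 hi)
      refine (Finset.sum_le_card_nsmul _ _ _ h1).trans (le_of_eq ?_)
      rw [Finset.card_range, nsmul_eq_mul]
      have h2 : (q ^ (2 * m))⁻¹ * (M * chainRatio β ^ (2 * m)) =
          M * (2 : ℝ≥0∞) ^ (-(β - γ) * m) := by
        rw [hq, mul_left_comm]
        congr 1
        unfold chainRatio
        rw [← ENNReal.rpow_natCast, ← ENNReal.rpow_natCast, ← ENNReal.rpow_mul,
          ← ENNReal.rpow_mul, ← ENNReal.rpow_neg, ← ENNReal.rpow_add _ _ (by norm_num)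
          (by norm_num)]
        congr 1; push_cast; ring
      rw [h2, ENNReal.mul_rpow_of_nonneg _ _ hr.le, mul_left_comm]
      congr 1
      rw [← ENNReal.rpow_natCast, ← ENNReal.rpow_mul, ← ENNReal.rpow_mul]
      push_cast
      rw [← ENNReal.rpow_natCast, ← ENNReal.rpow_add _ _ (by norm_num) (by norm_num)]
      congr 1; ring
    refine (ENNReal.tsum_le_tsum key).trans (le_of_eq ?_)
    rw [ENNReal.tsum_mul_left, ENNReal.tsum_geometric, ENNReal.mul_rpow_of_nonneg _ _ hr.le,
      kolConst, ← ENNReal.rpow_mul, one_div_mul_cancel hr.ne', ENNReal.rpow_one, mul_comm]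
  · intro ω m i hi
    have h1 : (q ^ (2 * m))⁻¹ * A m i ω ≤
        (∑' m, ∑ i ∈ Finset.range (2 ^ m), ((q ^ (2 * m))⁻¹ * A m i ω) ^ r) ^ (1 / r) := by
      rw [one_div, ENNReal.le_rpow_inv_iff hr]
      refine le_trans ?_ (ENNReal.le_tsum m)
      exact Finset.single_le_sum (f := fun i => ((q ^ (2 * m))⁻¹ * A m i ω) ^ r)
        (fun _ _ => zero_le) (Finset.mem_range.2 hi)
    calc A m i ω = (q ^ (2 * m))⁻¹ * A m i ω * q ^ (2 * m) := by
          rw [mul_comm, ← mul_assoc, ENNReal.mul_inv_cancel (hq0 _) (hqt _), one_mul]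
      _ ≤ _ := by gcongr

end Moments

end RoughHeat

namespace RoughHeat

/-! ### Hölder norms in time of paths, and the Kolmogorov criterion in time -/

section PathNorm

variable {V : Type*} [NormedAddCommGroup V] {α : ℝ} {T : ℝ≥0}

/-- The norm of `𝒞^α([0, T], V)`. -/
noncomputable def pathNorm (α : ℝ) (T : ℝ≥0) (u : ℝ≥0 → V) : ℝ≥0∞ :=
  timeNorm (fun v : V => ‖v‖ₑ) α T u

lemma enorm_sub_triangle (a b c : V) : ‖a - c‖ₑ ≤ ‖a - b‖ₑ + ‖b - c‖ₑ := by
  simp_rw [← edist_eq_enorm_sub]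
  exact edist_triangle a b c

lemma timeNorm_le {E : Type*} [AddCommGroup E] {N : E → ℝ≥0∞} {F : ℝ≥0 → E} {B B' : ℝ≥0∞}
    (h1 : ∀ t ≤ T, N (F t) ≤ B)
    (h2 : ∀ s ≤ T, ∀ t ≤ T, N (F t - F s) ≤ B' * edist s t ^ α) :
    timeNorm N α T F ≤ B + B' := by
  unfold timeNorm
  gcongr
  · exact iSup₂_le fun t ht => h1 t ht.2
  · refine iSup₂_le fun s hs => iSup₂_le fun t ht => iSup_le fun _ => ?_
    exact ENNReal.div_le_of_le_mul (h2 s hs.2 t ht.2)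

lemma enorm_le_pathNorm (u : ℝ≥0 → V) {t : ℝ≥0} (ht : t ≤ T) : ‖u t‖ₑ ≤ pathNorm α T u := by
  refine le_trans ?_ le_self_add
  exact le_iSup₂_of_le t ⟨zero_le, ht⟩ le_rfl

lemma enorm_sub_le_pathNorm (u : ℝ≥0 → V) {s t : ℝ≥0} (hs : s ≤ T) (ht : t ≤ T) :
    ‖u t - u s‖ₑ ≤ pathNorm α T u * edist s t ^ α := by
  rcases eq_or_ne s t with rfl | hst
  · simp
  have h0 : edist s t ≠ 0 := by simpa using hst
  have h1 : edist s t ≠ ⊤ := edist_ne_top s t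
  rw [← ENNReal.div_le_iff_le_mul
    (Or.inl (by simp [ENNReal.rpow_eq_zero_iff, h0, h1]))
    (Or.inl (by simp [ENNReal.rpow_eq_top_iff, h0, h1]))]
  refine le_trans ?_ le_add_self
  exact le_iSup₂_of_le s ⟨zero_le, hs⟩ (le_iSup₂_of_le t ⟨zero_le, ht⟩ (le_iSup_of_le hst le_rfl))

lemma pathNorm_zero : pathNorm α T (fun _ => (0 : V)) = 0 := by
  simp [pathNorm, timeNorm]

lemma pathNorm_neg (u : ℝ≥0 → V) : pathNorm α T (fun t => -u t) = pathNorm α T u := by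
  unfold pathNorm timeNorm
  simp only [enorm_neg]
  congr! 8 with s _ t
  rw [show -u t - -u s = -(u t - u s) by abel, enorm_neg]

lemma pathNorm_add_le (u v : ℝ≥0 → V) :
    pathNorm α T (fun t => u t + v t) ≤ pathNorm α T u + pathNorm α T v := by
  unfold pathNorm timeNorm
  rw [add_add_add_comm]
  gcongr
  · refine iSup₂_le fun t ht => (enorm_add_le _ _).trans ?_
    gcongr
    · exact le_iSup₂_of_le t ht le_rfl
    · exact le_iSup₂_of_le t ht le_rfl
  · refine iSup₂_le fun s hs => iSup₂_le fun t ht => iSup_le fun hst => ?_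
    have : u t + v t - (u s + v s) = (u t - u s) + (v t - v s) := by abel
    rw [this]
    refine (ENNReal.div_le_div_right (enorm_add_le _ _) _).trans ?_
    rw [ENNReal.add_div]
    gcongr
    · exact le_iSup₂_of_le s hs (le_iSup₂_of_le t ht (le_iSup_of_le hst le_rfl))
    · exact le_iSup₂_of_le s hs (le_iSup₂_of_le t ht (le_iSup_of_le hst le_rfl))

lemma pathNorm_sub_le (u v : ℝ≥0 → V) :
    pathNorm α T (fun t => u t - v t) ≤ pathNorm α T u + pathNorm α T v := by
  simp_rw [sub_eq_add_neg]
  exact (pathNorm_add_le _ _).trans_eq (by rw [pathNorm_neg])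

/-- A Hölder norm that includes the supremum is submultiplicative, since the increment of a product
is `u_{ts} v_t + u_s v_{ts}`. Applied to `tensor`, this bounds the defect in Chen's relation. -/
lemma pathNorm_bilin_le {V' W : Type*} [NormedAddCommGroup V'] [NormedAddCommGroup W]
    (m : V → V' → W) (hsub : ∀ a a' b b', m a b - m a' b' = m (a - a') b + m a' (b - b'))
    (hm : ∀ a b, ‖m a b‖ₑ ≤ ‖a‖ₑ * ‖b‖ₑ) (u : ℝ≥0 → V) (v : ℝ≥0 → V') :
    pathNorm α T (fun t => m (u t) (v t)) ≤ pathNorm α T u * pathNorm α T v := by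
  set U₁ := ⨆ t ∈ Icc 0 T, ‖u t‖ₑ with hU₁
  set U₂ := ⨆ (s ∈ Icc 0 T) (t ∈ Icc 0 T) (_ : s ≠ t), ‖u t - u s‖ₑ / edist s t ^ α with hU₂
  set V₁ := ⨆ t ∈ Icc 0 T, ‖v t‖ₑ with hV₁
  set V₂ := ⨆ (s ∈ Icc 0 T) (t ∈ Icc 0 T) (_ : s ≠ t), ‖v t - v s‖ₑ / edist s t ^ α with hV₂
  have hU : pathNorm α T u = U₁ + U₂ := rfl
  have hV : pathNorm α T v = V₁ + V₂ := rfl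
  rw [hU, hV]
  have u1 : ∀ t ∈ Icc 0 T, ‖u t‖ₑ ≤ U₁ := fun t ht => le_iSup₂_of_le t ht le_rfl
  have v1 : ∀ t ∈ Icc 0 T, ‖v t‖ₑ ≤ V₁ := fun t ht => le_iSup₂_of_le t ht le_rfl
  have hle : pathNorm α T (fun t => m (u t) (v t)) ≤ U₁ * V₁ + (U₂ * V₁ + U₁ * V₂) := by
    unfold pathNorm timeNorm
    gcongr
    · exact iSup₂_le fun t ht => (hm _ _).trans (mul_le_mul' (u1 t ht) (v1 t ht))
    · refine iSup₂_le fun s hs => iSup₂_le fun t ht => iSup_le fun hst => ?_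
      have u2 : ‖u t - u s‖ₑ / edist s t ^ α ≤ U₂ :=
        le_iSup₂_of_le s hs (le_iSup₂_of_le t ht (le_iSup_of_le hst le_rfl))
      have v2 : ‖v t - v s‖ₑ / edist s t ^ α ≤ V₂ :=
        le_iSup₂_of_le s hs (le_iSup₂_of_le t ht (le_iSup_of_le hst le_rfl))
      rw [hsub]
      calc _ ≤ (‖u t - u s‖ₑ * ‖v t‖ₑ + ‖u s‖ₑ * ‖v t - v s‖ₑ) / edist s t ^ α := by
            gcongr
            exact (enorm_add_le _ _).trans (add_le_add (hm _ _) (hm _ _))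
        _ = ‖u t - u s‖ₑ / edist s t ^ α * ‖v t‖ₑ + ‖u s‖ₑ * (‖v t - v s‖ₑ / edist s t ^ α) := by
            simp only [ENNReal.div_eq_inv_mul]; ring
        _ ≤ _ := by
            gcongr
            · exact v1 t ht
            · exact u1 s hs
  refine hle.trans ?_
  calc U₁ * V₁ + (U₂ * V₁ + U₁ * V₂) ≤ U₁ * V₁ + (U₂ * V₁ + U₁ * V₂) + U₂ * V₂ := le_self_add
    _ = _ := by ring

/-- A supremum of continuous functions. Continuity in `q` is known for each fixed time only, which
is why `chain_bound` asks for no more than lower semicontinuity. -/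
lemma lowerSemicontinuous_pathNorm {Q : Type*} [TopologicalSpace Q] {u : Q → ℝ≥0 → V}
    (hu : ∀ t, Continuous fun q => u q t) : LowerSemicontinuous fun q => pathNorm α T (u q) := by
  unfold pathNorm timeNorm
  refine LowerSemicontinuous.add ?_ ?_
  · exact lowerSemicontinuous_iSup fun t => lowerSemicontinuous_iSup fun _ =>
      (hu t).enorm.lowerSemicontinuous
  · refine lowerSemicontinuous_iSup fun s => lowerSemicontinuous_iSup fun _ =>
      lowerSemicontinuous_iSup fun t => lowerSemicontinuous_iSup fun _ =>
      lowerSemicontinuous_iSup fun hst => ?_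
    refine Continuous.lowerSemicontinuous ?_
    have h0 : edist s t ^ α ≠ 0 := by
      have h0 : edist s t ≠ 0 := by simpa using hst
      simp [ENNReal.rpow_eq_zero_iff, h0, edist_ne_top]
    exact (ENNReal.continuous_div_const _ h0).comp (((hu t).sub (hu s)).enorm)

end PathNorm

section Kolmogorov

variable {Ω : Type*} [MeasurableSpace Ω] {P : Measure Ω} {V : Type*} [NormedAddCommGroup V]

lemma ofReal_dyadic_rpow (β : ℝ) (m : ℕ) :
    ENNReal.ofReal (((2 : ℝ) ^ m)⁻¹) ^ β = chainRatio β ^ (2 * m) := by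
  rw [mul_comm, pow_mul, ← ofReal_inv_two_pow_rpow, ← ENNReal.rpow_natCast, ← ENNReal.rpow_mul]
  congr 1; push_cast; ring

/-- The Kolmogorov criterion in time, for processes that start in `0`. -/
theorem exists_pathNorm_majorant {α β r : ℝ} (hα : 0 < α) (hr : 0 < r)
    (hκ : 1 < r * (β - α)) (T : ℝ≥0) :
    ∃ C : ℝ≥0, ∀ (u : Ω → ℝ≥0 → V) (M : ℝ≥0∞), (∀ ω, Continuous (u ω)) → (∀ ω, u ω 0 = 0) →
      (∀ s t, Measurable fun ω => ‖u ω t - u ω s‖ₑ) →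
      (∀ s ≤ T, ∀ t ≤ T, mom P r (fun ω => ‖u ω t - u ω s‖ₑ) ≤ M * edist s t ^ β) →
      ∃ K : Ω → ℝ≥0∞, Measurable K ∧ mom P r K ≤ C * M ∧ ∀ ω, pathNorm α T (u ω) ≤ K ω := by
  -- The chaining runs on `[0, 1]` after division of time by `T`, so `T = 0` is treated apart.
  rcases eq_or_ne T 0 with rfl | hT
  · refine ⟨0, fun u M _ h0 _ _ => ⟨fun _ => 0, measurable_const, by simp [mom_zero hr], fun ω => ?_⟩⟩
    refine (timeNorm_le (B := 0) (B' := 0) (fun t ht => ?_) fun s hs t ht => ?_).trans (by simp)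
    · rw [nonpos_iff_eq_zero.1 ht, h0]; simp
    · rw [nonpos_iff_eq_zero.1 ht, nonpos_iff_eq_zero.1 hs]; simp
  have hT' : (T : ℝ≥0∞) ≠ 0 := by simpa using hT
  have hTt : (T : ℝ≥0∞) ≠ ⊤ := ENNReal.coe_ne_top
  have hβ : 0 < β := by
    by_contra hb
    have : r * (β - α) ≤ 0 := mul_nonpos_of_nonneg_of_nonpos hr.le (by linarith)
    linarith
  set c : ℝ≥0∞ := chainConst α * (T : ℝ≥0∞) ^ (-α) with hc
  have hcT : c ≠ ⊤ := ENNReal.mul_ne_top (chainConst_ne_top hα)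
    (by simp [ENNReal.rpow_eq_top_iff, hT'])
  set C : ℝ≥0∞ := (c * (T : ℝ≥0∞) ^ α + c) * (kolConst r (r * (β - α)) * (T : ℝ≥0∞) ^ β) with hC
  have hTα : (T : ℝ≥0∞) ^ α ≠ ⊤ := ENNReal.rpow_ne_top_of_nonneg hα.le hTt
  have hTβ : (T : ℝ≥0∞) ^ β ≠ ⊤ := ENNReal.rpow_ne_top_of_nonneg hβ.le hTt
  have hkol := kolConst_ne_top hr hκ
  have hCt : C ≠ ⊤ := by finiteness
  -- The constant is fixed before the process and before `M`; this is what later makes the estimates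
  -- uniform in `ε` and linear in the distance of two systems.
  refine ⟨C.toNNReal, fun u M hu h0 hmeas hM => ?_⟩
  rw [ENNReal.coe_toNNReal hCt]
  set F : Ω → ℝ → ℝ → ℝ≥0∞ := fun ω σ τ =>
    ‖u ω (Real.toNNReal (T * τ)) - u ω (Real.toNNReal (T * σ))‖ₑ with hF
  have hcell : ∀ m i : ℕ, i < 2 ^ m →
      mom P r (fun ω => F ω ((i : ℝ) / 2 ^ m) (((i : ℝ) + 1) / 2 ^ m)) ≤
        (M * (T : ℝ≥0∞) ^ β) * chainRatio β ^ (2 * m) := by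
    intro m i hi
    have i1 : ((i : ℝ) + 1) / 2 ^ m ≤ 1 := by
      rw [div_le_one (by positivity)]
      exact_mod_cast Nat.succ_le_of_lt hi
    have i2 : (i : ℝ) / 2 ^ m ≤ ((i : ℝ) + 1) / 2 ^ m := by gcongr; linarith
    have hle : ∀ τ : ℝ, τ ≤ 1 → Real.toNNReal (T * τ) ≤ T := by
      intro τ hτ
      rw [Real.toNNReal_le_iff_le_coe]
      exact mul_le_of_le_one_right T.2 hτ
    refine (hM _ (hle _ (i2.trans i1)) _ (hle _ i1)).trans (le_of_eq ?_)
    rw [mul_assoc]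
    congr 1
    rw [← ofReal_dyadic_rpow, ← ENNReal.mul_rpow_of_nonneg _ _ hβ.le]
    congr 1
    rw [edist_dist, NNReal.dist_eq, Real.coe_toNNReal _ (by positivity),
      Real.coe_toNNReal _ (by positivity), abs_sub_comm, abs_of_nonneg, ← mul_sub,
      ENNReal.ofReal_mul T.coe_nonneg, ENNReal.ofReal_coe_nnreal]
    · congr 2; field_simp; ring
    · rw [sub_nonneg]; gcongr
  obtain ⟨K, hKm, hKM, hK⟩ := exists_dyadic_majorant
    (A := fun m i ω => F ω ((i : ℝ) / 2 ^ m) (((i : ℝ) + 1) / 2 ^ m)) (γ := α)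
    (fun m i => hmeas _ _) hr hcell
  -- Increments in time are exactly additive, so the error coefficient of the chaining is `0`.
  have hF' : ∀ ω (σ τ : ℝ), 0 ≤ σ → σ ≤ τ → τ ≤ 1 →
      F ω σ τ ≤ chainConst α * (K ω + 0) * ENNReal.ofReal (τ - σ) ^ α := by
    intro ω σ τ hσ hστ hτ
    refine chain_bound hα (F := F ω) ?_ ?_ ?_ ?_ (fun m i hi => hK ω m i hi) hσ hστ hτ
    · refine Continuous.lowerSemicontinuous ?_
      have := hu ω
      simp only [hF]
      fun_prop
    · intro x; simp [hF]
    · intro x y z _ _ _ _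
      simp only [hF, zero_mul, add_zero]
      rw [add_comm]
      exact enorm_sub_triangle _ _ _
    · intro x y z _ _ _ _
      simp only [hF, zero_mul, add_zero]
      rw [enorm_sub_rev (u ω (T * y).toNNReal)]
      exact enorm_sub_triangle _ _ _
  have hst : ∀ ω s t, s ≤ t → t ≤ T → ‖u ω t - u ω s‖ₑ ≤ c * K ω * edist s t ^ α := by
    intro ω s t hst ht
    have hTp : (0 : ℝ) < T := by positivity
    have h := hF' ω (s / T) (t / T) (by positivity) (by gcongr)
      (by rw [div_le_one hTp]; exact_mod_cast ht)
    simp only [hF, mul_div_cancel₀ _ hTp.ne', Real.toNNReal_coe, add_zero] at h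
    refine h.trans (le_of_eq ?_)
    have he : ENNReal.ofReal ((t : ℝ) / T - s / T) = edist s t * (T : ℝ≥0∞)⁻¹ := by
      rw [← sub_div, ENNReal.ofReal_div_of_pos hTp, ENNReal.div_eq_inv_mul, mul_comm,
        edist_dist, NNReal.dist_eq, abs_sub_comm, abs_of_nonneg, ENNReal.ofReal_coe_nnreal]
      rw [sub_nonneg]; exact_mod_cast hst
    rw [he, ENNReal.mul_rpow_of_nonneg _ _ hα.le, ENNReal.inv_rpow, ← ENNReal.rpow_neg, hc]
    ring
  have hst' : ∀ ω, ∀ s ≤ T, ∀ t ≤ T, ‖u ω t - u ω s‖ₑ ≤ c * K ω * edist s t ^ α := by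
    intro ω s hs t ht
    rcases le_total s t with h | h
    · exact hst ω s t h ht
    · rw [enorm_sub_rev, edist_comm]; exact hst ω t s h hs
  refine ⟨fun ω => (c * (T : ℝ≥0∞) ^ α + c) * K ω, hKm.const_mul _, ?_, fun ω => ?_⟩
  · rw [mom_const_mul hr (by finiteness)]
    refine (mul_le_mul_right hKM _).trans (le_of_eq ?_)
    rw [hC]; ring
  · refine (timeNorm_le (B := c * (T : ℝ≥0∞) ^ α * K ω) (B' := c * K ω) (fun t ht => ?_)
      fun s hs t ht => hst' ω s hs t ht).trans (le_of_eq (by ring))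
    -- As the path starts at `0`, its values are increments, at the price of a factor `T ^ α`.
    have := hst' ω 0 zero_le t ht
    rw [h0, sub_zero] at this
    refine this.trans ?_
    have : edist 0 t ≤ (T : ℝ≥0∞) := by
      rw [edist_dist, NNReal.dist_eq]
      simp only [NNReal.coe_zero, zero_sub, abs_neg, NNReal.abs_eq, ENNReal.ofReal_coe_nnreal]
      exact_mod_cast ht
    calc c * K ω * edist 0 t ^ α ≤ c * K ω * (T : ℝ≥0∞) ^ α := by gcongr
      _ = _ := by ring

/-! ### The Kolmogorov criterion in space for path-valued functionals -/

/-- The linear parametrisation of `[-π, π]` by `[0, 1]`, extended to `ℝ`. -/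
noncomputable def segPt (τ : ℝ) : Seg :=
  projIcc (-Real.pi) Real.pi (by linarith [Real.pi_pos]) (-Real.pi + 2 * Real.pi * τ)

lemma continuous_segPt : Continuous segPt := by
  unfold segPt
  exact continuous_projIcc.comp (by fun_prop)

lemma coe_segPt {τ : ℝ} (h0 : 0 ≤ τ) (h1 : τ ≤ 1) : (segPt τ : ℝ) = -Real.pi + 2 * Real.pi * τ := by
  unfold segPt
  rw [projIcc_of_mem]
  constructor <;> nlinarith [Real.pi_pos]

lemma segPt_mono : Monotone segPt := fun σ τ h => by
  unfold segPt
  apply monotone_projIcc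
  have := Real.pi_pos
  gcongr

lemma segPt_surj (x : Seg) : segPt (((x : ℝ) + Real.pi) / (2 * Real.pi)) = x := by
  have hp := Real.pi_pos
  obtain ⟨x, h1, h2⟩ := x
  apply Subtype.ext
  rw [coe_segPt]
  · field_simp; ring
  · exact div_nonneg (by simp; linarith) (by positivity)
  · rw [div_le_one (by positivity)]; simp; linarith

lemma edist_segPt {σ τ : ℝ} (h0 : 0 ≤ σ) (h : σ ≤ τ) (h1 : τ ≤ 1) :
    edist (segPt σ) (segPt τ) = ENNReal.ofReal (2 * Real.pi) * ENNReal.ofReal (τ - σ) := by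
  have hp := Real.pi_pos
  rw [Subtype.edist_eq, coe_segPt h0 (h.trans h1), coe_segPt (h0.trans h) h1, edist_dist,
    Real.dist_eq, ← ENNReal.ofReal_mul (by positivity), abs_sub_comm, abs_of_nonneg]
  · congr 1; ring
  · nlinarith

/-- The Kolmogorov criterion for functionals `E x y` of intervals with values in the paths: moment
bounds on increments in time, and approximate additivity with respect to the interval, imply
a pathwise bound in `𝒞^{α₁}([0, T])` by a power of the length of the interval. -/
theorem exists_interval_majorant {α₁ β₁ γ β r : ℝ} (hα : 0 < α₁) (hγ : 0 < γ) (hr : 0 < r)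
    (hκ₁ : 1 < r * (β₁ - α₁)) (hκ : 1 < r * (β - γ)) (T : ℝ≥0) :
    ∃ C : ℝ≥0, ∀ (E : Ω → Seg → Seg → ℝ≥0 → V) (M : ℝ≥0∞) (G : Ω → ℝ≥0∞),
      (∀ ω, Continuous fun q : ℝ≥0 × Seg × Seg => E ω q.2.1 q.2.2 q.1) →
      (∀ ω x y, E ω x y 0 = 0) → (∀ ω x t, E ω x x t = 0) →
      (∀ x y s t, Measurable fun ω => ‖E ω x y t - E ω x y s‖ₑ) →
      (∀ x y, x ≤ y → ∀ s ≤ T, ∀ t ≤ T,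
        mom P r (fun ω => ‖E ω x y t - E ω x y s‖ₑ) ≤ M * edist s t ^ β₁ * edist x y ^ β) →
      (∀ ω x y z, x ≤ y → y ≤ z →
        pathNorm α₁ T (fun t => E ω x z t - E ω x y t - E ω y z t) ≤
          G ω * (edist x y ^ (γ / 2) * edist y z ^ (γ / 2))) →
      ∃ K : Ω → ℝ≥0∞, Measurable K ∧ mom P r K ≤ C * M ∧
        ∀ ω x y, x ≤ y → pathNorm α₁ T (E ω x y) ≤ C * (K ω + G ω) * edist x y ^ γ := by
  have hβ : 0 < β := by
    by_contra hb
    have : r * (β - γ) ≤ 0 := mul_nonpos_of_nonneg_of_nonpos hr.le (by linarith)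
    linarith
  obtain ⟨C₁, hC₁⟩ := exists_pathNorm_majorant (Ω := Ω) (P := P) (V := V) hα hr hκ₁ T
  set ℓ : ℝ≥0∞ := ENNReal.ofReal (2 * Real.pi) with hℓ
  have hℓ1 : 1 ≤ ℓ := by
    rw [hℓ, ENNReal.one_le_ofReal]; linarith [Real.pi_gt_three]
  have hℓt : ℓ ≠ ⊤ := ENNReal.ofReal_ne_top
  have hℓ0 : ℓ ≠ 0 := (zero_lt_one.trans_le hℓ1).ne'
  have hℓγ : ℓ ^ γ ≠ ⊤ := ENNReal.rpow_ne_top_of_nonneg hγ.le hℓt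
  have hℓγ' : ℓ ^ (-γ) ≠ ⊤ := by simp [ENNReal.rpow_eq_top_iff, hℓ0, hℓt]
  have hℓβ : ℓ ^ β ≠ ⊤ := ENNReal.rpow_ne_top_of_nonneg hβ.le hℓt
  have hch := chainConst_ne_top hγ
  have hkol := kolConst_ne_top hr hκ
  set D₁ : ℝ≥0∞ := kolConst r (r * (β - γ)) * (C₁ * ℓ ^ β) with hD₁
  set D₂ : ℝ≥0∞ := chainConst γ * (ℓ ^ (-γ) + 1) with hD₂
  have hD₁t : D₁ ≠ ⊤ := by finiteness
  have hD₂t : D₂ ≠ ⊤ := by finiteness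
  refine ⟨(D₁ + D₂).toNNReal, fun E M G hcont h0 hxx hmeas hM hG => ?_⟩
  rw [ENNReal.coe_toNNReal (by finiteness)]
  set F : Ω → ℝ → ℝ → ℝ≥0∞ := fun ω σ τ => pathNorm α₁ T (E ω (segPt σ) (segPt τ)) with hF
  -- On each dyadic interval the criterion in time, with the end points fixed, provides a random
  -- variable `A m i` above the path norm. These variables are the input for chaining in space.
  have hcell : ∀ m i : ℕ, ∃ A : Ω → ℝ≥0∞, Measurable A ∧ (i < 2 ^ m →
      mom P r A ≤ C₁ * (M * ℓ ^ β) * chainRatio β ^ (2 * m) ∧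
      ∀ ω, F ω ((i : ℝ) / 2 ^ m) (((i : ℝ) + 1) / 2 ^ m) ≤ A ω) := by
    intro m i
    by_cases hi : i < 2 ^ m
    · have i1 : ((i : ℝ) + 1) / 2 ^ m ≤ 1 := by
        rw [div_le_one (by positivity)]
        exact_mod_cast Nat.succ_le_of_lt hi
      have i2 : (i : ℝ) / 2 ^ m ≤ ((i : ℝ) + 1) / 2 ^ m := by gcongr; linarith
      set x := segPt ((i : ℝ) / 2 ^ m) with hx
      set y := segPt (((i : ℝ) + 1) / 2 ^ m) with hy
      obtain ⟨A, hA1, hA2, hA3⟩ := hC₁ (fun ω => E ω x y) (M * edist x y ^ β)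
        (fun ω => (hcont ω).comp (f := fun t => (t, x, y)) (by fun_prop)) (fun ω => h0 ω _ _) (fun s t => hmeas x y s t)
        (fun s hs t ht => (hM x y (segPt_mono i2) s hs t ht).trans (le_of_eq (by ring)))
      refine ⟨A, hA1, fun _ => ⟨hA2.trans (le_of_eq ?_), hA3⟩⟩
      rw [hx, hy, edist_segPt (by positivity) i2 i1, ENNReal.mul_rpow_of_nonneg _ _ hβ.le,
        ← ofReal_dyadic_rpow, ← hℓ]
      have : ((i : ℝ) + 1) / 2 ^ m - i / 2 ^ m = (2 ^ m)⁻¹ := by field_simp; ring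
      rw [this]; ring
    · exact ⟨fun _ => 0, measurable_const, fun h => absurd h hi⟩
  choose A hA1 hA2 using hcell
  obtain ⟨K, hKm, hKM, hK⟩ := exists_dyadic_majorant (A := A) (γ := γ) hA1 hr
    (fun m i hi => (hA2 m i hi).1)
  refine ⟨K, hKm, ?_, fun ω x y hxy => ?_⟩
  · refine hKM.trans ?_
    calc kolConst r (r * (β - γ)) * (C₁ * (M * ℓ ^ β)) = D₁ * M := by rw [hD₁]; ring
      _ ≤ _ := by gcongr; exact le_self_add
  have tri : ∀ a b c : ℝ, a ≤ b → b ≤ c →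
      pathNorm α₁ T (fun t => E ω (segPt a) (segPt c) t - E ω (segPt a) (segPt b) t -
        E ω (segPt b) (segPt c) t) ≤
      G ω * (edist (segPt a) (segPt b) ^ (γ / 2) * edist (segPt b) (segPt c) ^ (γ / 2)) :=
    fun a b c hab hbc => hG ω _ _ _ (segPt_mono hab) (segPt_mono hbc)
  have hdist : ∀ a b c : ℝ, 0 ≤ a → a ≤ b → b ≤ c → c ≤ 1 →
      G ω * (edist (segPt a) (segPt b) ^ (γ / 2) * edist (segPt b) (segPt c) ^ (γ / 2)) =
      (G ω * ℓ ^ γ) * (ENNReal.ofReal (b - a) ^ (γ / 2) * ENNReal.ofReal (c - b) ^ (γ / 2)) := by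
    intro a b c ha hab hbc hc
    rw [edist_segPt ha hab (hbc.trans hc), edist_segPt (ha.trans hab) hbc hc, ← hℓ,
      ENNReal.mul_rpow_of_nonneg _ _ (by linarith), ENNReal.mul_rpow_of_nonneg _ _ (by linarith)]
    have : ℓ ^ γ = ℓ ^ (γ / 2) * ℓ ^ (γ / 2) := by
      rw [← ENNReal.rpow_add _ _ hℓ0 hℓt]; congr 1; ring
    rw [this]; ring
  have hF' : ∀ σ τ : ℝ, 0 ≤ σ → σ ≤ τ → τ ≤ 1 →
      F ω σ τ ≤ chainConst γ * (K ω + G ω * ℓ ^ γ) * ENNReal.ofReal (τ - σ) ^ γ := by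
    intro σ τ hσ hστ hτ
    refine chain_bound hγ (F := F ω) ?_ ?_ ?_ ?_
      (fun m i hi => ((hA2 m i hi).2 ω).trans (hK ω m i hi)) hσ hστ hτ
    · refine lowerSemicontinuous_pathNorm fun t => ?_
      have h1 := hcont ω
      have h2 := continuous_segPt
      exact h1.comp (f := fun q : ℝ × ℝ => (t, segPt q.1, segPt q.2)) (by fun_prop)
    · intro x
      have : E ω (segPt x) (segPt x) = fun _ => 0 := funext fun t => hxx ω _ t
      simp only [hF, this, pathNorm_zero]
    · intro a b c ha hab hbc hc
      rw [← hdist a b c ha hab hbc hc]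
      have e : E ω (segPt a) (segPt c) = fun t => (E ω (segPt a) (segPt b) t +
          E ω (segPt b) (segPt c) t) + (E ω (segPt a) (segPt c) t - E ω (segPt a) (segPt b) t -
          E ω (segPt b) (segPt c) t) := by
        funext t; abel
      simp only [hF]
      rw [e]
      refine (pathNorm_add_le _ _).trans ?_
      gcongr
      · exact pathNorm_add_le _ _
      · exact tri a b c hab hbc
    · intro a b c ha hab hbc hc
      rw [← hdist a b c ha hab hbc hc]
      have e : E ω (segPt b) (segPt c) = fun t => (E ω (segPt a) (segPt c) t -
          E ω (segPt a) (segPt b) t) - (E ω (segPt a) (segPt c) t - E ω (segPt a) (segPt b) t -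
          E ω (segPt b) (segPt c) t) := by
        funext t; abel
      simp only [hF]
      rw [e]
      refine (pathNorm_sub_le _ _).trans ?_
      gcongr
      · exact pathNorm_sub_le _ _
      · exact tri a b c hab hbc
  have hp := Real.pi_pos
  set σ := ((x : ℝ) + Real.pi) / (2 * Real.pi) with hσ
  set τ := ((y : ℝ) + Real.pi) / (2 * Real.pi) with hτ
  have s0 : 0 ≤ σ := div_nonneg (by linarith [x.2.1]) (by positivity)
  have s1 : τ ≤ 1 := by rw [hτ, div_le_one (by positivity)]; linarith [y.2.2]
  have st : σ ≤ τ := by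
    have : (x : ℝ) ≤ y := hxy
    rw [hσ, hτ]; gcongr
  have h := hF' σ τ s0 st s1
  have ed : edist x y = ℓ * ENNReal.ofReal (τ - σ) := by
    rw [hℓ, ← edist_segPt s0 st s1, segPt_surj, segPt_surj]
  simp only [hF] at h
  rw [hσ, hτ, segPt_surj, segPt_surj, ← hσ, ← hτ] at h
  refine h.trans ?_
  have e2 : ENNReal.ofReal (τ - σ) ^ γ = ℓ ^ (-γ) * edist x y ^ γ := by
    rw [ed, ENNReal.mul_rpow_of_nonneg _ _ hγ.le, ← mul_assoc, ← ENNReal.rpow_add _ _ hℓ0 hℓt]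
    simp
  rw [e2]
  have e3 : ℓ ^ γ * ℓ ^ (-γ) = 1 := by
    rw [← ENNReal.rpow_add _ _ hℓ0 hℓt]; simp
  calc chainConst γ * (K ω + G ω * ℓ ^ γ) * (ℓ ^ (-γ) * edist x y ^ γ)
      = chainConst γ * (ℓ ^ (-γ) * K ω + (ℓ ^ γ * ℓ ^ (-γ)) * G ω) * edist x y ^ γ := by ring
    _ ≤ chainConst γ * ((ℓ ^ (-γ) + 1) * K ω + (ℓ ^ (-γ) + 1) * G ω) * edist x y ^ γ := by
        rw [e3]
        gcongr
        · exact le_self_add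
        · exact le_add_self
    _ = D₂ * (K ω + G ω) * edist x y ^ γ := by rw [hD₂]; ring
    _ ≤ _ := by gcongr; exact le_add_self

end Kolmogorov

end RoughHeat

namespace RoughHeat

/-! ### Norms of enhanced processes -/

section Enhanced

variable {n : ℕ}

lemma tensor_apply (u v : Vec n) (i : Fin n × Fin n) : tensor u v i = u i.1 * v i.2 := rfl

lemma enorm_tensor_le (u v : Vec n) : ‖tensor u v‖ₑ ≤ ‖u‖ₑ * ‖v‖ₑ := by
  have : ‖tensor u v‖ = ‖u‖ * ‖v‖ := by
    rw [EuclideanSpace.norm_eq, EuclideanSpace.norm_eq, EuclideanSpace.norm_eq,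
      ← Real.sqrt_mul (by positivity), Finset.sum_mul_sum, ← Finset.sum_product']
    congr 1
    refine Finset.sum_congr rfl fun i _ => ?_
    rw [tensor_apply, norm_mul, mul_pow]
  rw [← ofReal_norm, ← ofReal_norm, ← ofReal_norm, this,
    ENNReal.ofReal_mul (norm_nonneg _)]

lemma tensor_sub_tensor (a a' b b' : Vec n) :
    tensor a b - tensor a' b' = tensor (a - a') b + tensor a' (b - b') := by
  ext i
  simp only [PiLp.sub_apply, PiLp.add_apply, tensor_apply]
  ring

variable {Ω : Type*} [MeasurableSpace Ω]

/-- A continuous process, with values in the functions on `[-π, π]`, and its iterated integral. -/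
structure IsEnhanced (X : Ω → ℝ≥0 → Seg → Vec n) (XX : Ω → ℝ≥0 → Seg → Seg → Ten n) : Prop where
  meas : ∀ t x, Measurable fun ω => X ω t x
  meas₂ : ∀ t x y, Measurable fun ω => XX ω t x y
  cont : ∀ ω, Continuous fun q : ℝ≥0 × Seg => X ω q.1 q.2
  cont₂ : ∀ ω, Continuous fun q : ℝ≥0 × Seg × Seg => XX ω q.1 q.2.1 q.2.2
  zero : ∀ ω x, X ω 0 x = 0
  zero₂ : ∀ ω x y, XX ω 0 x y = 0
  diag : ∀ ω t x, XX ω t x x = 0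
  chen : ∀ ω t x y z, XX ω t x z - XX ω t x y - XX ω t y z =
    tensor (X ω t y - X ω t x) (X ω t z - X ω t y)

variable {P : Measure Ω} {X X' : Ω → ℝ≥0 → Seg → Vec n} {XX XX' : Ω → ℝ≥0 → Seg → Seg → Ten n}

/-- Moment bounds on the increments of a process in time and space. -/
structure HasIncrementBound (P : Measure Ω) (T : ℝ≥0) (r β₁ β₂ : ℝ) (M : ℝ≥0∞)
    (D : Ω → ℝ≥0 → Seg → Vec n) : Prop where
  time : ∀ x, ∀ s ≤ T, ∀ t ≤ T, mom P r (fun ω => ‖D ω t x - D ω s x‖ₑ) ≤ M * edist s t ^ β₁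
  rect : ∀ x y, ∀ s ≤ T, ∀ t ≤ T,
    mom P r (fun ω => ‖(D ω t y - D ω t x) - (D ω s y - D ω s x)‖ₑ) ≤
      M * edist s t ^ β₁ * edist x y ^ β₂

/-- Pathwise bounds on a process and its spatial increments. -/
structure HasPathBound (T : ℝ≥0) (α₁ α₂ : ℝ) (D : ℝ≥0 → Seg → Vec n) (H : ℝ≥0∞) : Prop where
  point : ∀ x, pathNorm α₁ T (fun t => D t x) ≤ H
  incr : ∀ x y, pathNorm α₁ T (fun t => D t y - D t x) ≤ H * edist x y ^ α₂

/-- The Hölder quotients in time and in space may be taken in either order. The factor 4 counts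
supremum or seminorm in space times supremum or seminorm in time. -/
lemma HasPathBound.timeNorm_le {T : ℝ≥0} {α₁ α₂ : ℝ} {D : ℝ≥0 → Seg → Vec n} {H : ℝ≥0∞}
    (h : HasPathBound T α₁ α₂ D H) : timeNorm (cNorm α₂) α₁ T D ≤ 4 * H := by
  have h4 : 4 * H = (H + H) + (H + H) := by ring
  have quot : ∀ (a : Vec n) (B : ℝ≥0∞) (x y : Seg), ‖a‖ₑ ≤ B * edist y x ^ α₂ →
      ‖a‖ₑ / edist x y ^ α₂ ≤ B := fun a B x y h => by
    rw [edist_comm] at h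
    exact ENNReal.div_le_of_le_mul h
  rw [h4]
  refine RoughHeat.timeNorm_le (fun t ht => ?_) fun s hs t ht => ?_
  · unfold cNorm holderSemi
    gcongr
    · exact iSup_le fun x => (enorm_le_pathNorm (α := α₁) (fun t => D t x) ht).trans (h.point x)
    · refine iSup_le fun x => iSup_le fun y => iSup_le fun _ => quot _ _ _ _ ?_
      exact (enorm_le_pathNorm (α := α₁) (fun t => D t x - D t y) ht).trans (h.incr y x)
  · rw [add_mul]
    unfold cNorm holderSemi
    gcongr
    · refine iSup_le fun x => ?_
      refine (enorm_sub_le_pathNorm (α := α₁) (fun t => D t x) hs ht).trans ?_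
      gcongr
      exact h.point x
    · refine iSup_le fun x => iSup_le fun y => iSup_le fun _ => quot _ _ _ _ ?_
      have e : (D t - D s) x - (D t - D s) y = (D t x - D t y) - (D s x - D s y) := by
        simp only [Pi.sub_apply]; abel
      rw [e]
      refine (enorm_sub_le_pathNorm (α := α₁) (fun t => D t x - D t y) hs ht).trans ?_
      calc _ ≤ H * edist y x ^ α₂ * edist s t ^ α₁ := by gcongr; exact h.incr y x
        _ = _ := by ring

lemma timeNorm_bNorm_le {T : ℝ≥0} {α₁ γ : ℝ} {E : ℝ≥0 → Seg → Seg → Ten n} {H : ℝ≥0∞}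
    (h : ∀ x y, pathNorm α₁ T (fun t => E t x y) ≤ H * edist x y ^ γ) :
    timeNorm (bNorm γ) α₁ T E ≤ 2 * H := by
  rw [two_mul]
  refine timeNorm_le (fun t ht => ?_) fun s hs t ht => ?_
  · unfold bNorm
    refine iSup_le fun x => iSup_le fun y => iSup_le fun _ => ENNReal.div_le_of_le_mul ?_
    exact (enorm_le_pathNorm (α := α₁) (fun t => E t x y) ht).trans (h x y)
  · unfold bNorm
    refine iSup_le fun x => iSup_le fun y => iSup_le fun _ => ENNReal.div_le_of_le_mul ?_
    refine (enorm_sub_le_pathNorm (α := α₁) (fun t => E t x y) hs ht).trans ?_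
    calc _ ≤ H * edist x y ^ γ * edist s t ^ α₁ := by gcongr; exact h x y
      _ = _ := by ring

/-- The Kolmogorov criterion for processes with values in the functions on `[-π, π]`. -/
theorem exists_hasPathBound {α₁ α₂ β₁ β₂ r : ℝ} (hα₁ : 0 < α₁) (hα₂ : 0 < α₂) (hr : 1 ≤ r)
    (hκ₁ : 1 < r * (β₁ - α₁)) (hκ₂ : 1 < r * (β₂ - α₂)) (T : ℝ≥0) :
    ∃ C : ℝ≥0, ∀ (D : Ω → ℝ≥0 → Seg → Vec n) (M : ℝ≥0∞),
      (∀ ω, Continuous fun q : ℝ≥0 × Seg => D ω q.1 q.2) → (∀ ω x, D ω 0 x = 0) →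
      (∀ t x, Measurable fun ω => D ω t x) → HasIncrementBound P T r β₁ β₂ M D →
      ∃ H : Ω → ℝ≥0∞, Measurable H ∧ mom P r H ≤ C * M ∧
        ∀ ω, HasPathBound T α₁ α₂ (D ω) (H ω) := by
  have hr0 : 0 < r := zero_lt_one.trans_le hr
  obtain ⟨C₁, hC₁⟩ := exists_pathNorm_majorant (Ω := Ω) (P := P) (V := Vec n) hα₁ hr0 hκ₁ T
  obtain ⟨C₂, hC₂⟩ := exists_interval_majorant (Ω := Ω) (P := P) (V := Vec n)
    hα₁ hα₂ hr0 hκ₁ hκ₂ T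
  set ℓ : ℝ≥0 := (Real.toNNReal (2 * Real.pi)) ^ α₂ with hℓ
  -- A base point: any other value is the value there plus a spatial increment over at most the
  -- diameter.
  set x₀ : Seg := segPt 0
  have hdiam : ∀ x y : Seg, edist x y ^ α₂ ≤ ℓ := by
    intro x y
    have : edist x y ≤ ENNReal.ofReal (2 * Real.pi) := by
      rw [Subtype.edist_eq, edist_dist, Real.dist_eq]
      refine ENNReal.ofReal_le_ofReal ?_
      rw [abs_le]
      constructor <;> linarith [x.2.1, x.2.2, y.2.1, y.2.2]
    rw [hℓ, ENNReal.coe_rpow_of_nonneg _ hα₂.le]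
    gcongr
    exact this
  refine ⟨C₁ + (C₂ * (ℓ + 1)) * C₂, fun D M hc h0 hm hD => ?_⟩
  obtain ⟨K₁, m₁, b₁, p₁⟩ := hC₁ (fun ω t => D ω t x₀) M
    (fun ω => (hc ω).comp (f := fun t => (t, x₀)) (by fun_prop)) (fun ω => h0 ω _)
    (fun s t => ((hm t _).sub (hm s _)).enorm) (fun s hs t ht => hD.time _ s hs t ht)
  obtain ⟨K₂, m₂, b₂, p₂⟩ := hC₂ (fun ω x y t => D ω t y - D ω t x) M (fun _ => 0)
    (fun ω => by
      have h1 := (hc ω).comp (f := fun q : ℝ≥0 × Seg × Seg => (q.1, q.2.2)) (by fun_prop)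
      have h2 := (hc ω).comp (f := fun q : ℝ≥0 × Seg × Seg => (q.1, q.2.1)) (by fun_prop)
      exact h1.sub h2)
    (fun ω x y => by simp [h0]) (fun ω x t => by simp)
    (fun x y s t => (((hm t _).sub (hm t _)).sub ((hm s _).sub (hm s _))).enorm)
    (fun x y _ s hs t ht => hD.rect x y s hs t ht)
    (fun ω x y z _ _ => by
      simp [pathNorm_zero])
  have hincr : ∀ ω x y, pathNorm α₁ T (fun t => D ω t y - D ω t x) ≤
      C₂ * K₂ ω * edist x y ^ α₂ := by
    intro ω x y
    rcases le_total x y with h | h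
    · simpa using p₂ ω x y h
    · rw [← pathNorm_neg, edist_comm]
      simpa using p₂ ω y x h
  refine ⟨fun ω => K₁ ω + C₂ * (ℓ + 1) * K₂ ω, m₁.add (m₂.const_mul _), ?_, fun ω => ⟨?_, ?_⟩⟩
  · refine (mom_add_le hr m₁.aemeasurable (m₂.const_mul _).aemeasurable).trans ?_
    rw [mom_const_mul hr0 (by finiteness)]
    push_cast
    rw [add_mul, mul_assoc _ (C₂ : ℝ≥0∞) M]
    gcongr
  · intro x
    have e : (fun t => D ω t x) = fun t => D ω t x₀ + (D ω t x - D ω t x₀) := by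
      funext t; abel
    rw [e]
    refine (pathNorm_add_le _ _).trans (add_le_add (p₁ ω) ?_)
    · calc _ ≤ C₂ * K₂ ω * edist x₀ x ^ α₂ := hincr ω x₀ x
        _ ≤ C₂ * K₂ ω * (ℓ + 1) := by gcongr; exact (hdiam _ _).trans le_self_add
        _ = _ := by ring
  · intro x y
    refine (hincr ω x y).trans (mul_le_mul' ?_ le_rfl)
    calc C₂ * K₂ ω = C₂ * 1 * K₂ ω := by ring
      _ ≤ C₂ * (ℓ + 1) * K₂ ω := by gcongr; exact le_add_self
      _ ≤ _ := le_add_self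

/-- The Kolmogorov criterion for iterated integrals. -/
theorem exists_iterated_majorant {α₁ α₂ β₁ β₂ β₃ r : ℝ} (hα₁ : 0 < α₁) (hα₂ : 0 < α₂) (hr : 1 ≤ r)
    (hκ₁ : 1 < r * (β₁ - α₁)) (hκ₂ : 1 < r * (β₂ - α₂)) (hκ₃ : 1 < r * (β₃ - 2 * α₂)) (T : ℝ≥0) :
    ∃ C : ℝ≥0, ∀ (X X' : Ω → ℝ≥0 → Seg → Vec n) (XX XX' : Ω → ℝ≥0 → Seg → Seg → Ten n)
      (M M₁ : ℝ≥0∞), IsEnhanced X XX → IsEnhanced X' XX' →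
      HasIncrementBound P T (2 * r) β₁ β₂ M₁ X → HasIncrementBound P T (2 * r) β₁ β₂ M₁ X' →
      HasIncrementBound P T (2 * r) β₁ β₂ M (fun ω t x => X ω t x - X' ω t x) →
      (∀ x y, ∀ s ≤ T, ∀ t ≤ T, mom P r (fun ω => ‖(XX ω t x y - XX' ω t x y) -
        (XX ω s x y - XX' ω s x y)‖ₑ) ≤ M * edist s t ^ β₁ * edist x y ^ β₃) →
      ∃ H : Ω → ℝ≥0∞, Measurable H ∧ mom P r H ≤ C * (1 + M₁) * M ∧
        ∀ ω x y, pathNorm α₁ T (fun t => XX ω t x y - XX' ω t x y) ≤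
          H ω * edist x y ^ (2 * α₂) := by
  have hr0 : 0 < r := zero_lt_one.trans_le hr
  have mono : ∀ κ, 1 < r * κ → 1 < 2 * r * κ := fun κ h => by linarith
  obtain ⟨C₁, hC₁⟩ := exists_hasPathBound (Ω := Ω) (P := P) (n := n) hα₁ hα₂
    (r := 2 * r) (by linarith) (mono _ hκ₁) (mono _ hκ₂) T
  -- For `γ = 2 α₂` the two half exponents `γ / 2` in the defect are the Hölder exponents of the two
  -- paths.
  obtain ⟨C₂, hC₂⟩ := exists_interval_majorant (Ω := Ω) (P := P) (V := Ten n) (γ := 2 * α₂)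
    hα₁ (by linarith) hr0 hκ₁ hκ₃ T
  refine ⟨C₂ * C₂ + (C₂ + 1) * (2 * C₁ * C₁), fun X X' XX XX' M M₁ hX hX' bX bX' bD bE => ?_⟩
  obtain ⟨H₁, m₁, q₁, p₁⟩ := hC₁ X M₁ hX.cont hX.zero hX.meas bX
  obtain ⟨H₂, m₂, q₂, p₂⟩ := hC₁ X' M₁ hX'.cont hX'.zero hX'.meas bX'
  obtain ⟨H₃, m₃, q₃, p₃⟩ := hC₁ (fun ω t x => X ω t x - X' ω t x) M
    (fun ω => (hX.cont ω).sub (hX'.cont ω)) (fun ω x => by rw [hX.zero, hX'.zero, sub_zero])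
    (fun t x => (hX.meas t x).sub (hX'.meas t x)) bD
  -- With `D = X - X'`, the difference of the iterated integrals has Chen defect `D ⊗ X + X' ⊗ D`
  -- (of increments). Being linear in `D`, it keeps the factor `M`.
  set G : Ω → ℝ≥0∞ := fun ω => H₃ ω * H₁ ω + H₂ ω * H₃ ω with hG
  have mG : Measurable G := (m₃.mul m₁).add (m₂.mul m₃)
  have qG : mom P r G ≤ 2 * C₁ * C₁ * M₁ * M := by
    refine (mom_add_le hr (m₃.mul m₁).aemeasurable (m₂.mul m₃).aemeasurable).trans ?_
    refine (add_le_add (mom_mul_le hr0 m₃.aemeasurable m₁.aemeasurable)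
      (mom_mul_le hr0 m₂.aemeasurable m₃.aemeasurable)).trans ?_
    calc _ ≤ (C₁ * M) * (C₁ * M₁) + (C₁ * M₁) * (C₁ * M) := by gcongr
      _ = _ := by ring
  have hchen : ∀ ω x y z t, (XX ω t x z - XX' ω t x z) - (XX ω t x y - XX' ω t x y) -
      (XX ω t y z - XX' ω t y z) =
      tensor ((X ω t y - X' ω t y) - (X ω t x - X' ω t x)) (X ω t z - X ω t y) +
      tensor (X' ω t y - X' ω t x) ((X ω t z - X' ω t z) - (X ω t y - X' ω t y)) := by
    intro ω x y z t
    have e1 := hX.chen ω t x y z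
    have e2 := hX'.chen ω t x y z
    have e3 := tensor_sub_tensor (X ω t y - X ω t x) (X' ω t y - X' ω t x) (X ω t z - X ω t y)
      (X' ω t z - X' ω t y)
    have e4 : (X ω t y - X' ω t y) - (X ω t x - X' ω t x) =
      (X ω t y - X ω t x) - (X' ω t y - X' ω t x) := by abel
    have e5 : (X ω t z - X' ω t z) - (X ω t y - X' ω t y) =
      (X ω t z - X ω t y) - (X' ω t z - X' ω t y) := by abel
    rw [e4, e5, ← e3, ← e1, ← e2]
    abel
  have hdelta : ∀ ω x y z, pathNorm α₁ T (fun t => (XX ω t x z - XX' ω t x z) -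
      (XX ω t x y - XX' ω t x y) - (XX ω t y z - XX' ω t y z)) ≤
      G ω * (edist x y ^ α₂ * edist y z ^ α₂) := by
    intro ω x y z
    simp_rw [hchen]
    refine (pathNorm_add_le _ _).trans ?_
    have t1 := pathNorm_bilin_le (α := α₁) (T := T) tensor tensor_sub_tensor enorm_tensor_le
      (fun t => (X ω t y - X' ω t y) - (X ω t x - X' ω t x)) (fun t => X ω t z - X ω t y)
    have t2 := pathNorm_bilin_le (α := α₁) (T := T) tensor tensor_sub_tensor enorm_tensor_le
      (fun t => X' ω t y - X' ω t x) (fun t => (X ω t z - X' ω t z) - (X ω t y - X' ω t y))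
    refine (add_le_add t1 t2).trans ?_
    calc _ ≤ (H₃ ω * edist x y ^ α₂) * (H₁ ω * edist y z ^ α₂) +
          (H₂ ω * edist x y ^ α₂) * (H₃ ω * edist y z ^ α₂) := by
          gcongr
          · exact (p₃ ω).incr x y
          · exact (p₁ ω).incr y z
          · exact (p₂ ω).incr x y
          · exact (p₃ ω).incr y z
      _ = _ := by rw [hG]; ring
  obtain ⟨K, mK, qK, pK⟩ := hC₂ (fun ω x y t => XX ω t x y - XX' ω t x y) M G
    (fun ω => (hX.cont₂ ω).sub (hX'.cont₂ ω))
    (fun ω x y => by rw [hX.zero₂, hX'.zero₂, sub_zero])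
    (fun ω x t => by rw [hX.diag, hX'.diag, sub_zero])
    (fun x y s t => (((hX.meas₂ t x y).sub (hX'.meas₂ t x y)).sub
      ((hX.meas₂ s x y).sub (hX'.meas₂ s x y))).enorm)
    (fun x y _ s hs t ht => bE x y s hs t ht)
    (fun ω x y z _ _ => by
      rw [mul_div_cancel_left₀ _ (two_ne_zero)]
      exact hdelta ω x y z)
  refine ⟨fun ω => C₂ * K ω + (C₂ + 1) * G ω, (mK.const_mul _).add (mG.const_mul _), ?_, ?_⟩
  · refine (mom_add_le hr (mK.const_mul _).aemeasurable (mG.const_mul _).aemeasurable).trans ?_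
    rw [mom_const_mul hr0 (by finiteness), mom_const_mul hr0 (by finiteness)]
    push_cast
    calc _ ≤ C₂ * (C₂ * M) + (C₂ + 1) * (2 * C₁ * C₁ * M₁ * M) := by gcongr
      _ = C₂ * C₂ * 1 * M + (C₂ + 1) * (2 * C₁ * C₁) * M₁ * M := by ring
      _ ≤ C₂ * C₂ * (1 + M₁) * M + (C₂ + 1) * (2 * C₁ * C₁) * (1 + M₁) * M := by
          gcongr
          · exact le_self_add
          · exact le_add_self
      _ = _ := by ring
  · intro ω x y
    beta_reduce
    have hle : ∀ x y, x ≤ y → pathNorm α₁ T (fun t => XX ω t x y - XX' ω t x y) ≤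
        (C₂ * K ω + C₂ * G ω) * edist x y ^ (2 * α₂) := by
      intro x y h
      exact (pK ω x y h).trans (le_of_eq (by ring))
    have hsplit : C₂ * K ω + (C₂ + 1) * G ω = (C₂ * K ω + C₂ * G ω) + G ω := by ring
    rcases le_total x y with h | h
    · rw [hsplit]
      exact (hle x y h).trans (mul_le_mul' le_self_add le_rfl)
    -- For `y ≤ x`, Chen's relation through `y, x, y` and the vanishing on the diagonal express the
    -- value at `(x, y)` by the one at `(y, x)` and the defect.
    · have e : (fun t => XX ω t x y - XX' ω t x y) = fun t =>
          -((XX ω t y x - XX' ω t y x) + ((XX ω t y y - XX' ω t y y) -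
          (XX ω t y x - XX' ω t y x) - (XX ω t x y - XX' ω t x y))) := by
        funext t
        rw [hX.diag, hX'.diag]
        abel
      rw [e, pathNorm_neg]
      refine (pathNorm_add_le _ _).trans ?_
      rw [hsplit, add_mul]
      have h2 : edist x y ^ (2 * α₂) = edist y x ^ α₂ * edist x y ^ α₂ := by
        rw [edist_comm y x, two_mul, ENNReal.rpow_add_of_nonneg _ _ hα₂.le hα₂.le]
      refine add_le_add ?_ ?_
      · rw [edist_comm x y]; exact hle y x h
      · rw [h2]; exact hdelta ω y x y

end Enhanced

end RoughHeat

namespace RoughHeat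

/-! ### Moments of Gaussian sums of first and second order -/

section Gauss

variable {Ω : Type*} [MeasurableSpace Ω] {P : Measure Ω} {ι : Type*}

lemma mom_rpow_fun {r a : ℝ} (hr : 0 < r) (ha : 0 < a) (f : Ω → ℝ≥0∞) :
    mom P r (fun ω => f ω ^ a) = mom P (a * r) f ^ a := by
  unfold mom
  simp_rw [← ENNReal.rpow_mul]
  congr 1
  field_simp

lemma mom_map {Ω' : Type*} [MeasurableSpace Ω'] {X : Ω → Ω'} (hX : AEMeasurable X P) {r : ℝ}
    {f : Ω' → ℝ≥0∞} (hf : Measurable f) : mom (P.map X) r f = mom P r (fun ω => f (X ω)) := by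
  unfold mom
  rw [lintegral_map' (hf.pow_const r).aemeasurable hX]

/-- The absolute moments of the standard normal distribution. -/
noncomputable def gaussMom (r : ℝ) : ℝ≥0∞ := mom (gaussianReal 0 1) r fun x => ‖x‖ₑ

lemma gaussMom_ne_top {r : ℝ} (hr : 0 < r) : gaussMom r ≠ ⊤ := by
  have h := (memLp_id_gaussianReal' (μ := 0) (v := 1) (ENNReal.ofReal r) (by simp)).2
  rw [eLpNorm_eq_eLpNorm' (by simpa using hr) (by simp), ENNReal.toReal_ofReal hr.le] at h
  exact h.ne

/-- A centred Gaussian is `√v` times a standard one, so its variance determines all its moments. -/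
lemma mom_of_map_eq_gaussianReal {X : Ω → ℝ} (hX : Measurable X) {v : ℝ≥0}
    (h : P.map X = gaussianReal 0 v) {r : ℝ} (hr : 0 < r) :
    mom P r (fun ω => ‖X ω‖ₑ) = gaussMom r * (v : ℝ≥0∞) ^ (1 / 2 : ℝ) := by
  rw [← mom_map hX.aemeasurable (f := fun x => ‖x‖ₑ) (by fun_prop), h]
  have hv : gaussianReal 0 v = (gaussianReal 0 1).map (√v * ·) := by
    rw [gaussianReal_map_const_mul]
    congr 1
    · simp
    · ext; simp
  rw [hv, mom_map (by fun_prop) (by fun_prop)]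
  simp_rw [enorm_mul]
  rw [mom_const_mul hr (by finiteness), mul_comm, gaussMom]
  congr 1
  rw [← ENNReal.coe_rpow_of_nonneg _ (by norm_num), ← NNReal.sqrt_eq_rpow, Real.enorm_eq_ofReal
    (by positivity), ← ENNReal.ofReal_coe_nnreal]
  simp

/-- Independent centred Gaussian random variables with given variances. -/
structure IsGaussArray (P : Measure Ω) (U : ι → Ω → ℝ) (v : ι → ℝ≥0) : Prop where
  meas : ∀ i, Measurable (U i)
  law : ∀ i, P.map (U i) = gaussianReal 0 (v i)
  indep : iIndepFun U P

variable {U : ι → Ω → ℝ} {v : ι → ℝ≥0}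

lemma IsGaussArray.map_sum [IsProbabilityMeasure P] (hU : IsGaussArray P U v) (S : Finset ι)
    (c : ι → ℝ) :
    P.map (fun ω => ∑ i ∈ S, c i * U i ω) =
      gaussianReal 0 (∑ i ∈ S, ⟨c i ^ 2, sq_nonneg _⟩ * v i) := by
  classical
  set W : ι → Ω → ℝ := fun i ω => c i * U i ω with hW
  have hWi : iIndepFun W P := hU.indep.comp (fun i x => c i * x) (fun i => by fun_prop)
  have hWm : ∀ i, Measurable (W i) := fun i => (hU.meas i).const_mul _
  have hWl : ∀ i, P.map (W i) = gaussianReal 0 (⟨c i ^ 2, sq_nonneg _⟩ * v i) := by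
    intro i
    have : P.map (W i) = (P.map (U i)).map (c i * ·) := by
      rw [Measure.map_map (by fun_prop) (hU.meas i)]; rfl
    rw [this, hU.law, gaussianReal_map_const_mul, mul_zero]
    rfl
  have hsum : (fun ω => ∑ i ∈ S, c i * U i ω) = ∑ i ∈ S, W i := by
    ext ω; simp [hW]
  rw [hsum]
  induction S using Finset.induction_on with
  | empty =>
    simp only [Finset.sum_empty, gaussianReal_zero_var]
    have : (0 : Ω → ℝ) = fun _ => 0 := rfl
    rw [this, Measure.map_const, measure_univ, one_smul]
  | insert a s ha ih =>
    rw [Finset.sum_insert ha, Finset.sum_insert ha]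
    have hind := (hWi.indepFun_finsetSum_of_notMem hWm ha).symm
    have := gaussianReal_add_gaussianReal_of_indepFun hind (hWl a) (ih (by ext; simp [hW]))
    rw [this, add_zero]

lemma IsGaussArray.mom_sum_le [IsProbabilityMeasure P] (hU : IsGaussArray P U v) (S : Finset ι)
    (c : ι → ℝ) {r : ℝ} (hr : 0 < r) :
    mom P r (fun ω => ‖∑ i ∈ S, c i * U i ω‖ₑ) ≤
      gaussMom r * ENNReal.ofReal (∑ i ∈ S, c i ^ 2 * v i) ^ (1 / 2 : ℝ) := by
  rw [mom_of_map_eq_gaussianReal (Finset.measurable_fun_sum _ fun i _ => (hU.meas i).const_mul _)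
    (hU.map_sum S c) hr]
  gcongr
  rw [← ENNReal.ofReal_coe_nnreal]
  push_cast
  rfl

/-- The families indexed by the disjoint sets `S` and `S'` are independent. With the second one
frozen the sum is a centred Gaussian of variance `∑ d_i² v_i`; Minkowski's inequality in `L^{r/2}`,
whence `2 ≤ r`, reduces the moments of this random variance to those of the Gaussian sums `d_i`.
Moments of the second chaos are thus obtained from independence alone. -/
lemma IsGaussArray.mom_bilin_le [IsProbabilityMeasure P] (hU : IsGaussArray P U v)
    {S S' : Finset ι} (hSS : Disjoint S S') (c : ι → ι → ℝ) {r : ℝ} (hr : 2 ≤ r) :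
    mom P r (fun ω => ‖∑ i ∈ S, ∑ j ∈ S', c i j * (U i ω * U j ω)‖ₑ) ≤
      gaussMom r ^ 2 * ENNReal.ofReal (∑ i ∈ S, ∑ j ∈ S', c i j ^ 2 * (v i * v j)) ^ (1 / 2 : ℝ) := by
  have hr0 : 0 < r := by linarith
  have hind := hU.indep.indepFun_finset S S' hSS hU.meas
  set A : Ω → S → ℝ := fun ω i => U i ω with hA
  set B : Ω → S' → ℝ := fun ω j => U j ω with hB
  have mA : Measurable A := measurable_pi_lambda _ fun i => hU.meas i
  have mB : Measurable B := measurable_pi_lambda _ fun i => hU.meas i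
  set d : ι → Ω → ℝ := fun i ω => ∑ j ∈ S', c i j * U j ω with hd
  have md : ∀ i, Measurable (d i) := fun i =>
    Finset.measurable_fun_sum _ fun j _ => (hU.meas j).const_mul _
  set Φ : (S → ℝ) × (S' → ℝ) → ℝ≥0∞ := fun q =>
    ‖∑ i ∈ S.attach, (∑ j ∈ S'.attach, c i j * q.2 j) * q.1 i‖ₑ ^ r with hΦ
  have mΦ : Measurable Φ := by simp only [hΦ]; fun_prop
  -- Fubini for the product law of `(A, B)`: the inner moment is over the first family, the outer
  -- one over the second.
  have hfub : mom P r (fun ω => ‖∑ i ∈ S, ∑ j ∈ S', c i j * (U i ω * U j ω)‖ₑ) =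
      mom P r (fun ω' => mom P r (fun ω => ‖∑ i ∈ S, d i ω' * U i ω‖ₑ)) := by
    unfold mom
    simp_rw [← ENNReal.rpow_mul, one_div_mul_cancel hr0.ne', ENNReal.rpow_one]
    congr 1
    have e1 : ∀ ω ω', Φ (A ω, B ω') = ‖∑ i ∈ S, d i ω' * U i ω‖ₑ ^ r := by
      intro ω ω'
      simp only [hΦ, hA, hB, hd]
      congr 2
      rw [← Finset.sum_attach S]
      refine Finset.sum_congr rfl fun i _ => ?_
      rw [← Finset.sum_attach S']
    have e2 : ∀ ω, ‖∑ i ∈ S, ∑ j ∈ S', c i j * (U i ω * U j ω)‖ₑ ^ r = Φ (A ω, B ω) := by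
      intro ω
      rw [e1]
      congr 2
      refine Finset.sum_congr rfl fun i _ => ?_
      rw [hd, Finset.sum_mul]
      exact Finset.sum_congr rfl fun j _ => by ring
    simp_rw [e2, ← e1]
    rw [← lintegral_map mΦ (mA.prodMk mB), (indepFun_iff_map_prod_eq_prod_map_map mA.aemeasurable
      mB.aemeasurable).1 hind, lintegral_prod_symm' _ mΦ, lintegral_map
      (mΦ.lintegral_prod_left') mB]
    refine lintegral_congr fun ω' => ?_
    rw [lintegral_map (by fun_prop) mA]
  rw [hfub]
  have mD : ∀ i, Measurable fun ω => ENNReal.ofReal (d i ω ^ 2 * v i) := fun i =>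
    (((md i).pow_const 2).mul_const _).ennreal_ofReal
  have hmomd : ∀ i, mom P (r / 2) (fun ω => ENNReal.ofReal (d i ω ^ 2 * v i)) ≤
      gaussMom r ^ 2 * ENNReal.ofReal (∑ j ∈ S', c i j ^ 2 * (v i * v j)) := by
    intro i
    have e : ∀ ω, ENNReal.ofReal (d i ω ^ 2 * v i) = v i * ‖d i ω‖ₑ ^ (2 : ℝ) := by
      intro ω
      rw [ENNReal.ofReal_mul (sq_nonneg _), ENNReal.ofReal_coe_nnreal, mul_comm,
        Real.enorm_eq_ofReal_abs, ENNReal.ofReal_rpow_of_nonneg (abs_nonneg _) (by norm_num)]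
      congr 2
      simp
    simp_rw [e]
    rw [mom_const_mul (by linarith) (by finiteness), mom_rpow_fun (by linarith) (by norm_num),
      mul_div_cancel₀ _ two_ne_zero]
    calc _ ≤ v i * (gaussMom r * ENNReal.ofReal (∑ j ∈ S', c i j ^ 2 * v j) ^ (1 / 2 : ℝ)) ^ (2 : ℝ) := by
          gcongr
          exact hU.mom_sum_le S' (c i) hr0
      _ = _ := by
          have : ∑ j ∈ S', c i j ^ 2 * ((v i : ℝ) * v j) = v i * ∑ j ∈ S', c i j ^ 2 * v j := by
            rw [Finset.mul_sum]; exact Finset.sum_congr rfl fun j _ => by ring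
          rw [this, ENNReal.mul_rpow_of_nonneg _ _ (by norm_num), ← ENNReal.rpow_mul,
            one_div_mul_cancel two_ne_zero, ENNReal.rpow_one, ENNReal.ofReal_mul (by positivity),
            ENNReal.ofReal_coe_nnreal, ENNReal.rpow_two]
          ring
  calc _ ≤ mom P r (fun ω' => gaussMom r *
          (∑ i ∈ S, ENNReal.ofReal (d i ω' ^ 2 * v i)) ^ (1 / 2 : ℝ)) := by
        refine mom_mono hr0 fun ω' => ?_
        refine (hU.mom_sum_le S (fun i => d i ω') hr0).trans (le_of_eq ?_)
        rw [ENNReal.ofReal_sum_of_nonneg fun i _ => by positivity]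
    _ = gaussMom r * mom P (r / 2) (fun ω' => ∑ i ∈ S, ENNReal.ofReal (d i ω' ^ 2 * v i)) ^
          (1 / 2 : ℝ) := by
        rw [mom_const_mul hr0 (gaussMom_ne_top hr0), mom_rpow_fun hr0 (by norm_num)]
        congr 3; ring
    _ ≤ gaussMom r * (gaussMom r ^ 2 * ENNReal.ofReal
          (∑ i ∈ S, ∑ j ∈ S', c i j ^ 2 * (v i * v j))) ^ (1 / 2 : ℝ) := by
        gcongr
        refine (RoughHeat.mom_sum_le (by linarith) S fun i _ => (mD i).aemeasurable).trans ?_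
        rw [ENNReal.ofReal_sum_of_nonneg fun i _ => Finset.sum_nonneg fun j _ => by positivity,
          Finset.mul_sum]
        exact Finset.sum_le_sum fun i _ => hmomd i
    _ = _ := by
        rw [ENNReal.mul_rpow_of_nonneg _ _ (by norm_num), ← ENNReal.rpow_natCast,
          ← ENNReal.rpow_mul, ← mul_assoc]
        norm_num
        rw [← pow_two]

/-- Pointwise limits of independent centred Gaussian random variables with convergent
variances. -/
def IsGaussLimit (P : Measure Ω) (U : ι → Ω → ℝ) (v : ι → ℝ) : Prop :=
  ∃ (W : ℕ → ι → Ω → ℝ) (u : ℕ → ι → ℝ≥0), (∀ m, IsGaussArray P (W m) (u m)) ∧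
    (∀ i ω, Tendsto (fun m => W m i ω) atTop (𝓝 (U i ω))) ∧
    ∀ i, Tendsto (fun m => (u m i : ℝ)) atTop (𝓝 (v i))

/-- Fatou's lemma: the laws are explicit along the approximations, and the moment bounds pass to the
limit without identifying its law. -/
lemma IsGaussLimit.mom_sum_le [IsProbabilityMeasure P] {v : ι → ℝ} (hU : IsGaussLimit P U v)
    (S : Finset ι) (c : ι → ℝ) {r : ℝ} (hr : 0 < r) :
    mom P r (fun ω => ‖∑ i ∈ S, c i * U i ω‖ₑ) ≤
      gaussMom r * ENNReal.ofReal (∑ i ∈ S, c i ^ 2 * v i) ^ (1 / 2 : ℝ) := by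
  obtain ⟨W, u, hW, hlim, hv⟩ := hU
  refine mom_le_of_tendsto hr (f := fun m ω => ‖∑ i ∈ S, c i * W m i ω‖ₑ)
    (fun m => ?_) (Eventually.of_forall fun ω => ?_) (fun m => (hW m).mom_sum_le S c hr) ?_
  · exact (Finset.measurable_fun_sum _ fun i _ => ((hW m).meas i).const_mul _).enorm.aemeasurable
  · exact (tendsto_finsetSum _ fun i _ => (hlim i ω).const_mul _).enorm
  · refine ENNReal.Tendsto.const_mul ?_ (Or.inr (gaussMom_ne_top hr))
    refine (ENNReal.continuous_rpow_const.tendsto _).comp ?_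
    exact ENNReal.tendsto_ofReal (tendsto_finsetSum _ fun i _ => (hv i).const_mul _)

lemma IsGaussLimit.mom_bilin_le [IsProbabilityMeasure P] {v : ι → ℝ} (hU : IsGaussLimit P U v)
    {S S' : Finset ι} (hSS : Disjoint S S') (c : ι → ι → ℝ) {r : ℝ} (hr : 2 ≤ r) :
    mom P r (fun ω => ‖∑ i ∈ S, ∑ j ∈ S', c i j * (U i ω * U j ω)‖ₑ) ≤
      gaussMom r ^ 2 * ENNReal.ofReal (∑ i ∈ S, ∑ j ∈ S', c i j ^ 2 * (v i * v j)) ^ (1 / 2 : ℝ) := by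
  obtain ⟨W, u, hW, hlim, hv⟩ := hU
  have hr0 : 0 < r := by linarith
  refine mom_le_of_tendsto hr0
    (f := fun m ω => ‖∑ i ∈ S, ∑ j ∈ S', c i j * (W m i ω * W m j ω)‖ₑ)
    (fun m => ?_) (Eventually.of_forall fun ω => ?_) (fun m => (hW m).mom_bilin_le hSS c hr) ?_
  · exact (Finset.measurable_fun_sum _ fun i _ => Finset.measurable_fun_sum _ fun j _ =>
      (((hW m).meas i).mul ((hW m).meas j)).const_mul _).enorm.aemeasurable
  · exact (tendsto_finsetSum _ fun i _ => tendsto_finsetSum _ fun j _ =>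
      ((hlim i ω).mul (hlim j ω)).const_mul _).enorm
  · refine ENNReal.Tendsto.const_mul ?_ (Or.inr (ENNReal.pow_ne_top (gaussMom_ne_top hr0)))
    refine (ENNReal.continuous_rpow_const.tendsto _).comp ?_
    exact ENNReal.tendsto_ofReal (tendsto_finsetSum _ fun i _ => tendsto_finsetSum _ fun j _ =>
      ((hv i).mul (hv j)).const_mul _)

end Gauss

end RoughHeat

namespace RoughHeat

/-! ### Wiener integrals of exponential kernels -/

section Wiener

variable {Ω : Type*} [MeasurableSpace Ω] {P : Measure Ω}

/-- Inner products of indicators reproduce the covariance `min` of Brownian motion: this is Itô's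
isometry for step functions. -/
lemma integral_indicator_mul_indicator {p q p' q' : ℝ≥0} (h : p ≤ q) (h' : p' ≤ q') :
    ∫ u : ℝ, (Ico (p : ℝ) q).indicator 1 u * (Ico (p' : ℝ) q').indicator 1 u =
      (min q q' : ℝ) - min q p' - min p q' + min p p' := by
  have e : ∀ u : ℝ, (Ico (p : ℝ) q).indicator (1 : ℝ → ℝ) u * (Ico (p' : ℝ) q').indicator 1 u =
      (Ico (max (p : ℝ) p') (min q q')).indicator 1 u := by
    intro u
    have := congrFun (inter_indicator_one (s := Ico (p : ℝ) q) (t := Ico (p' : ℝ) q') (M₀ := ℝ)) u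
    rw [Ico_inter_Ico] at this
    exact this.symm
  simp_rw [e]
  rw [integral_indicator_one measurableSet_Ico, Measure.real, Real.volume_Ico,
    ENNReal.toReal_ofReal']
  push_cast
  have h1 : (p : ℝ) ≤ q := by exact_mod_cast h
  have h2 : (p' : ℝ) ≤ q' := by exact_mod_cast h'
  grind

lemma aux_memLp {B : ℝ≥0 → Ω → ℝ} (hB : IsPreBrownianReal B P) (t : ℝ≥0) : MemLp (B t) 2 P :=
  (hB.isGaussianProcess.hasGaussianLaw_eval t).memLp_two

/-- The law of a linear combination of increments of a Brownian motion. -/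
theorem map_increment_sum {B : ℝ≥0 → Ω → ℝ} (hB : IsPreBrownianReal B P) {κ : Type*}
    (s : Finset κ) (c : κ → ℝ) (p q : κ → ℝ≥0) (hpq : ∀ i, p i ≤ q i) :
    P.map (fun ω => ∑ i ∈ s, c i * (B (q i) ω - B (p i) ω)) = gaussianReal 0
      (∫ u : ℝ, (∑ i ∈ s, c i * (Ico (p i : ℝ) (q i)).indicator 1 u) ^ 2).toNNReal := by
  classical
  have hprob := hB.isGaussianProcess.isProbabilityMeasure
  have hlaw : HasGaussianLaw (fun ω => ∑ i ∈ s, c i * (B (q i) ω - B (p i) ω)) P := by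
    have h := hB.isGaussianProcess.hasGaussianLaw (s.image p ∪ s.image q)
    have hp : ∀ i : s, p i ∈ s.image p ∪ s.image q := fun i =>
      Finset.mem_union_left _ (Finset.mem_image_of_mem p i.2)
    have hq : ∀ i : s, q i ∈ s.image p ∪ s.image q := fun i =>
      Finset.mem_union_right _ (Finset.mem_image_of_mem q i.2)
    let L : ((s.image p ∪ s.image q : Finset ℝ≥0) → ℝ) →L[ℝ] ℝ :=
      ∑ i ∈ s.attach, c i • (ContinuousLinearMap.proj (R := ℝ)
        (φ := fun _ : (s.image p ∪ s.image q : Finset ℝ≥0) => ℝ) ⟨q i, hq i⟩ -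
        ContinuousLinearMap.proj ⟨p i, hp i⟩)
    have e : (fun ω => ∑ i ∈ s, c i * (B (q i) ω - B (p i) ω)) =
        fun ω => L ((s.image p ∪ s.image q).restrict (B · ω)) := by
      funext ω
      rw [← Finset.sum_attach s]
      simp [L, Finset.restrict_def]
    rw [e]
    exact h.map_fun L
  rw [hlaw.map_eq_gaussianReal]
  have hmem : ∀ i, MemLp (fun ω => B (q i) ω - B (p i) ω) 2 P := fun i =>
    (aux_memLp hB _).sub (aux_memLp hB _)
  have hmem' : ∀ i, MemLp (fun ω => c i * (B (q i) ω - B (p i) ω)) 2 P := fun i =>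
    (hmem i).const_mul _
  congr 1
  · rw [integral_finsetSum _ fun i _ => (hmem' i).integrable (by norm_num)]
    refine Finset.sum_eq_zero fun i _ => ?_
    rw [integral_const_mul, integral_sub (hB.integrable_eval _) (hB.integrable_eval _),
      hB.integral_eval, hB.integral_eval, sub_zero, mul_zero]
  · congr 1
    rw [variance_fun_sum' fun i _ => hmem' i]
    have hsq : ∀ u : ℝ, (∑ i ∈ s, c i * (Ico (p i : ℝ) (q i)).indicator 1 u) ^ 2 =
        ∑ i ∈ s, ∑ j ∈ s, c i * c j *
          ((Ico (p i : ℝ) (q i)).indicator 1 u * (Ico (p j : ℝ) (q j)).indicator 1 u) := by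
      intro u
      rw [pow_two, Finset.sum_mul_sum]
      exact Finset.sum_congr rfl fun i _ => Finset.sum_congr rfl fun j _ => by ring
    simp_rw [hsq]
    have hint : ∀ i j, Integrable (fun u : ℝ => c i * c j *
        ((Ico (p i : ℝ) (q i)).indicator 1 u * (Ico (p j : ℝ) (q j)).indicator 1 u)) := by
      intro i j
      refine Integrable.const_mul ?_ _
      have e : (fun u : ℝ => (Ico (p i : ℝ) (q i)).indicator (1 : ℝ → ℝ) u *
          (Ico (p j : ℝ) (q j)).indicator 1 u) =
          (Ico (p i : ℝ) (q i) ∩ Ico (p j : ℝ) (q j)).indicator 1 := by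
        exact (inter_indicator_one (s := Ico (p i : ℝ) (q i)) (t := Ico (p j : ℝ) (q j))
          (M₀ := ℝ)).symm
      rw [e]
      refine (integrable_indicator_iff (measurableSet_Ico.inter measurableSet_Ico)).2 ?_
      refine integrableOn_const (ne_top_of_le_ne_top ?_ (measure_mono inter_subset_left)) (by simp)
      simp
    rw [integral_finsetSum _ fun i _ => integrable_finsetSum _ fun j _ => hint i j]
    refine Finset.sum_congr rfl fun i _ => ?_
    rw [integral_finsetSum _ fun j _ => hint i j]
    refine Finset.sum_congr rfl fun j _ => ?_
    rw [integral_const_mul, integral_indicator_mul_indicator (hpq i) (hpq j),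
      covariance_const_mul_left, covariance_const_mul_right, covariance_fun_sub_fun_sub]
    · simp_rw [hB.covariance_fun_eval]
      push_cast
      ring
    all_goals exact aux_memLp hB _

/-! ### Riemann sums and the pathwise form of the Wiener integral -/

/-- The kernel `b exp (-a (t - s))`. -/
noncomputable def ouKer (a b : ℝ) (t s : ℝ≥0) : ℝ := b * Real.exp (-(a * ((t : ℝ) - s)))

/-- The left-endpoint Riemann sums of `∫₀ᵗ b exp (-a (t - s)) dβ(s)`. -/
noncomputable def rsum (a b : ℝ) (m : ℕ) (t : ℝ≥0) (β : ℝ≥0 → ℝ) : ℝ :=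
  ∑ i ∈ Finset.range m, ouKer a b t (t * i / m) * (β (t * (i + 1) / m) - β (t * i / m))

/-- The integral `∫₀ᵗ b exp (-a (t - s)) dβ(s)`, after integration by parts. -/
noncomputable def ou (a b : ℝ) (t : ℝ≥0) (β : ℝ≥0 → ℝ) : ℝ :=
  -- This form is defined for every continuous path and is continuous in `t`.
  b * (β t - a * ∫ s in (0 : ℝ)..t, Real.exp (-(a * (t - s))) * β s.toNNReal)

lemma coe_grid (t : ℝ≥0) (i m : ℕ) : ((t * i / m : ℝ≥0) : ℝ) = t * i / m := by push_cast; rfl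

lemma coe_grid_succ (t : ℝ≥0) (i m : ℕ) : ((t * (i + 1) / m : ℝ≥0) : ℝ) = t * (i + 1) / m := by
  push_cast; rfl

lemma abs_ouKer_le {a b : ℝ} (ha : 0 ≤ a) {s t : ℝ≥0} (hst : s ≤ t) : |ouKer a b t s| ≤ |b| := by
  unfold ouKer
  rw [abs_mul, Real.abs_exp]
  refine mul_le_of_le_one_right (abs_nonneg _) (Real.exp_le_one_iff.2 ?_)
  have : (s : ℝ) ≤ t := hst
  have : 0 ≤ a * (t - s) := mul_nonneg ha (by linarith)
  linarith

/-- The Riemann sums converge along every continuous path. -/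
theorem tendsto_rsum {a b : ℝ} (ha : 0 ≤ a) (t : ℝ≥0) {β : ℝ≥0 → ℝ} (hβ : Continuous β)
    (h0 : β 0 = 0) : Tendsto (fun m => rsum a b m t β) atTop (𝓝 (ou a b t β)) := by
  set bb : ℝ → ℝ := fun s => β s.toNNReal with hbb
  have cbb : Continuous bb := by fun_prop
  set g : ℝ → ℝ := fun s => b * Real.exp (-(a * (t - s))) with hg
  have hg' : ∀ s, HasDerivAt g (a * g s) s := by
    intro s
    have h1 : HasDerivAt (fun s : ℝ => -(a * (t - s))) a s := by
      have := ((hasDerivAt_id s).const_sub (t : ℝ)).const_mul (-a)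
      refine HasDerivAt.congr_deriv (f' := -a * -1) ?_ (by ring)
      exact this.congr_of_eventuallyEq (Eventually.of_forall fun u => by simp)
    refine ((h1.exp).const_mul b).congr_deriv ?_
    change _ = a * (b * Real.exp (-(a * (t - s))))
    ring
  have cg : Continuous g := by simp only [hg]; fun_prop
  have hou : ou a b t β = g t * bb t - ∫ s in (0 : ℝ)..t, bb s * (a * g s) := by
    unfold ou
    have e : ∀ s, bb s * (a * g s) = (b * a) * (Real.exp (-(a * (t - s))) * β s.toNNReal) := by
      intro s; simp only [hg, hbb]; ring
    simp_rw [e]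
    rw [intervalIntegral.integral_const_mul]
    simp only [hg, hbb, sub_self, mul_zero, neg_zero, Real.exp_zero, Real.toNNReal_coe]
    ring
  -- Summation by parts: `g_i (β_{i+1} - β_i) = (g_{i+1} β_{i+1} - g_i β_i) - β_{i+1} (g_{i+1} -
  -- g_i)`, where the last increment is the integral of `g' = a g` over the cell.
  have hrs : ∀ m : ℕ, 0 < m → rsum a b m t β = g t * bb t -
      ∑ i ∈ Finset.range m, ∫ s in (t * i / m : ℝ)..(t * (i + 1 : ℕ) / m),
        bb (t * (i + 1 : ℕ) / m) * (a * g s) := by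
    intro m hm
    have hm' : (m : ℝ) ≠ 0 := by positivity
    have e1 : ∀ i : ℕ, (∫ s in (t * i / m : ℝ)..(t * (i + 1 : ℕ) / m),
        bb (t * (i + 1 : ℕ) / m) * (a * g s)) =
        bb (t * (i + 1 : ℕ) / m) * (g (t * (i + 1 : ℕ) / m) - g (t * i / m)) := by
      intro i
      rw [intervalIntegral.integral_const_mul, intervalIntegral.integral_eq_sub_of_hasDerivAt
        (fun s _ => hg' s) ((cg.const_mul a).intervalIntegrable _ _)]
    simp_rw [e1]
    have tel := Finset.sum_range_sub (fun i : ℕ => g (t * i / m) * bb (t * i / m)) m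
    have hz : bb ((t : ℝ) * (0 : ℕ) / m) = 0 := by simp [hbb, h0]
    have he : (t : ℝ) * m / m = t := by field_simp
    rw [hz, he, mul_zero, sub_zero] at tel
    rw [← tel, ← Finset.sum_sub_distrib]
    unfold rsum
    refine Finset.sum_congr rfl fun i _ => ?_
    have b1 : bb (t * (i + 1 : ℕ) / m) = β (t * (i + 1) / m) := by
      simp only [hbb]; congr 1
      apply NNReal.eq
      rw [Real.coe_toNNReal _ (by positivity)]; push_cast; rfl
    have b2 : bb (t * i / m) = β (t * i / m) := by
      simp only [hbb]; congr 1
      apply NNReal.eq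
      rw [Real.coe_toNNReal _ (by positivity)]; push_cast; rfl
    have b3 : ouKer a b t (t * i / m) = g (t * i / m) := by
      simp only [ouKer, hg]; push_cast; rfl
    rw [b1, b2, b3]; ring
  have hdiff : ∀ m : ℕ, 0 < m → rsum a b m t β - ou a b t β =
      ∑ i ∈ Finset.range m, ∫ s in (t * i / m : ℝ)..(t * (i + 1 : ℕ) / m),
        (bb s - bb (t * (i + 1 : ℕ) / m)) * (a * g s) := by
    intro m hm
    have hm' : (m : ℝ) ≠ 0 := by positivity
    rw [hrs m hm, hou]
    have hadj := intervalIntegral.sum_integral_adjacent_intervals (μ := volume)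
      (f := fun s => bb s * (a * g s)) (a := fun i : ℕ => (t * i / m : ℝ)) (n := m)
      (fun i _ => (cbb.mul (cg.const_mul a)).intervalIntegrable _ _)
    have he : (t : ℝ) * m / m = t := by field_simp
    simp only [Nat.cast_zero, mul_zero, zero_div, he] at hadj
    rw [← hadj, sub_sub_sub_cancel_left, ← Finset.sum_sub_distrib]
    refine Finset.sum_congr rfl fun i _ => ?_
    rw [← intervalIntegral.integral_sub]
    · congr 1; funext s; ring
    · exact (cbb.mul (cg.const_mul a)).intervalIntegrable _ _
    · exact ((cg.const_mul a).const_mul _).intervalIntegrable _ _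
  rw [tendsto_iff_norm_sub_tendsto_zero, Metric.tendsto_atTop]
  intro ε hε
  -- `a |b| t` bounds the integral of `|a g|` over `[0, t]`; the `1` only keeps the denominator
  -- positive.
  set D : ℝ := a * |b| * t + 1 with hD
  have hDpos : 0 < D := by positivity
  have huc : UniformContinuousOn bb (Icc 0 t) :=
    isCompact_Icc.uniformContinuousOn_of_continuous cbb.continuousOn
  obtain ⟨δ, hδ, hδ'⟩ := Metric.uniformContinuousOn_iff.1 huc (ε / D) (by positivity)
  obtain ⟨m₀, hm₀⟩ := exists_nat_gt ((t : ℝ) / δ)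
  refine ⟨m₀ + 1, fun m hm => ?_⟩
  have hmpos : 0 < m := by omega
  have hmr : (0 : ℝ) < m := by positivity
  have hmesh : (t : ℝ) / m < δ := by
    rw [div_lt_iff₀ hmr]
    rw [div_lt_iff₀ hδ] at hm₀
    have : (m₀ : ℝ) < m := by exact_mod_cast hm
    nlinarith
  rw [Real.dist_eq, sub_zero, abs_norm, hdiff m hmpos]
  have hcell : ∀ i ∈ Finset.range m, ‖∫ s in (t * i / m : ℝ)..(t * (i + 1 : ℕ) / m),
      (bb s - bb (t * (i + 1 : ℕ) / m)) * (a * g s)‖ ≤ (ε / D * (a * |b|)) * (t / m) := by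
    intro i hi
    have hi' : ((i : ℝ) + 1) ≤ m := by exact_mod_cast Finset.mem_range.1 hi
    have hlen : (t * (i + 1 : ℕ) / m : ℝ) - t * i / m = t / m := by
      push_cast; field_simp; ring
    have hle : (t * i / m : ℝ) ≤ t * (i + 1 : ℕ) / m := by
      have : (0 : ℝ) ≤ t / m := by positivity
      linarith
    have hend : (t * (i + 1 : ℕ) / m : ℝ) ≤ t := by
      rw [div_le_iff₀ hmr]
      push_cast
      exact mul_le_mul_of_nonneg_left hi' t.2
    have hst : (0 : ℝ) ≤ t * i / m := by positivity
    have := intervalIntegral.norm_integral_le_of_norm_le_const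
      (f := fun s => (bb s - bb (t * (i + 1 : ℕ) / m)) * (a * g s)) (C := ε / D * (a * |b|))
      (a := (t * i / m : ℝ)) (b := t * (i + 1 : ℕ) / m) ?_
    · rwa [hlen, abs_of_nonneg (show (0 : ℝ) ≤ t / m by positivity)] at this
    · intro s hs
      rw [uIoc_of_le hle] at hs
      rw [norm_mul, norm_mul, Real.norm_of_nonneg ha]
      have h1 : ‖bb s - bb (t * (i + 1 : ℕ) / m)‖ ≤ ε / D := by
        refine (hδ' s ⟨hst.trans hs.1.le, hs.2.trans hend⟩ _ ⟨hst.trans hle, hend⟩ ?_).le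
        rw [Real.dist_eq, abs_sub_comm, abs_of_nonneg (by linarith [hs.2])]
        linarith [hs.1]
      have h2 : ‖g s‖ ≤ |b| := by
        simp only [hg]
        rw [norm_mul, Real.norm_eq_abs, Real.norm_eq_abs, Real.abs_exp]
        refine mul_le_of_le_one_right (abs_nonneg _) (Real.exp_le_one_iff.2 ?_)
        have : 0 ≤ a * (t - s) := mul_nonneg ha (by linarith [hs.2])
        linarith
      gcongr
  calc _ ≤ ∑ i ∈ Finset.range m, (ε / D * (a * |b|)) * (t / m : ℝ) :=
        (norm_sum_le _ _).trans (Finset.sum_le_sum hcell)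
    _ = ε * ((a * |b| * t) / D) := by
        rw [Finset.sum_const, Finset.card_range, nsmul_eq_mul]; field_simp
    _ < ε * 1 := by
        refine mul_lt_mul_of_pos_left ?_ hε
        rw [div_lt_one hDpos]; linarith
    _ = ε := mul_one _

/-- Taking `exp (-a t)` out of the integral leaves a primitive evaluated at `t`. -/
lemma continuous_ou (a b : ℝ) {β : ℝ≥0 → ℝ} (hβ : Continuous β) :
    Continuous fun t => ou a b t β := by
  have e : ∀ t : ℝ≥0, ou a b t β = b * (β t - a * (Real.exp (-(a * t)) *
      ∫ s in (0 : ℝ)..t, Real.exp (a * s) * β s.toNNReal)) := by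
    intro t
    have h : (∫ s in (0 : ℝ)..t, Real.exp (-(a * (t - s))) * β s.toNNReal) =
        Real.exp (-(a * t)) * ∫ s in (0 : ℝ)..t, Real.exp (a * s) * β s.toNNReal := by
      rw [← intervalIntegral.integral_const_mul]
      congr 1
      funext s
      rw [← mul_assoc, ← Real.exp_add]
      congr 2; ring
    rw [ou, h]
  simp_rw [e]
  have h : Continuous fun t : ℝ => ∫ s in (0 : ℝ)..t, Real.exp (a * s) * β s.toNNReal :=
    intervalIntegral.continuous_primitive (fun x y =>
      Continuous.intervalIntegrable (by fun_prop) x y) 0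
  have h2 : Continuous fun t : ℝ≥0 => ∫ s in (0 : ℝ)..t, Real.exp (a * s) * β s.toNNReal :=
    h.comp NNReal.continuous_coe
  fun_prop

lemma ou_zero (a b : ℝ) {β : ℝ≥0 → ℝ} (h0 : β 0 = 0) : ou a b 0 β = 0 := by
  simp [ou, h0]

/-! ### Step kernels and variances -/

/-- The kernel of the Wiener integral, as a function on the real line. -/
noncomputable def fullKer (a b : ℝ) (t : ℝ≥0) (u : ℝ) : ℝ :=
  (Ico (0 : ℝ) t).indicator (fun u => b * Real.exp (-(a * (t - u)))) u

/-- The step kernels of the Riemann sums. -/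
noncomputable def stepKer (a b : ℝ) (m : ℕ) (t : ℝ≥0) (u : ℝ) : ℝ :=
  ∑ i ∈ Finset.range m, ouKer a b t (t * i / m) *
    (Ico ((t * i / m : ℝ≥0) : ℝ) (t * (i + 1) / m : ℝ≥0)).indicator 1 u

lemma measurable_stepKer (a b : ℝ) (m : ℕ) (t : ℝ≥0) : Measurable (stepKer a b m t) := by
  unfold stepKer
  exact Finset.measurable_fun_sum _ fun i _ =>
    (measurable_one.indicator measurableSet_Ico).const_mul _

lemma measurable_fullKer (a b : ℝ) (t : ℝ≥0) : Measurable (fullKer a b t) := by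
  unfold fullKer
  exact Measurable.indicator (by fun_prop) measurableSet_Ico

/-- Only the cell that contains `u` contributes, and its index is `⌊u m / t⌋`. -/
lemma stepKer_eq {a b : ℝ} {m : ℕ} (hm : 0 < m) {t : ℝ≥0} {u : ℝ} (hu : u ∈ Ico (0 : ℝ) t) :
    ∃ s : ℝ≥0, (s : ℝ) ≤ u ∧ u < s + t / m ∧ stepKer a b m t u = ouKer a b t s := by
  have ht : (0 : ℝ) < t := hu.1.trans_lt hu.2
  have hmr : (0 : ℝ) < m := by positivity
  set i := ⌊u * m / t⌋₊ with hi
  have hnn : 0 ≤ u * m / t := div_nonneg (mul_nonneg hu.1 hmr.le) ht.le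
  have f1 : (i : ℝ) ≤ u * m / t := Nat.floor_le hnn
  have f2 : u * m / t < i + 1 := Nat.lt_floor_add_one _
  have g1 : (t * i / m : ℝ) ≤ u := by
    rw [div_le_iff₀ hmr]; rw [le_div_iff₀ ht] at f1; linarith
  have g2 : u < t * (i + 1) / m := by
    rw [lt_div_iff₀ hmr]; rw [div_lt_iff₀ ht] at f2; linarith
  have him : i < m := by
    have : (i : ℝ) < m := by
      refine f1.trans_lt ?_
      rw [div_lt_iff₀ ht]
      nlinarith [hu.2]
    exact_mod_cast this
  refine ⟨t * i / m, by rw [coe_grid]; exact g1, ?_, ?_⟩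
  · rw [coe_grid]
    have : (t * (i + 1) / m : ℝ) = t * i / m + t / m := by ring
    linarith
  · unfold stepKer
    rw [Finset.sum_eq_single i]
    · rw [indicator_of_mem, Pi.one_apply, mul_one]
      rw [coe_grid, coe_grid_succ]
      exact ⟨g1, g2⟩
    · intro j _ hj
      rw [indicator_of_notMem, mul_zero]
      rw [coe_grid, coe_grid_succ]
      rintro ⟨h1, h2⟩
      rw [div_le_iff₀ hmr] at h1
      rw [lt_div_iff₀ hmr] at h2
      rw [div_le_iff₀ hmr] at g1
      rw [lt_div_iff₀ hmr] at g2
      have k1 : (j : ℝ) < i + 1 := by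
        by_contra hcon
        push Not at hcon
        nlinarith
      have k2 : (i : ℝ) < j + 1 := by
        by_contra hcon
        push Not at hcon
        nlinarith
      have k1' : j < i + 1 := by exact_mod_cast k1
      have k2' : i < j + 1 := by exact_mod_cast k2
      omega
    · intro h; exact absurd (Finset.mem_range.2 him) h

lemma stepKer_eq_zero {a b : ℝ} {m : ℕ} {t : ℝ≥0} {u : ℝ} (hu : u ∉ Ico (0 : ℝ) t) :
    stepKer a b m t u = 0 := by
  unfold stepKer
  refine Finset.sum_eq_zero fun i hi => ?_
  rw [indicator_of_notMem, mul_zero]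
  rw [coe_grid, coe_grid_succ]
  rintro ⟨h1, h2⟩
  have him : ((i : ℝ) + 1) ≤ m := by exact_mod_cast Finset.mem_range.1 hi
  have hmr : (0 : ℝ) < m := by linarith [(Nat.cast_nonneg i : (0 : ℝ) ≤ i)]
  refine hu ⟨le_trans (by positivity) h1, h2.trans_le ?_⟩
  rw [div_le_iff₀ hmr]
  exact mul_le_mul_of_nonneg_left him t.2

lemma abs_stepKer_le {a b : ℝ} (ha : 0 ≤ a) (m : ℕ) (t : ℝ≥0) (u : ℝ) :
    |stepKer a b m t u| ≤ (Ico (0 : ℝ) t).indicator (fun _ => |b|) u := by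
  by_cases hu : u ∈ Ico (0 : ℝ) t
  · rw [indicator_of_mem hu]
    rcases Nat.eq_zero_or_pos m with rfl | hm
    · simp [stepKer]
    · obtain ⟨s, h1, _, h3⟩ := stepKer_eq (a := a) (b := b) hm hu
      rw [h3]
      refine abs_ouKer_le ha ?_
      have : (s : ℝ) ≤ t := h1.trans hu.2.le
      exact_mod_cast this
  · rw [stepKer_eq_zero hu, indicator_of_notMem hu, abs_zero]

lemma abs_fullKer_le {a b : ℝ} (ha : 0 ≤ a) (t : ℝ≥0) (u : ℝ) :
    |fullKer a b t u| ≤ (Ico (0 : ℝ) t).indicator (fun _ => |b|) u := by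
  unfold fullKer
  by_cases hu : u ∈ Ico (0 : ℝ) t
  · rw [indicator_of_mem hu, indicator_of_mem hu, abs_mul, Real.abs_exp]
    refine mul_le_of_le_one_right (abs_nonneg _) (Real.exp_le_one_iff.2 ?_)
    have : 0 ≤ a * (t - u) := mul_nonneg ha (by linarith [hu.2])
    linarith
  · rw [indicator_of_notMem hu, indicator_of_notMem hu, abs_zero]

lemma tendsto_stepKer (a b : ℝ) (t : ℝ≥0) (u : ℝ) :
    Tendsto (fun m => stepKer a b m t u) atTop (𝓝 (fullKer a b t u)) := by
  by_cases hu : u ∈ Ico (0 : ℝ) t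
  · have hs : ∀ m : ℕ, ∃ s : ℝ, (0 < m → s ≤ u ∧ u < s + t / m ∧
        stepKer a b m t u = b * Real.exp (-(a * (t - s)))) := by
      intro m
      by_cases hm : 0 < m
      · obtain ⟨s, h1, h2, h3⟩ := stepKer_eq (a := a) (b := b) hm hu
        exact ⟨s, fun _ => ⟨h1, h2, h3⟩⟩
      · exact ⟨0, fun h => absurd h hm⟩
    choose s hs using hs
    have hlim : Tendsto s atTop (𝓝 u) := by
      have hl : Tendsto (fun m : ℕ => u - (t : ℝ) / m) atTop (𝓝 u) := by
        simpa using (tendsto_const_div_atTop_nhds_zero_nat (t : ℝ)).const_sub u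
      refine tendsto_of_tendsto_of_tendsto_of_le_of_le' hl tendsto_const_nhds ?_ ?_
      · filter_upwards [eventually_gt_atTop 0] with m hm
        linarith [(hs m hm).2.1]
      · filter_upwards [eventually_gt_atTop 0] with m hm using (hs m hm).1
    have hc : Continuous fun s : ℝ => b * Real.exp (-(a * (t - s))) := by fun_prop
    unfold fullKer
    rw [indicator_of_mem hu]
    refine ((hc.tendsto u).comp hlim).congr' ?_
    filter_upwards [eventually_gt_atTop 0] with m hm
    exact ((hs m hm).2.2).symm
  · have : fullKer a b t u = 0 := indicator_of_notMem hu _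
    rw [this]
    simp_rw [stepKer_eq_zero hu]
    exact tendsto_const_nhds

lemma tendsto_integral_sq_of_bound {k : ℕ → ℝ → ℝ} {k' : ℝ → ℝ} {A : ℝ} {t : ℝ}
    (hk : ∀ m, Measurable (k m)) (hb : ∀ m u, |k m u| ≤ (Ico (0 : ℝ) t).indicator (fun _ => A) u)
    (hlim : ∀ u, Tendsto (fun m => k m u) atTop (𝓝 (k' u))) :
    Tendsto (fun m => ∫ u, k m u ^ 2) atTop (𝓝 (∫ u, k' u ^ 2)) := by
  refine tendsto_integral_of_dominated_convergence
    ((Ico (0 : ℝ) t).indicator fun _ => A ^ 2) (fun m => ((hk m).pow_const 2).aestronglyMeasurable)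
    ?_ (fun m => Eventually.of_forall fun u => ?_)
    (Eventually.of_forall fun u => (hlim u).pow 2)
  · rw [integrable_indicator_iff measurableSet_Ico]
    exact integrableOn_const (by simp) (by simp)
  · have := hb m u
    by_cases hu : u ∈ Ico (0 : ℝ) t
    · rw [indicator_of_mem hu] at this ⊢
      rw [Real.norm_eq_abs, abs_pow]
      gcongr
    · rw [indicator_of_notMem hu] at this ⊢
      have : k m u = 0 := abs_eq_zero.1 (le_antisymm this (abs_nonneg _))
      simp [this]

lemma abs_sub_le_indicator {t t' : ℝ≥0} {b b' : ℝ} {f g : ℝ → ℝ}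
    (hf : ∀ u, |f u| ≤ (Ico (0 : ℝ) t).indicator (fun _ => |b|) u)
    (hg : ∀ u, |g u| ≤ (Ico (0 : ℝ) t').indicator (fun _ => |b'|) u) (u : ℝ) :
    |f u - g u| ≤ (Ico (0 : ℝ) (max t t')).indicator (fun _ => |b| + |b'|) u := by
  have i1 : (Ico (0 : ℝ) t).indicator (fun _ => |b|) u ≤
      (Ico (0 : ℝ) (max t t')).indicator (fun _ => |b|) u :=
    indicator_le_indicator_of_subset (Ico_subset_Ico_right (le_max_left _ _))
      (fun _ => abs_nonneg _) u
  have i2 : (Ico (0 : ℝ) t').indicator (fun _ => |b'|) u ≤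
      (Ico (0 : ℝ) (max t t')).indicator (fun _ => |b'|) u :=
    indicator_le_indicator_of_subset (Ico_subset_Ico_right (le_max_right _ _))
      (fun _ => abs_nonneg _) u
  calc |f u - g u| ≤ |f u| + |g u| := abs_sub _ _
    _ ≤ _ := add_le_add ((hf u).trans i1) ((hg u).trans i2)
    _ = _ := by by_cases hu : u ∈ Ico (0 : ℝ) (max t t') <;> simp [hu]

/-- The variance of `∫₀ᵗ b e^{-a(t-s)} dB(s) - ∫₀^{t'} b' e^{-a'(t'-s)} dB(s)`. -/
noncomputable def kerVar (a b : ℝ) (t : ℝ≥0) (a' b' : ℝ) (t' : ℝ≥0) : ℝ :=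
  ∫ u : ℝ, (fullKer a b t u - fullKer a' b' t' u) ^ 2

lemma kerVar_nonneg (a b : ℝ) (t : ℝ≥0) (a' b' : ℝ) (t' : ℝ≥0) : 0 ≤ kerVar a b t a' b' t' :=
  integral_nonneg fun _ => sq_nonneg _

lemma map_rsum_sub {B : ℝ≥0 → Ω → ℝ} (hB : IsPreBrownianReal B P) (a b : ℝ) (m : ℕ) (t : ℝ≥0)
    (a' b' : ℝ) (m' : ℕ) (t' : ℝ≥0) :
    P.map (fun ω => rsum a b m t (B · ω) - rsum a' b' m' t' (B · ω)) = gaussianReal 0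
      (∫ u : ℝ, (stepKer a b m t u - stepKer a' b' m' t' u) ^ 2).toNNReal := by
  -- Both Riemann sums are written as a single sum over a disjoint union, the second with a minus
  -- sign.
  set c : ℕ ⊕ ℕ → ℝ := Sum.elim (fun i => ouKer a b t (t * i / m))
    (fun i => -ouKer a' b' t' (t' * i / m')) with hc
  set p : ℕ ⊕ ℕ → ℝ≥0 := Sum.elim (fun i => t * i / m) (fun i => t' * i / m') with hp
  set q : ℕ ⊕ ℕ → ℝ≥0 := Sum.elim (fun i => t * (i + 1) / m) (fun i => t' * (i + 1) / m') with hq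
  have hpq : ∀ i, p i ≤ q i := by
    rintro (i | i)
    · simp only [hp, hq, Sum.elim_inl]; gcongr; exact le_self_add
    · simp only [hp, hq, Sum.elim_inr]; gcongr; exact le_self_add
  have h := map_increment_sum hB ((Finset.range m).disjSum (Finset.range m')) c p q hpq
  simp only [Finset.sum_disjSum, hc, hp, hq, Sum.elim_inl, Sum.elim_inr, neg_mul,
    Finset.sum_neg_distrib, ← sub_eq_add_neg] at h
  exact h

/-! ### Families of independent Brownian motions -/

variable {ι : Type*}

/-- A family of independent Brownian motions with continuous paths, started in `0`. -/
structure IsBrownianFamily (P : Measure Ω) (B : ι → ℝ≥0 → Ω → ℝ) : Prop where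
  meas : ∀ i t, Measurable (B i t)
  cont : ∀ i ω, Continuous fun t => B i t ω
  zero : ∀ i ω, B i 0 ω = 0
  brownian : ∀ i, IsPreBrownianReal (B i) P
  indep : iIndepFun (fun i ω => fun t : ℝ≥0 => B i t ω) P

lemma measurable_rsum_path (a b : ℝ) (m : ℕ) (t : ℝ≥0) :
    Measurable fun β : ℝ≥0 → ℝ => rsum a b m t β := by
  unfold rsum
  fun_prop

lemma IsBrownianFamily.measurable_rsum {B : ι → ℝ≥0 → Ω → ℝ} (hB : IsBrownianFamily P B) (i : ι)
    (a b : ℝ) (m : ℕ) (t : ℝ≥0) : Measurable fun ω => rsum a b m t (B i · ω) :=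
  (measurable_rsum_path a b m t).comp (measurable_pi_lambda _ fun s => hB.meas i s)

lemma IsBrownianFamily.measurable_ou {B : ι → ℝ≥0 → Ω → ℝ} (hB : IsBrownianFamily P B) (i : ι)
    {a : ℝ} (ha : 0 ≤ a) (b : ℝ) (t : ℝ≥0) : Measurable fun ω => ou a b t (B i · ω) :=
  measurable_of_tendsto_metrizable (fun m => hB.measurable_rsum i a b m t)
    (tendsto_pi_nhds.2 fun ω => tendsto_rsum ha t (hB.cont i ω) (hB.zero i ω))

lemma IsBrownianFamily.isGaussArray {B : ι → ℝ≥0 → Ω → ℝ} (hB : IsBrownianFamily P B)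
    (a b : ι → ℝ) (m : ℕ) (t : ι → ℝ≥0) (a' b' : ι → ℝ) (m' : ℕ) (t' : ι → ℝ≥0) :
    IsGaussArray P
      (fun i ω => rsum (a i) (b i) m (t i) (B i · ω) - rsum (a' i) (b' i) m' (t' i) (B i · ω))
      (fun i => (∫ u : ℝ, (stepKer (a i) (b i) m (t i) u -
        stepKer (a' i) (b' i) m' (t' i) u) ^ 2).toNNReal) where
  meas i := (hB.measurable_rsum i _ _ _ _).sub (hB.measurable_rsum i _ _ _ _)
  law i := map_rsum_sub (hB.brownian i) _ _ _ _ _ _ _ _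
  indep := hB.indep.comp
    (fun i β => rsum (a i) (b i) m (t i) β - rsum (a' i) (b' i) m' (t' i) β)
    fun _ => (measurable_rsum_path _ _ _ _).sub (measurable_rsum_path _ _ _ _)

/-- Differences of Wiener integrals with exponential kernels, for independent Brownian motions,
are limits of Gaussian arrays. -/
theorem IsBrownianFamily.isGaussLimit {B : ι → ℝ≥0 → Ω → ℝ} (hB : IsBrownianFamily P B)
    {a a' : ι → ℝ} (ha : ∀ i, 0 ≤ a i) (ha' : ∀ i, 0 ≤ a' i) (b b' : ι → ℝ) (t t' : ι → ℝ≥0) :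
    IsGaussLimit P
      (fun i ω => ou (a i) (b i) (t i) (B i · ω) - ou (a' i) (b' i) (t' i) (B i · ω))
      (fun i => kerVar (a i) (b i) (t i) (a' i) (b' i) (t' i)) := by
  refine ⟨_, _, fun m => hB.isGaussArray a b m t a' b' m t', fun i ω => ?_, fun i => ?_⟩
  · exact (tendsto_rsum (ha i) _ (hB.cont i ω) (hB.zero i ω)).sub
      (tendsto_rsum (ha' i) _ (hB.cont i ω) (hB.zero i ω))
  · have e : ∀ m, ((∫ u : ℝ, (stepKer (a i) (b i) m (t i) u -
        stepKer (a' i) (b' i) m (t' i) u) ^ 2).toNNReal : ℝ) = _ := fun m =>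
      Real.coe_toNNReal _ (integral_nonneg fun _ => sq_nonneg _)
    simp_rw [e]
    exact tendsto_integral_sq_of_bound
      (fun m => (measurable_stepKer _ _ _ _).sub (measurable_stepKer _ _ _ _))
      (fun m => abs_sub_le_indicator (abs_stepKer_le (ha i) m (t i))
        (abs_stepKer_le (ha' i) m (t' i)))
      (fun u => (tendsto_stepKer _ _ _ u).sub (tendsto_stepKer _ _ _ u))

/-- The Riemann sums converge to the integral in `L²`. -/
theorem IsBrownianFamily.tendsto_mom_rsum {B : ι → ℝ≥0 → Ω → ℝ} (hB : IsBrownianFamily P B)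
    (i : ι) {a : ℝ} (ha : 0 ≤ a) (b : ℝ) (t : ℝ≥0) :
    Tendsto (fun m => mom P 2 fun ω => ‖rsum a b m t (B i · ω) - ou a b t (B i · ω)‖ₑ) atTop
      (𝓝 0) := by
  set v : ℕ → ℝ := fun m => ∫ u : ℝ, (stepKer a b m t u - fullKer a b t u) ^ 2 with hv
  have hvlim : Tendsto v atTop (𝓝 0) := by
    have := tendsto_integral_sq_of_bound
      (fun m => (measurable_stepKer a b m t).sub (measurable_fullKer a b t))
      (fun m => abs_sub_le_indicator (abs_stepKer_le ha m t) (abs_fullKer_le ha t))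
      (fun u => (tendsto_stepKer a b t u).sub tendsto_const_nhds)
    simpa using this
  have hle : ∀ m, mom P 2 (fun ω => ‖rsum a b m t (B i · ω) - ou a b t (B i · ω)‖ₑ) ≤
      gaussMom 2 * ENNReal.ofReal (v m) ^ (1 / 2 : ℝ) := by
    intro m
    -- The difference of the sums with `m` and `m'` cells is Gaussian with a variance given by step
    -- kernels; `m' → ∞` and Fatou's lemma replace the second sum by the integral.
    refine mom_le_of_tendsto (by norm_num)
      (f := fun m' ω => ‖rsum a b m t (B i · ω) - rsum a b m' t (B i · ω)‖ₑ)
      (fun m' => ((hB.measurable_rsum i _ _ _ _).sub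
        (hB.measurable_rsum i _ _ _ _)).enorm.aemeasurable)
      (Eventually.of_forall fun ω => (tendsto_const_nhds.sub
        (tendsto_rsum ha t (hB.cont i ω) (hB.zero i ω))).enorm)
      (fun m' => (mom_of_map_eq_gaussianReal ((hB.measurable_rsum i _ _ _ _).sub
        (hB.measurable_rsum i _ _ _ _)) (map_rsum_sub (hB.brownian i) a b m t a b m' t)
        (by norm_num)).le) ?_
    refine ENNReal.Tendsto.const_mul ?_ (Or.inr (gaussMom_ne_top (by norm_num)))
    refine (ENNReal.continuous_rpow_const.tendsto _).comp ?_
    refine ENNReal.tendsto_ofReal ?_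
    exact tendsto_integral_sq_of_bound
      (fun m' => (measurable_stepKer a b m t).sub (measurable_stepKer a b m' t))
      (fun m' => abs_sub_le_indicator (abs_stepKer_le ha m t) (abs_stepKer_le ha m' t))
      (fun u => tendsto_const_nhds.sub (tendsto_stepKer a b t u))
  refine tendsto_of_tendsto_of_tendsto_of_le_of_le tendsto_const_nhds ?_ (fun _ => zero_le) hle
  have h1 : Tendsto (fun m => ENNReal.ofReal (v m) ^ (1 / 2 : ℝ)) atTop (𝓝 0) := by
    have := (ENNReal.continuous_rpow_const (y := 1 / 2)).tendsto (ENNReal.ofReal 0) |>.comp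
      (ENNReal.tendsto_ofReal hvlim)
    simpa [Function.comp_def] using this
  simpa using ENNReal.Tendsto.const_mul h1 (Or.inr (gaussMom_ne_top (r := 2) (by norm_num)))

end Wiener

end RoughHeat

namespace RoughHeat

/-! ### Variances of the Fourier modes -/

section Variance

lemma integrable_sq_of_indicator_bound {k : ℝ → ℝ} (hk : Measurable k) {A t : ℝ}
    (hb : ∀ u, |k u| ≤ (Ico (0 : ℝ) t).indicator (fun _ => A) u) :
    Integrable fun u => k u ^ 2 := by
  refine Integrable.mono' (g := (Ico (0 : ℝ) t).indicator fun _ => A ^ 2) ?_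
    (hk.pow_const 2).aestronglyMeasurable (Eventually.of_forall fun u => ?_)
  · rw [integrable_indicator_iff measurableSet_Ico]
    exact integrableOn_const (by simp) (by simp)
  · have := hb u
    by_cases hu : u ∈ Ico (0 : ℝ) t
    · rw [indicator_of_mem hu] at this ⊢
      rw [Real.norm_eq_abs, abs_pow]
      gcongr
    · rw [indicator_of_notMem hu] at this ⊢
      have : k u = 0 := abs_eq_zero.1 (le_antisymm this (abs_nonneg _))
      simp [this]

lemma integrable_fullKer_sub_sq {a a' : ℝ} (ha : 0 ≤ a) (ha' : 0 ≤ a') (b b' : ℝ) (t t' : ℝ≥0) :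
    Integrable fun u => (fullKer a b t u - fullKer a' b' t' u) ^ 2 :=
  integrable_sq_of_indicator_bound ((measurable_fullKer a b t).sub (measurable_fullKer a' b' t'))
    (abs_sub_le_indicator (abs_fullKer_le ha t) (abs_fullKer_le ha' t'))

lemma kerVar_triangle {a a' a'' : ℝ} (ha : 0 ≤ a) (ha' : 0 ≤ a') (ha'' : 0 ≤ a'')
    (b b' b'' : ℝ) (t t' t'' : ℝ≥0) :
    kerVar a b t a'' b'' t'' ≤ 2 * kerVar a b t a' b' t' + 2 * kerVar a' b' t' a'' b'' t'' := by
  unfold kerVar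
  rw [← integral_const_mul, ← integral_const_mul, ← integral_add
    ((integrable_fullKer_sub_sq ha ha' _ _ _ _).const_mul _)
    ((integrable_fullKer_sub_sq ha' ha'' _ _ _ _).const_mul _)]
  refine integral_mono (integrable_fullKer_sub_sq ha ha'' _ _ _ _)
    (((integrable_fullKer_sub_sq ha ha' _ _ _ _).const_mul _).add
    ((integrable_fullKer_sub_sq ha' ha'' _ _ _ _).const_mul _)) fun u => ?_
  nlinarith [sq_nonneg ((fullKer a b t u - fullKer a' b' t' u) -
    (fullKer a' b' t' u - fullKer a'' b'' t'' u))]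

lemma kerVar_comm (a b : ℝ) (t : ℝ≥0) (a' b' : ℝ) (t' : ℝ≥0) :
    kerVar a b t a' b' t' = kerVar a' b' t' a b t := by
  unfold kerVar
  congr 1; funext u; ring

lemma fullKer_zero_right (a : ℝ) (t : ℝ≥0) (u : ℝ) : fullKer a 0 t u = 0 := by
  simp [fullKer]

lemma fullKer_zero_time (a b : ℝ) (u : ℝ) : fullKer a b 0 u = 0 := by
  simp [fullKer]

lemma integral_exp_Ico {l p q : ℝ} (hl : 0 < l) (hpq : p ≤ q) :
    ∫ u in Ico p q, Real.exp (-(l * (q - u))) ≤ 1 / l := by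
  rw [integral_Ico_eq_integral_Ioc, ← intervalIntegral.integral_of_le hpq]
  have hd : ∀ u ∈ uIcc p q, HasDerivAt (fun u => Real.exp (-(l * (q - u))) / l)
      (Real.exp (-(l * (q - u)))) u := by
    intro u _
    have h1 : HasDerivAt (fun u : ℝ => -(l * (q - u))) l u := by
      have := ((hasDerivAt_id u).const_sub q).const_mul (-l)
      refine HasDerivAt.congr_deriv (f' := -l * -1) ?_ (by ring)
      exact this.congr_of_eventuallyEq (Eventually.of_forall fun u => by simp)
    refine (h1.exp.div_const l).congr_deriv ?_
    field_simp
  rw [intervalIntegral.integral_eq_sub_of_hasDerivAt hd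
    (Continuous.intervalIntegrable (by fun_prop) _ _)]
  have : 0 < Real.exp (-(l * (q - p))) / l := by positivity
  simp only [sub_self, mul_zero, neg_zero, Real.exp_zero]
  linarith

lemma integral_exp_Ico_le_length {l p q : ℝ} (hl : 0 ≤ l) (hpq : p ≤ q) :
    ∫ u in Ico p q, Real.exp (-(l * (q - u))) ≤ q - p := by
  have h : ∫ u in Ico p q, Real.exp (-(l * (q - u))) ≤ ∫ u in Ico p q, (1 : ℝ) := by
    refine setIntegral_mono_on ?_ (integrableOn_const (by simp) (by simp)) measurableSet_Ico
      fun u hu => ?_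
    · exact (Continuous.integrableOn_Icc (by fun_prop)).mono_set Ico_subset_Icc_self
    · rw [Real.exp_le_one_iff]
      have : 0 ≤ l * (q - u) := mul_nonneg hl (by linarith [hu.2])
      linarith
  refine h.trans (le_of_eq ?_)
  simp [hpq]

/-- On `[0, s)` the later kernel is `exp (-a (t - s))` times the earlier one; on `[s, t)` only the
later one is present. -/
lemma kerVar_time_le_aux (a b : ℝ) {s t : ℝ≥0} (hst : s ≤ t) :
    kerVar a b t a b s ≤ b ^ 2 * ((1 - Real.exp (-(a * ((t : ℝ) - s)))) ^ 2 *
      (∫ u in Ico (0 : ℝ) s, Real.exp (-((2 * a) * (s - u)))) +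
      ∫ u in Ico (s : ℝ) t, Real.exp (-((2 * a) * (t - u)))) := by
  have hst' : (s : ℝ) ≤ t := hst
  set k₁ : ℝ → ℝ := fun u => Real.exp (-((2 * a) * (s - u)))
  set k₂ : ℝ → ℝ := fun u => Real.exp (-((2 * a) * (t - u)))
  have i1 : Integrable ((Ico (0 : ℝ) s).indicator k₁) := by
    rw [integrable_indicator_iff measurableSet_Ico]
    exact (Continuous.integrableOn_Icc (by fun_prop)).mono_set Ico_subset_Icc_self
  have i2 : Integrable ((Ico (s : ℝ) t).indicator k₂) := by
    rw [integrable_indicator_iff measurableSet_Ico]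
    exact (Continuous.integrableOn_Icc (by fun_prop)).mono_set Ico_subset_Icc_self
  rw [← integral_indicator measurableSet_Ico, ← integral_indicator measurableSet_Ico,
    ← integral_const_mul, ← integral_add (i1.const_mul _) i2, ← integral_const_mul]
  unfold kerVar
  refine le_of_eq (integral_congr_ae (Eventually.of_forall fun u => ?_))
  unfold fullKer
  by_cases h0 : 0 ≤ u
  · by_cases h1 : u < s
    · have m1 : u ∈ Ico (0 : ℝ) t := ⟨h0, h1.trans_le hst'⟩
      have m2 : u ∈ Ico (0 : ℝ) s := ⟨h0, h1⟩
      have m3 : u ∉ Ico (s : ℝ) t := fun h => absurd h.1 (not_le.2 h1)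
      simp only [indicator_of_mem m1, indicator_of_mem m2, indicator_of_notMem m3, k₁]
      have e1 : Real.exp (-(a * ((t : ℝ) - u))) =
          Real.exp (-(a * (t - s))) * Real.exp (-(a * (s - u))) := by
        rw [← Real.exp_add]; congr 1; ring
      have e2 : Real.exp (-(2 * a * ((s : ℝ) - u))) = Real.exp (-(a * (s - u))) ^ 2 := by
        rw [← Real.exp_nat_mul]; congr 1; push_cast; ring
      rw [e1, e2]; ring
    · push Not at h1
      by_cases h2 : u < t
      · have m1 : u ∈ Ico (0 : ℝ) t := ⟨h0, h2⟩
        have m2 : u ∉ Ico (0 : ℝ) s := fun h => absurd h.2 (not_lt.2 h1)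
        have m3 : u ∈ Ico (s : ℝ) t := ⟨h1, h2⟩
        simp only [indicator_of_mem m1, indicator_of_notMem m2, indicator_of_mem m3, k₂]
        have e2 : Real.exp (-(2 * a * ((t : ℝ) - u))) = Real.exp (-(a * (t - u))) ^ 2 := by
          rw [← Real.exp_nat_mul]; congr 1; push_cast; ring
        rw [e2]; ring
      · have m1 : u ∉ Ico (0 : ℝ) t := fun h => h2 h.2
        have m2 : u ∉ Ico (0 : ℝ) s := fun h => absurd h.2 (not_lt.2 h1)
        have m3 : u ∉ Ico (s : ℝ) t := fun h => h2 h.2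
        simp only [indicator_of_notMem m1, indicator_of_notMem m2, indicator_of_notMem m3]
        ring
  · have m1 : u ∉ Ico (0 : ℝ) t := fun h => h0 h.1
    have m2 : u ∉ Ico (0 : ℝ) s := fun h => h0 h.1
    have m3 : u ∉ Ico (s : ℝ) t := fun h => h0 (s.2.trans h.1)
    simp only [indicator_of_notMem m1, indicator_of_notMem m2, indicator_of_notMem m3]
    ring

/-- `(1 - e^{-x})² ≤ x` for `x = a (t - s)` cancels the factor `1 / (2a)` of the integral, so the
bound does not see the rate `a`. -/
lemma kerVar_time_le {a : ℝ} (ha : 0 ≤ a) (b : ℝ) (s t : ℝ≥0) :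
    kerVar a b t a b s ≤ 2 * b ^ 2 * dist s t := by
  wlog hst : s ≤ t generalizing s t
  · rw [kerVar_comm, dist_comm]
    exact this t s (le_of_not_ge hst)
  have hst' : (s : ℝ) ≤ t := hst
  refine (kerVar_time_le_aux a b hst).trans ?_
  rw [NNReal.dist_eq, abs_sub_comm, abs_of_nonneg (sub_nonneg.2 hst')]
  have h2 := integral_exp_Ico_le_length (l := 2 * a) (by positivity) hst'
  have h1 : (1 - Real.exp (-(a * ((t : ℝ) - s)))) ^ 2 *
      (∫ u in Ico (0 : ℝ) s, Real.exp (-((2 * a) * (s - u)))) ≤ t - s := by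
    rcases ha.eq_or_lt with rfl | hpos
    · simpa using hst'
    · have hI := integral_exp_Ico (l := 2 * a) (by positivity) s.2
      have hx : 0 ≤ a * ((t : ℝ) - s) := mul_nonneg ha (by linarith)
      have e1 := Real.one_sub_le_exp_neg (a * ((t : ℝ) - s))
      have e2 : Real.exp (-(a * ((t : ℝ) - s))) ≤ 1 := Real.exp_le_one_iff.2 (by linarith)
      have e3 := Real.exp_pos (-(a * ((t : ℝ) - s)))
      have hsq : (1 - Real.exp (-(a * ((t : ℝ) - s)))) ^ 2 ≤ a * (t - s) := by nlinarith
      calc _ ≤ (a * (t - s)) * (1 / (2 * a)) := by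
            refine mul_le_mul hsq hI ?_ hx
            exact integral_nonneg fun _ => (Real.exp_pos _).le
        _ = (t - s) / 2 := by field_simp
        _ ≤ t - s := by linarith
  calc _ ≤ b ^ 2 * ((t - s) + (t - s)) := by gcongr
    _ = _ := by ring

/-- Both integrals are at most `1 / (2a)` whatever the times are; this is the source of the decay in
`k`. -/
lemma kerVar_time_le' {a : ℝ} (ha : 0 < a) (b : ℝ) (s t : ℝ≥0) :
    kerVar a b t a b s ≤ b ^ 2 / a := by
  wlog hst : s ≤ t generalizing s t
  · rw [kerVar_comm]
    exact this t s (le_of_not_ge hst)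
  have hst' : (s : ℝ) ≤ t := hst
  refine (kerVar_time_le_aux a b hst).trans ?_
  have h2 := integral_exp_Ico (l := 2 * a) (by positivity) hst'
  have hI := integral_exp_Ico (l := 2 * a) (by positivity) s.2
  have hx : 0 ≤ a * ((t : ℝ) - s) := mul_nonneg ha.le (by linarith)
  have e2 : Real.exp (-(a * ((t : ℝ) - s))) ≤ 1 := Real.exp_le_one_iff.2 (by linarith)
  have e3 := Real.exp_pos (-(a * ((t : ℝ) - s)))
  have hsq : (1 - Real.exp (-(a * ((t : ℝ) - s)))) ^ 2 ≤ 1 := by nlinarith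
  calc _ ≤ b ^ 2 * (1 * (1 / (2 * a)) + 1 / (2 * a)) := by
        gcongr
        exact hI
    _ = _ := by field_simp; ring

/-- At time lag `r` the kernels differ by at most `|b - b'| e^{-ar} + |b'| |a - a'| r e^{-lr}`, and
`r e^{-lr} ≤ (2/l) e^{-lr/2}`. For the heat equation `l` is of order `k²` and `|a - a'|` of order
`k² ε|k|`; the bracket is then of order `ε|k|` and the variance of order `ε²`, uniformly in `k`. -/
lemma kerVar_diff_le {a a' l : ℝ} (hl : 0 < l) (ha : l ≤ a) (ha' : l ≤ a') (b b' : ℝ) (t : ℝ≥0) :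
    kerVar a b t a' b' t ≤ (|b - b'| + 2 * |b'| * |a - a'| / l) ^ 2 / l := by
  set D := |b - b'| + 2 * |b'| * |a - a'| / l with hD
  have hD0 : 0 ≤ D := by positivity
  have hexp : ∀ x y r : ℝ, 0 ≤ r → l ≤ x → x ≤ y →
      |Real.exp (-(x * r)) - Real.exp (-(y * r))| ≤ (y - x) * r * Real.exp (-(l * r)) := by
    intro x y r hr hx hxy
    have h1 : Real.exp (-(y * r)) = Real.exp (-(x * r)) * Real.exp (-((y - x) * r)) := by
      rw [← Real.exp_add]; congr 1; ring
    have h2 := Real.one_sub_le_exp_neg ((y - x) * r)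
    have h3 : Real.exp (-((y - x) * r)) ≤ 1 :=
      Real.exp_le_one_iff.2 (by have := mul_nonneg (sub_nonneg.2 hxy) hr; linarith)
    have h4 : Real.exp (-(x * r)) ≤ Real.exp (-(l * r)) :=
      Real.exp_le_exp.2 (by have := mul_le_mul_of_nonneg_right hx hr; linarith)
    have h5 := Real.exp_pos (-(x * r))
    have h6 := mul_nonneg (sub_nonneg.2 hxy) hr
    rw [h1, abs_of_nonneg (by nlinarith)]
    calc _ = Real.exp (-(x * r)) * (1 - Real.exp (-((y - x) * r))) := by ring
      _ ≤ Real.exp (-(l * r)) * ((y - x) * r) := by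
          refine mul_le_mul h4 (by linarith) (by linarith) (Real.exp_pos _).le
      _ = _ := by ring
  have hexp' : ∀ r : ℝ, 0 ≤ r →
      |Real.exp (-(a * r)) - Real.exp (-(a' * r))| ≤ |a - a'| * r * Real.exp (-(l * r)) := by
    intro r hr
    rcases le_total a a' with h | h
    · rw [abs_sub_comm a, abs_of_nonneg (sub_nonneg.2 h)]
      exact hexp a a' r hr ha h
    · rw [abs_sub_comm, abs_of_nonneg (sub_nonneg.2 h)]
      exact hexp a' a r hr ha' h
  have hpt : ∀ r : ℝ, 0 ≤ r → |b * Real.exp (-(a * r)) - b' * Real.exp (-(a' * r))| ≤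
      D * Real.exp (-(l / 2 * r)) := by
    intro r hr
    have e1 : b * Real.exp (-(a * r)) - b' * Real.exp (-(a' * r)) =
        (b - b') * Real.exp (-(a * r)) + b' * (Real.exp (-(a * r)) - Real.exp (-(a' * r))) := by
      ring
    have e2 : Real.exp (-(a * r)) ≤ Real.exp (-(l / 2 * r)) :=
      Real.exp_le_exp.2 (by nlinarith)
    have e3 : r * Real.exp (-(l * r)) ≤ 2 / l * Real.exp (-(l / 2 * r)) := by
      have h1 : Real.exp (-(l * r)) = Real.exp (-(l / 2 * r)) * Real.exp (-(l / 2 * r)) := by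
        rw [← Real.exp_add]; congr 1; ring
      have h2 : l / 2 * r * Real.exp (-(l / 2 * r)) ≤ 1 := by
        rw [Real.exp_neg, ← div_eq_mul_inv, div_le_one (Real.exp_pos _)]
        linarith [Real.add_one_le_exp (l / 2 * r)]
      have h3 := Real.exp_pos (-(l / 2 * r))
      have h4 : r * Real.exp (-(l / 2 * r)) ≤ 2 / l := by
        rw [le_div_iff₀ hl]; linarith
      rw [h1, ← mul_assoc]
      gcongr
    rw [e1]
    refine (abs_add_le _ _).trans ?_
    rw [abs_mul, abs_mul, Real.abs_exp]
    calc _ ≤ |b - b'| * Real.exp (-(l / 2 * r)) +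
          |b'| * (|a - a'| * r * Real.exp (-(l * r))) := by
          gcongr
          exact hexp' r hr
      _ = |b - b'| * Real.exp (-(l / 2 * r)) + |b'| * |a - a'| * (r * Real.exp (-(l * r))) := by
          ring
      _ ≤ |b - b'| * Real.exp (-(l / 2 * r)) +
          |b'| * |a - a'| * (2 / l * Real.exp (-(l / 2 * r))) := by gcongr
      _ = _ := by rw [hD]; ring
  have hI := integral_exp_Ico hl (p := 0) (q := t) t.2
  have hmaj : ∀ u, (fullKer a b t u - fullKer a' b' t u) ^ 2 ≤
      D ^ 2 * (Ico (0 : ℝ) t).indicator (fun u => Real.exp (-(l * (t - u)))) u := by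
    intro u
    unfold fullKer
    by_cases hu : u ∈ Ico (0 : ℝ) t
    · simp only [indicator_of_mem hu]
      have h := hpt (t - u) (by linarith [hu.2])
      have e : Real.exp (-(l * ((t : ℝ) - u))) = Real.exp (-(l / 2 * (t - u))) ^ 2 := by
        rw [← Real.exp_nat_mul]; congr 1; push_cast; ring
      rw [e, ← mul_pow, ← sq_abs]
      gcongr
    · simp [indicator_of_notMem hu]
  have hint : Integrable ((Ico (0 : ℝ) t).indicator fun u => Real.exp (-(l * (t - u)))) := by
    rw [integrable_indicator_iff measurableSet_Ico]
    exact (Continuous.integrableOn_Icc (by fun_prop)).mono_set Ico_subset_Icc_self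
  calc kerVar a b t a' b' t ≤ ∫ u, D ^ 2 *
        (Ico (0 : ℝ) t).indicator (fun u => Real.exp (-(l * (t - u)))) u :=
        integral_mono (integrable_fullKer_sub_sq (hl.le.trans ha) (hl.le.trans ha') _ _ _ _)
          (hint.const_mul _) hmaj
    _ = D ^ 2 * ∫ u in Ico (0 : ℝ) t, Real.exp (-(l * (t - u))) := by
        rw [integral_const_mul, integral_indicator measurableSet_Ico]
    _ ≤ D ^ 2 * (1 / l) := by gcongr
    _ = _ := by ring

/-! ### Systems of Fourier modes and their distances -/

/-- The decay rates and noise strengths of the Fourier modes. -/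
structure Modes where
  /-- the decay rate of the `k`-th mode -/
  a : ℤ → ℝ
  /-- the strength of the noise in the `k`-th mode -/
  b : ℤ → ℝ

/-- The decay of the variance of the Fourier modes. -/
noncomputable def modeWeight (k : ℤ) : ℝ := (1 + (k : ℝ) ^ 2)⁻¹

lemma modeWeight_pos (k : ℤ) : 0 < modeWeight k := by unfold modeWeight; positivity

lemma modeWeight_le_one (k : ℤ) : modeWeight k ≤ 1 := by
  unfold modeWeight
  exact inv_le_one_of_one_le₀ (by nlinarith [sq_nonneg (k : ℝ)])

lemma one_le_sq_of_ne_zero {k : ℤ} (hk : k ≠ 0) : (1 : ℝ) ≤ (k : ℝ) ^ 2 := by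
  have : 1 ≤ k ^ 2 := by have := sq_pos_of_ne_zero hk; omega
  exact_mod_cast this

/-- Uniform nondegeneracy of the decay rates, and boundedness of the noise strengths. -/
structure Modes.Bounded (θ : Modes) (c M : ℝ) : Prop where
  nonneg : ∀ k, 0 ≤ θ.a k
  bound : ∀ k, |θ.b k| ≤ M
  -- Required of noisy modes only: modes with `f = ⊤` and those of the system without noise carry
  -- the rate `0`.
  lower : ∀ k, θ.b k ≠ 0 → c * (k : ℝ) ^ 2 ≤ θ.a k

/-- The constant in the variance bounds. -/
noncomputable def varConst (c M : ℝ) (T : ℝ≥0) : ℝ := 2 * M ^ 2 * (1 + T) + 2 * M ^ 2 / c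

lemma varConst_nonneg {c : ℝ} (hc : 0 < c) (M : ℝ) (T : ℝ≥0) : 0 ≤ varConst c M T := by
  unfold varConst; positivity

lemma Modes.Bounded.kerVar_time {θ : Modes} {c M : ℝ} (hc : 0 < c) (hθ : θ.Bounded c M)
    (T : ℝ≥0) (k : ℤ) {s t : ℝ≥0} (hs : s ≤ T) (ht : t ≤ T) :
    kerVar (θ.a k) (θ.b k) t (θ.a k) (θ.b k) s ≤
      varConst c M T * min (dist s t) (modeWeight k) := by
  have hb2 : θ.b k ^ 2 ≤ M ^ 2 := by
    rw [← sq_abs]; exact pow_le_pow_left₀ (abs_nonneg _) (hθ.bound k) 2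
  have h1 := kerVar_time_le (hθ.nonneg k) (θ.b k) s t
  have hd : dist s t ≤ T := by
    have h3 : (s : ℝ) ≤ T := hs
    have h4 : (t : ℝ) ≤ T := ht
    have h5 := s.2
    have h6 := t.2
    rw [NNReal.dist_eq, abs_le]
    constructor <;> linarith
  have hd0 : 0 ≤ dist s t := dist_nonneg
  have hT : (0 : ℝ) ≤ T := T.2
  have hC : 2 * M ^ 2 ≤ varConst c M T := by
    unfold varConst
    have : 0 ≤ 2 * M ^ 2 / c := by positivity
    nlinarith [sq_nonneg M, mul_nonneg (sq_nonneg M) hT]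
  rw [mul_min_of_nonneg _ _ (varConst_nonneg hc M T)]
  refine le_min ?_ ?_
  · calc _ ≤ 2 * θ.b k ^ 2 * dist s t := h1
      _ ≤ 2 * M ^ 2 * dist s t := by gcongr
      _ ≤ _ := by gcongr
  · by_cases hb : θ.b k = 0
    · have : kerVar (θ.a k) (θ.b k) t (θ.a k) (θ.b k) s = 0 := by
        simp [kerVar, hb, fullKer_zero_right]
      rw [this]
      exact mul_nonneg (varConst_nonneg hc M T) (modeWeight_pos k).le
    -- The zero mode has no damping; its variance is bounded because the times are at most `T`.
    by_cases hk : k = 0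
    · have hw : modeWeight k = 1 := by simp [modeWeight, hk]
      rw [hw, mul_one]
      calc _ ≤ 2 * θ.b k ^ 2 * dist s t := h1
        _ ≤ 2 * M ^ 2 * T := by gcongr
        _ ≤ _ := by
            unfold varConst
            have : 0 ≤ 2 * M ^ 2 / c := by positivity
            nlinarith [sq_nonneg M]
    · have hk2 := one_le_sq_of_ne_zero hk
      have hck : 0 < c * (k : ℝ) ^ 2 := by positivity
      have hlow := hθ.lower k hb
      calc _ ≤ θ.b k ^ 2 / θ.a k := kerVar_time_le' (hck.trans_le hlow) _ _ _
        _ ≤ M ^ 2 / (c * (k : ℝ) ^ 2) := by gcongr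
        _ ≤ 2 * M ^ 2 / c * modeWeight k := by
            unfold modeWeight
            rw [← div_eq_mul_inv, div_div, div_le_div_iff₀ hck (by positivity)]
            have h0 : 0 ≤ M ^ 2 * c := by positivity
            nlinarith
        _ ≤ _ := by
            gcongr
            · exact (modeWeight_pos k).le
            · unfold varConst
              have : 0 ≤ 2 * M ^ 2 * (1 + (T : ℝ)) := by positivity
              linarith

/-- Two mode systems differ, in variance, by at most `C min (η ^ 2) (1 + k ^ 2)⁻¹`. -/
def Modes.Close (θ θ' : Modes) (C η : ℝ) (T : ℝ≥0) : Prop :=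
  ∀ k, ∀ t ≤ T, kerVar (θ.a k) (θ.b k) t (θ'.a k) (θ'.b k) t ≤ C * min (η ^ 2) (modeWeight k)

/-- A mode without noise has the same vanishing kernel as a mode at time `0`, so absolute bounds are
time increments from `0`. -/
lemma kerVar_eq_time_zero (a b a' : ℝ) (t : ℝ≥0) : kerVar a b t a' 0 t = kerVar a b t a b 0 := by
  simp [kerVar, fullKer_zero_right, fullKer_zero_time]

/-- The system without noise. -/
def Modes.zero : Modes := ⟨fun _ => 0, fun _ => 0⟩

lemma Modes.bounded_zero {c M : ℝ} (hM : 0 ≤ M) : Modes.zero.Bounded c M where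
  nonneg _ := le_rfl
  bound _ := by simpa [Modes.zero] using hM
  lower _ h := absurd rfl h

lemma Modes.Bounded.kerVar_zero {θ : Modes} {c M : ℝ} (hc : 0 < c) (hθ : θ.Bounded c M)
    {T : ℝ≥0} (k : ℤ) {t : ℝ≥0} (ht : t ≤ T) (a' : ℝ) :
    kerVar (θ.a k) (θ.b k) t a' 0 t ≤ varConst c M T * modeWeight k := by
  rw [kerVar_eq_time_zero]
  refine (hθ.kerVar_time hc T k zero_le ht).trans ?_
  gcongr
  · exact varConst_nonneg hc M T
  · exact min_le_right _ _

lemma Modes.Bounded.close_zero {θ : Modes} {c M : ℝ} (hc : 0 < c) (hθ : θ.Bounded c M) (T : ℝ≥0) :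
    θ.Close Modes.zero (varConst c M T) 1 T := by
  intro k t ht
  rw [one_pow, min_eq_right (modeWeight_le_one k)]
  exact hθ.kerVar_zero hc k ht _

/-- Truncation of the noise to the modes `|k| ≤ N`. -/
def Modes.trunc (θ : Modes) (N : ℕ) : Modes := ⟨θ.a, fun k => if |k| ≤ N then θ.b k else 0⟩

lemma Modes.Bounded.trunc {θ : Modes} {c M : ℝ} (hM : 0 ≤ M) (hθ : θ.Bounded c M) (N : ℕ) :
    (θ.trunc N).Bounded c M where
  nonneg := hθ.nonneg
  bound k := by
    unfold Modes.trunc; dsimp only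
    split_ifs
    · exact hθ.bound k
    · simpa using hM
  lower k h := by
    refine hθ.lower k fun h0 => h ?_
    simp [Modes.trunc, h0]

/-- The discarded modes have `|k| ≥ N + 1`, hence weight at most `(N + 1)⁻²`. Truncation is thus a
perturbation of the same kind as a change of `ε`. -/
lemma Modes.Bounded.close_trunc {θ : Modes} {c M : ℝ} (hc : 0 < c) (hθ : θ.Bounded c M)
    (N : ℕ) (T : ℝ≥0) : θ.Close (θ.trunc N) (varConst c M T) (1 / (N + 1)) T := by
  intro k t ht
  have hC := varConst_nonneg hc M T
  by_cases hk : |k| ≤ N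
  · have h0 : kerVar (θ.a k) (θ.b k) t ((θ.trunc N).a k) ((θ.trunc N).b k) t = 0 := by
      simp [Modes.trunc, hk, kerVar]
    rw [h0]
    exact mul_nonneg hC (le_min (sq_nonneg _) (modeWeight_pos k).le)
  · have hb : (θ.trunc N).b k = 0 := by simp [Modes.trunc, hk]
    rw [hb]
    refine (hθ.kerVar_zero hc k ht _).trans ?_
    gcongr
    refine le_min ?_ le_rfl
    have h1 : ((N : ℝ) + 1) ≤ |(k : ℝ)| := by
      have : ((N : ℤ) + 1) ≤ |k| := by omega
      have h := (Int.cast_le (R := ℝ)).2 this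
      push_cast at h
      exact h
    have h2 : ((N : ℝ) + 1) ^ 2 ≤ (k : ℝ) ^ 2 := by
      rw [← sq_abs (k : ℝ)]; gcongr
    unfold modeWeight
    rw [one_div, inv_pow]
    apply inv_anti₀ (by positivity)
    linarith

/-! ### The modes of the heat equation and their dependence on ε -/

variable {f : ℝ → ℝ≥0∞} {h : ℝ → ℝ}

/-- The modes of the approximate stochastic heat equation. -/
noncomputable def heatModes (f : ℝ → ℝ≥0∞) (h : ℝ → ℝ) (ε : ℝ≥0) : Modes where
  a k := (k : ℝ) ^ 2 * (f (ε * k)).toReal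
  -- For `f = ⊤` the factor `exp (-∞)` kills the mode. As `toReal` turns this rate into `0`, the
  -- vanishing is recorded in the strength.
  b k := if f (ε * k) = ⊤ then 0 else h (ε * k)

/-- Positive frequencies are covered by `f ≥ 2c`, negative ones by evenness, and `f 0 = 1` explains
the `1` in the minimum. -/
lemma CutoffAssumptions.exists_bounded (hfh : CutoffAssumptions f h) :
    ∃ c M : ℝ, 0 < c ∧ 0 ≤ M ∧ ∀ ε : ℝ≥0, (heatModes f h ε).Bounded c M := by
  obtain ⟨c, hc, _, hf, _⟩ := hfh.f_lower
  obtain ⟨M, hM⟩ := hfh.h_bounded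
  have hM0 : 0 ≤ M := (abs_nonneg _).trans (hM 0)
  refine ⟨min 1 (2 * c), M, lt_min one_pos (by linarith), hM0, fun ε => ⟨fun k => ?_, fun k => ?_,
    fun k hb => ?_⟩⟩
  · exact mul_nonneg (sq_nonneg _) ENNReal.toReal_nonneg
  · unfold heatModes; dsimp only
    split_ifs
    · simpa using hM0
    · exact hM _
  · unfold heatModes at hb ⊢
    dsimp only at hb ⊢
    have hft : f (ε * k) ≠ ⊤ := fun h => hb (by simp [h])
    rw [mul_comm]
    gcongr
    have key : ∀ x : ℝ, f x ≠ ⊤ → min 1 (2 * c) ≤ (f x).toReal := by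
      intro x hx
      rcases lt_trichotomy x 0 with h | h | h
      · refine (min_le_right _ _).trans ?_
        rw [← ENNReal.ofReal_le_iff_le_toReal hx, ← hfh.f_even]
        exact hf _ (by linarith)
      · rw [h, hfh.f_zero]; simp
      · refine (min_le_right _ _).trans ?_
        rw [← ENNReal.ofReal_le_iff_le_toReal hx]
        exact hf _ h
    exact key _ hft

/-- First-order expansions at `0`. The radius is cut so that `L |x| ≤ 1/2`, which keeps `f ≥ 1/2`.
-/
lemma CutoffAssumptions.exists_lipschitz (hfh : CutoffAssumptions f h) :
    ∃ δ L : ℝ, 0 < δ ∧ 0 ≤ L ∧ ∀ x, |x| ≤ δ →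
      f x ≠ ⊤ ∧ 1 / 2 ≤ (f x).toReal ∧ |(f x).toReal - 1| ≤ L * |x| ∧ |h x - 1| ≤ L * |x| := by
  obtain ⟨δ, hδ, hft, hfc⟩ := hfh.f_smooth
  have hf0 : DifferentiableAt ℝ (fun k => (f k).toReal) 0 :=
    (hfc.contDiffAt (Icc_mem_nhds (by linarith) hδ)).differentiableAt (by norm_num)
  have hh0 : DifferentiableAt ℝ h 0 := hfh.h_diff.self_of_nhds
  obtain ⟨L₁, hL₁⟩ := hf0.isBigO_sub.bound
  obtain ⟨L₂, hL₂⟩ := hh0.isBigO_sub.bound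
  obtain ⟨r, hr, hball⟩ := Metric.eventually_nhds_iff.1 (hL₁.and hL₂)
  set L := max 0 (max L₁ L₂) with hL
  have hL0 : 0 ≤ L := le_max_left _ _
  refine ⟨min δ (min (r / 2) (1 / (2 * (L + 1)))), L, lt_min hδ (lt_min (by linarith)
    (by positivity)), hL0, fun x hx => ⟨hft x (abs_le.1 (hx.trans (min_le_left _ _))), ?_⟩⟩
  have hxr : dist x 0 < r := by
    rw [Real.dist_eq, sub_zero]
    have := hx.trans ((min_le_right _ _).trans (min_le_left _ _))
    linarith
  have hxL : L * |x| ≤ 1 / 2 := by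
    have h1 := hx.trans ((min_le_right _ _).trans (min_le_right _ _))
    rw [le_div_iff₀ (by positivity)] at h1
    nlinarith [abs_nonneg x]
  obtain ⟨h1, h2⟩ := hball hxr
  simp only [hfh.f_zero, ENNReal.toReal_one, sub_zero, Real.norm_eq_abs, hfh.h_zero] at h1 h2
  have l1 : L₁ ≤ L := (le_max_left _ _).trans (le_max_right _ _)
  have l2 : L₂ ≤ L := (le_max_right _ _).trans (le_max_right _ _)
  have h1' := h1.trans (mul_le_mul_of_nonneg_right l1 (abs_nonneg _))
  exact ⟨by linarith [(abs_le.1 (h1'.trans hxL)).1], h1', h2.trans (mul_le_mul_of_nonneg_right l2 (abs_nonneg _))⟩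

/-- The modes of the approximate stochastic heat equation are close to those of the stochastic
heat equation. -/
theorem CutoffAssumptions.exists_close (hfh : CutoffAssumptions f h) (T : ℝ≥0) :
    ∃ C : ℝ, 0 ≤ C ∧ ∀ ε : ℝ≥0, (heatModes f h ε).Close (heatModes f h 0) C ε T := by
  obtain ⟨c, M, hc, hM, hb⟩ := hfh.exists_bounded
  obtain ⟨δ, L, hδ, hL, hlip⟩ := hfh.exists_lipschitz
  set V := varConst c M T with hV
  have hV0 : 0 ≤ V := varConst_nonneg hc M T
  set c' : ℝ := 1 / 2 with hc'
  have hcp : 0 < c' := by norm_num [hc']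
  set A := (L + 2 * L / c') ^ 2 / c' with hA
  have hA0 : 0 ≤ A := by positivity
  refine ⟨4 * V + A + 4 * V / δ ^ 2, by positivity, fun ε k t ht => ?_⟩
  set θ := heatModes f h ε with hθ
  set θ₀ := heatModes f h 0 with hθ₀
  -- Both systems are compared with the one without noise; this settles the part `modeWeight k` of
  -- the minimum.
  have h4 : kerVar (θ.a k) (θ.b k) t (θ₀.a k) (θ₀.b k) t ≤ 4 * V * modeWeight k := by
    have h1 := kerVar_triangle ((hb ε).nonneg k) (le_refl 0) ((hb 0).nonneg k) (θ.b k) 0 (θ₀.b k)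
      t t t
    have h2 := (hb ε).kerVar_zero hc k ht 0
    have h3 := (hb 0).kerVar_zero hc k ht 0
    rw [kerVar_comm] at h3
    rw [← hθ] at h2
    rw [← hθ₀] at h3
    rw [← hθ, ← hθ₀] at h1
    linarith
  have hw := (modeWeight_pos k).le
  have hwle : 4 * V * modeWeight k ≤ (4 * V + A + 4 * V / δ ^ 2) * modeWeight k := by
    gcongr
    have : 0 ≤ 4 * V / δ ^ 2 := by positivity
    linarith
  rw [mul_min_of_nonneg _ _ (by positivity)]
  refine le_min ?_ (h4.trans hwle)
  have hε0 : (0 : ℝ) ≤ ε := ε.2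
  by_cases hk : k = 0
  · have h0 : kerVar (θ.a k) (θ.b k) t (θ₀.a k) (θ₀.b k) t = 0 := by
      simp [kerVar, hθ, hθ₀, heatModes, hk]
    rw [h0]; positivity
  have hk2 := one_le_sq_of_ne_zero hk
  have habs : |(ε : ℝ) * k| = ε * |(k : ℝ)| := by rw [abs_mul, abs_of_nonneg hε0]
  have hkabs : 0 < |(k : ℝ)| := by positivity
  -- At low frequencies the Lipschitz bounds give `ε²`; for `|εk| > δ` the weight `(1 + k²)⁻¹` is
  -- itself at most `ε² / δ²`.
  by_cases hεk : |(ε : ℝ) * k| ≤ δ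
  · obtain ⟨g1, g0, g2, g3⟩ := hlip _ hεk
    have ea : θ.a k = (k : ℝ) ^ 2 * (f (ε * k)).toReal := rfl
    have eb : θ.b k = h (ε * k) := by simp [hθ, heatModes, g1]
    have ea0 : θ₀.a k = (k : ℝ) ^ 2 := by simp [hθ₀, heatModes, hfh.f_zero]
    have eb0 : θ₀.b k = 1 := by simp [hθ₀, heatModes, hfh.f_zero, hfh.h_zero]
    have hk2p : 0 < (k : ℝ) ^ 2 := by linarith
    have hl : 0 < c' * (k : ℝ) ^ 2 := mul_pos hcp hk2p
    have hla0 : c' * (k : ℝ) ^ 2 ≤ θ₀.a k := by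
      rw [ea0]; exact mul_le_of_le_one_left hk2p.le (by norm_num [hc'])
    have hla : c' * (k : ℝ) ^ 2 ≤ θ.a k := by
      rw [ea, mul_comm]; gcongr
    have hd := kerVar_diff_le hl hla hla0 (θ.b k) (θ₀.b k) t
    refine hd.trans ?_
    rw [ea, ea0, eb, eb0]
    have e1 : |(k : ℝ) ^ 2 * (f (ε * k)).toReal - (k : ℝ) ^ 2| =
        (k : ℝ) ^ 2 * |(f (ε * k)).toReal - 1| := by
      rw [← abs_of_pos hk2p, ← abs_mul, abs_of_pos hk2p]; congr 1; ring
    rw [e1, abs_one]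
    have hsum : |h (ε * k) - 1| + 2 * 1 * ((k : ℝ) ^ 2 * |(f (ε * k)).toReal - 1|) /
        (c' * (k : ℝ) ^ 2) ≤ (L + 2 * L / c') * (ε * |(k : ℝ)|) := by
      rw [habs] at g2 g3
      have e2 : 2 * 1 * ((k : ℝ) ^ 2 * |(f (ε * k)).toReal - 1|) / (c' * (k : ℝ) ^ 2) =
          2 * |(f (ε * k)).toReal - 1| / c' := by field_simp
      rw [e2]
      calc _ ≤ L * (ε * |(k : ℝ)|) + 2 * (L * (ε * |(k : ℝ)|)) / c' := by gcongr
        _ = _ := by ring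
    calc _ ≤ ((L + 2 * L / c') * (ε * |(k : ℝ)|)) ^ 2 / (c' * (k : ℝ) ^ 2) := by
          gcongr
      _ = A * ε ^ 2 := by
          rw [hA, mul_pow, mul_pow, sq_abs]; field_simp
      _ ≤ _ := by
          gcongr
          have : 0 ≤ 4 * V / δ ^ 2 := by positivity
          linarith
  · push Not at hεk
    rw [habs] at hεk
    refine h4.trans ?_
    have h5 : modeWeight k ≤ ε ^ 2 / δ ^ 2 := by
      unfold modeWeight
      rw [inv_eq_one_div, div_le_div_iff₀ (by positivity) (by positivity)]
      have : δ ^ 2 ≤ (ε * |(k : ℝ)|) ^ 2 := by gcongr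
      rw [mul_pow, sq_abs] at this
      nlinarith [sq_nonneg (ε : ℝ)]
    calc _ ≤ 4 * V * (ε ^ 2 / δ ^ 2) := by gcongr
      _ = 4 * V / δ ^ 2 * ε ^ 2 := by ring
      _ ≤ _ := by
          gcongr
          linarith

end Variance

end RoughHeat

namespace RoughHeat

/-! ### Trigonometric sums -/

/-- The real trigonometric functions: `√2 cos (k x)` for `k > 0` and `√2 sin (k x)` for `k < 0`. -/
noncomputable def trig (k : ℤ) (x : ℝ) : ℝ :=
  if k = 0 then 1 else if 0 < k then √2 * Real.cos (k * x) else √2 * Real.sin (k * x)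

/-- Indexing the sines by negative `k` makes differentiation the reflection `k ↦ -k` with factor
`k`, free of case distinctions. -/
lemma hasDerivAt_trig (k : ℤ) (x : ℝ) : HasDerivAt (trig k) (k * trig (-k) x) x := by
  rcases lt_trichotomy k 0 with hk | rfl | hk
  · have e : trig k = fun x => √2 * Real.sin (k * x) := by
      funext x; simp [trig, hk.ne, hk.not_gt]
    rw [e]
    have h1 := ((hasDerivAt_id x).const_mul (k : ℝ)).sin.const_mul √2
    refine h1.congr_deriv ?_
    simp [trig, hk.ne, hk]
    ring
  · have e : trig 0 = fun _ => 1 := by funext x; simp [trig]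
    rw [e]
    simpa using hasDerivAt_const x (1 : ℝ)
  · have e : trig k = fun x => √2 * Real.cos (k * x) := by
      funext x; simp [trig, hk.ne', hk]
    rw [e]
    have h1 := ((hasDerivAt_id x).const_mul (k : ℝ)).cos.const_mul √2
    refine h1.congr_deriv ?_
    simp [trig, hk.ne', hk.not_gt]
    ring

lemma continuous_trig (k : ℤ) : Continuous (trig k) :=
  continuous_iff_continuousAt.2 fun x => (hasDerivAt_trig k x).continuousAt

lemma abs_trig_le (k : ℤ) (x : ℝ) : |trig k x| ≤ √2 := by
  unfold trig
  split_ifs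
  · simp
  · rw [abs_mul, abs_of_pos (by positivity)]
    exact mul_le_of_le_one_right (by positivity) (Real.abs_cos_le_one _)
  · rw [abs_mul, abs_of_pos (by positivity)]
    exact mul_le_of_le_one_right (by positivity) (Real.abs_sin_le_one _)

lemma trig_sq_le (k : ℤ) (x : ℝ) : trig k x ^ 2 ≤ 2 := by
  rw [← sq_abs, ← Real.sq_sqrt zero_le_two]
  exact pow_le_pow_left₀ (abs_nonneg _) (abs_trig_le k x) 2

lemma trig_sub_sq_le (k : ℤ) (x y : ℝ) : (trig k y - trig k x) ^ 2 ≤ 8 := by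
  nlinarith [sq_nonneg (trig k y + trig k x), trig_sq_le k x, trig_sq_le k y]

lemma trig_sub_sq_le' (k : ℤ) (x y : ℝ) :
    (trig k y - trig k x) ^ 2 ≤ 2 * (k : ℝ) ^ 2 * |y - x| ^ 2 := by
  have h := Convex.norm_image_sub_le_of_norm_hasDerivWithin_le (f := trig k)
    (f' := fun x => k * trig (-k) x) (C := |(k : ℝ)| * √2) (s := univ) (x := x) (y := y)
    (fun z _ => (hasDerivAt_trig k z).hasDerivWithinAt) (fun z _ => by
      rw [Real.norm_eq_abs, abs_mul]
      exact mul_le_mul_of_nonneg_left (abs_trig_le _ _) (abs_nonneg _))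
    convex_univ (mem_univ _) (mem_univ _)
  rw [Real.norm_eq_abs, Real.norm_eq_abs] at h
  have h2 := pow_le_pow_left₀ (abs_nonneg _) h 2
  rw [sq_abs, mul_pow, mul_pow, sq_abs, Real.sq_sqrt zero_le_two] at h2
  linarith

/-- The squared increment is at most `8` and at most `2 k² |y - x|²`, and `k² modeWeight k ≤ 1`. A
spatial increment therefore enters the minimum as one more small parameter. -/
lemma trig_sub_sq_mul_le (k : ℤ) (x y : ℝ) {m : ℝ} (hm : 0 ≤ m) :
    (trig k y - trig k x) ^ 2 * min m (modeWeight k) ≤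
      8 * min (min m (|y - x| ^ 2)) (modeWeight k) := by
  have h1 := trig_sub_sq_le k x y
  have h2 := trig_sub_sq_le' k x y
  have hw := modeWeight_pos k
  have hmin : 0 ≤ min m (modeWeight k) := le_min hm hw.le
  have hkw : (k : ℝ) ^ 2 * modeWeight k ≤ 1 := by
    unfold modeWeight
    rw [mul_inv_le_iff₀ (by positivity)]
    linarith
  rw [mul_min_of_nonneg (min m (|y - x| ^ 2)) _ (by norm_num : (0 : ℝ) ≤ 8),
    mul_min_of_nonneg m _ (by norm_num : (0 : ℝ) ≤ 8)]
  refine le_min (le_min ?_ ?_) ?_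
  · exact mul_le_mul h1 (min_le_left _ _) hmin (by norm_num)
  · calc _ ≤ (2 * (k : ℝ) ^ 2 * |y - x| ^ 2) * modeWeight k :=
          mul_le_mul h2 (min_le_right _ _) hmin (by positivity)
      _ = 2 * |y - x| ^ 2 * ((k : ℝ) ^ 2 * modeWeight k) := by ring
      _ ≤ 2 * |y - x| ^ 2 * 1 := by gcongr
      _ ≤ _ := by nlinarith [sq_nonneg |y - x|]
  · exact mul_le_mul h1 (min_le_right _ _) hmin (by norm_num)

/-- The modes `|k| ≤ N`. -/
noncomputable abbrev modeRange (N : ℕ) : Finset ℤ := Finset.Icc (-(N : ℤ)) N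

lemma sum_modeRange_succ {A : Type*} [AddCommMonoid A] (g : ℤ → A) (N : ℕ) :
    ∑ k ∈ modeRange (N + 1), g k =
      g (N + 1) + (g (-(N + 1)) + ∑ k ∈ modeRange N, g k) := by
  have e : modeRange (N + 1) =
      insert ((N : ℤ) + 1) (insert (-((N : ℤ) + 1)) (modeRange N)) := by
    ext k
    simp only [modeRange, Finset.mem_Icc, Finset.mem_insert, Nat.cast_add, Nat.cast_one]
    omega
  rw [e, Finset.sum_insert, Finset.sum_insert]
  · simp only [modeRange, Finset.mem_Icc]; omega
  · simp only [modeRange, Finset.mem_Icc, Finset.mem_insert]; omega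

lemma sum_modeRange_neg {A : Type*} [AddCommMonoid A] (g : ℤ → A) (N : ℕ) :
    ∑ k ∈ modeRange N, g (-k) = ∑ k ∈ modeRange N, g k := by
  refine Finset.sum_nbij' (fun k => -k) (fun k => -k) ?_ ?_ ?_ ?_ ?_ <;>
    simp [modeRange] <;> omega

/-- With `x = N + 1` the minimum is at most `4m² / (1 + mx)²`; replacing one factor `1 + mx` by `1 +
m (x - 1)` produces a telescoping difference. -/
lemma min_sq_modeWeight_le {m : ℝ} (hm : 0 ≤ m) (N : ℕ) (k : ℤ) (hk : k ^ 2 = ((N : ℤ) + 1) ^ 2) :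
    min (m ^ 2) (modeWeight k) ≤ 4 * m / (1 + m * N) - 4 * m / (1 + m * (N + 1)) := by
  have hk' : (k : ℝ) ^ 2 = ((N : ℝ) + 1) ^ 2 := by exact_mod_cast hk
  set x : ℝ := (N : ℝ) + 1 with hx
  have hN : (N : ℝ) = x - 1 := by rw [hx]; ring
  have hx1 : 1 ≤ x := by rw [hx]; have : (0 : ℝ) ≤ N := N.cast_nonneg; linarith
  have hmx : 0 ≤ m * x := by positivity
  have hmN : 0 ≤ m * (x - 1) := mul_nonneg hm (by linarith)
  rw [hN, div_sub_div _ _ (by positivity) (by positivity)]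
  have e : 4 * m * (1 + m * x) - (1 + m * (x - 1)) * (4 * m) = 4 * m ^ 2 := by ring
  rw [e]
  have h1 : 4 * m ^ 2 / (1 + m * x) ^ 2 ≤ 4 * m ^ 2 / ((1 + m * (x - 1)) * (1 + m * x)) := by
    gcongr
    rw [sq]; gcongr; linarith
  refine le_trans ?_ h1
  rcases le_total (m * x) 1 with h | h
  · refine (min_le_left _ _).trans ?_
    rw [le_div_iff₀ (by positivity)]
    nlinarith [sq_nonneg m, mul_nonneg (sq_nonneg m) (by nlinarith : 0 ≤ 4 - (1 + m * x) ^ 2)]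
  · refine (min_le_right _ _).trans ?_
    unfold modeWeight
    rw [hk', inv_eq_one_div, div_le_div_iff₀ (by positivity) (by positivity)]
    nlinarith [sq_nonneg m]

lemma sum_min_sq_modeWeight_le {m : ℝ} (hm : 0 ≤ m) (N : ℕ) :
    ∑ k ∈ modeRange N, min (m ^ 2) (modeWeight k) ≤ 9 * m := by
  -- The pairs `±k` telescope to `8m`, and `k = 0` adds `min (m², 1) ≤ m`.
  have key : ∑ k ∈ modeRange N, min (m ^ 2) (modeWeight k) ≤ 9 * m - 8 * m / (1 + m * N) := by
    induction N with
    | zero =>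
      simp only [modeRange, Nat.cast_zero, neg_zero, Finset.Icc_self, Finset.sum_singleton,
        mul_zero, add_zero, div_one]
      have hw : modeWeight 0 = 1 := by simp [modeWeight]
      rw [hw]
      rcases le_total m 1 with h | h
      · exact (min_le_left _ _).trans (by nlinarith)
      · exact (min_le_right _ _).trans (by linarith)
    | succ N ih =>
      rw [sum_modeRange_succ]
      have h1 := min_sq_modeWeight_le hm N ((N : ℤ) + 1) rfl
      have h2 := min_sq_modeWeight_le hm N (-((N : ℤ) + 1)) (by ring)
      push_cast at *
      have e : ∀ u : ℝ, 8 * m / u = 2 * (4 * m / u) := fun u => by ring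
      rw [e] at ih ⊢
      linarith
  have : 0 ≤ 8 * m / (1 + m * N) := by positivity
  linarith

lemma sum_min_min_modeWeight_le {m L : ℝ} (hm : 0 ≤ m) (hL : 0 ≤ L) (N : ℕ) :
    ∑ k ∈ modeRange N, min (min (m ^ 2) (L ^ 2)) (modeWeight k) ≤ 9 * min m L := by
  rcases le_total m L with h | h
  · rw [min_eq_left h, min_eq_left (by gcongr)]
    exact sum_min_sq_modeWeight_le hm N
  · rw [min_eq_right h, min_eq_right (by gcongr)]
    exact sum_min_sq_modeWeight_le hL N

/-! ### Bessel's inequality -/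

/-- `cos (k x) + sin (k x)`. -/
noncomputable def cas (k : ℤ) (x : ℝ) : ℝ := Real.cos (k * x) + Real.sin (k * x)

lemma continuous_cas (k : ℤ) : Continuous (cas k) := by unfold cas; fun_prop

/-- `cas k x · cas l x = cos ((k - l) x) + sin ((k + l) x)`. This orthogonal family has equal norms,
so Bessel's inequality avoids separate cases for constants, cosines and sines. -/
lemma integral_cas_mul_cas (k l : ℤ) :
    ∫ x in (-Real.pi)..Real.pi, cas k x * cas l x = if k = l then 2 * Real.pi else 0 := by
  have e : ∀ x, cas k x * cas l x =
      Real.cos (((k - l : ℤ) : ℝ) * x) + Real.sin (((k + l : ℤ) : ℝ) * x) := by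
    intro x
    unfold cas
    push_cast
    rw [sub_mul, Real.cos_sub, add_mul (k : ℝ), Real.sin_add]
    ring
  have hsin : ∀ j : ℤ, ∫ x in (-Real.pi)..Real.pi, Real.sin ((j : ℝ) * x) = 0 := by
    intro j
    have h := intervalIntegral.integral_comp_neg (a := -Real.pi) (b := Real.pi)
      (fun x => Real.sin ((j : ℝ) * x))
    simp only [mul_neg, Real.sin_neg, intervalIntegral.integral_neg, neg_neg] at h
    linarith
  have hcos : ∀ j : ℤ, j ≠ 0 → ∫ x in (-Real.pi)..Real.pi, Real.cos ((j : ℝ) * x) = 0 := by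
    intro j hj
    have hj' : (j : ℝ) ≠ 0 := by exact_mod_cast hj
    rw [intervalIntegral.integral_comp_mul_left (fun x => Real.cos x) hj', integral_cos]
    simp [Real.sin_int_mul_pi]
  simp_rw [e]
  rw [intervalIntegral.integral_add (Continuous.intervalIntegrable (by fun_prop) _ _)
    (Continuous.intervalIntegrable (by fun_prop) _ _), hsin, add_zero]
  split_ifs with h
  · subst h; simp; ring
  · exact hcos _ (sub_ne_zero.2 h)

/-- Expand `∫ (ψ - g / 2π)² ≥ 0` over `[x, y]`. Orthogonality holds on `[-π, π]` only, but enlarging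
the interval in `∫ g²` goes in the right direction. -/
lemma sum_sq_integral_cas_le {ψ : ℝ → ℝ} (hψ : Continuous ψ) {x y : ℝ} (hx : -Real.pi ≤ x)
    (hxy : x ≤ y) (hy : y ≤ Real.pi) (S : Finset ℤ) :
    ∑ k ∈ S, (∫ z in x..y, ψ z * cas k z) ^ 2 ≤ 2 * Real.pi * ∫ z in x..y, ψ z ^ 2 := by
  set a : ℤ → ℝ := fun k => ∫ z in x..y, ψ z * cas k z with ha
  set g : ℝ → ℝ := fun z => ∑ k ∈ S, a k * cas k z with hg
  have hgc : Continuous g := by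
    refine continuous_finsetSum _ fun k _ => ?_
    exact continuous_const.mul (continuous_cas k)
  have hpi := Real.pi_pos
  have hψg : ∫ z in x..y, ψ z * g z = ∑ k ∈ S, a k ^ 2 := by
    simp only [hg, Finset.mul_sum]
    rw [intervalIntegral.integral_finsetSum]
    · refine Finset.sum_congr rfl fun k _ => ?_
      rw [sq]
      nth_rewrite 3 [ha]
      rw [← intervalIntegral.integral_const_mul]
      congr 1; funext z; ring
    · intro k _
      exact Continuous.intervalIntegrable
        (hψ.mul (continuous_const.mul (continuous_cas k))) _ _
  have hgg : ∫ z in (-Real.pi)..Real.pi, g z ^ 2 = 2 * Real.pi * ∑ k ∈ S, a k ^ 2 := by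
    have e : ∀ z, g z ^ 2 = ∑ k ∈ S, ∑ l ∈ S, (a k * a l) * (cas k z * cas l z) := by
      intro z
      rw [sq, hg, Finset.sum_mul_sum]
      exact Finset.sum_congr rfl fun k _ => Finset.sum_congr rfl fun l _ => by ring
    simp_rw [e]
    have hint : ∀ k l : ℤ, IntervalIntegrable (fun z => (a k * a l) * (cas k z * cas l z)) volume
        (-Real.pi) Real.pi := fun k l => Continuous.intervalIntegrable
          (continuous_const.mul ((continuous_cas k).mul (continuous_cas l))) _ _
    rw [intervalIntegral.integral_finsetSum, Finset.mul_sum]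
    · refine Finset.sum_congr rfl fun k hk => ?_
      rw [intervalIntegral.integral_finsetSum fun l _ => hint k l]
      simp_rw [intervalIntegral.integral_const_mul, integral_cas_mul_cas]
      simp only [mul_ite, mul_zero, Finset.sum_ite_eq, hk, if_true]
      ring
    · intro k _
      have := IntervalIntegrable.sum S (f := fun l z => (a k * a l) * (cas k z * cas l z))
        (fun l _ => hint k l)
      simpa [Finset.sum_fn] using this
  have hgle : ∫ z in x..y, g z ^ 2 ≤ ∫ z in (-Real.pi)..Real.pi, g z ^ 2 :=
    intervalIntegral.integral_mono_interval hx hxy hy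
      (Eventually.of_forall fun z => sq_nonneg _)
      ((hgc.pow 2).intervalIntegrable _ _)
  have hpos : 0 ≤ ∫ z in x..y, (ψ z - (2 * Real.pi)⁻¹ * g z) ^ 2 :=
    intervalIntegral.integral_nonneg hxy fun z _ => sq_nonneg _
  have hexp : ∫ z in x..y, (ψ z - (2 * Real.pi)⁻¹ * g z) ^ 2 = (∫ z in x..y, ψ z ^ 2) -
      2 * (2 * Real.pi)⁻¹ * (∫ z in x..y, ψ z * g z) +
      (2 * Real.pi)⁻¹ ^ 2 * ∫ z in x..y, g z ^ 2 := by
    rw [← intervalIntegral.integral_const_mul, ← intervalIntegral.integral_const_mul,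
      ← intervalIntegral.integral_sub, ← intervalIntegral.integral_add]
    · congr 1; funext z; ring
    all_goals exact Continuous.intervalIntegrable (by fun_prop) _ _
  rw [hexp, hψg] at hpos
  rw [hgg] at hgle
  set I := ∫ z in x..y, ψ z ^ 2
  set A := ∑ k ∈ S, a k ^ 2
  have hpi2 : 0 < 2 * Real.pi := by positivity
  have h1 : (2 * Real.pi)⁻¹ ^ 2 * ∫ z in x..y, g z ^ 2 ≤ (2 * Real.pi)⁻¹ ^ 2 * (2 * Real.pi * A) := by
    gcongr
  have h2 : (2 * Real.pi)⁻¹ ^ 2 * (2 * Real.pi * A) = (2 * Real.pi)⁻¹ * A := by field_simp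
  have h3 : (2 * Real.pi)⁻¹ * A ≤ I := by linarith
  rwa [inv_mul_le_iff₀ hpi2] at h3

/-- For `k ≠ 0`, `trig k` is `√2 / 2` times the sum or difference of `cas k` and `cas (-k)`, and `(A
± B)² ≤ 2 (A² + B²)`. -/
lemma sq_integral_trig_le {ψ : ℝ → ℝ} (hψ : Continuous ψ) (x y : ℝ) (k : ℤ) :
    (∫ z in x..y, ψ z * trig k z) ^ 2 ≤
      (∫ z in x..y, ψ z * cas k z) ^ 2 + (∫ z in x..y, ψ z * cas (-k) z) ^ 2 := by
  have hi : ∀ k : ℤ, IntervalIntegrable (fun z => ψ z * cas k z) volume x y := fun k =>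
    (hψ.mul (continuous_cas k)).intervalIntegrable _ _
  have h2 : √2 ^ 2 = (2 : ℝ) := Real.sq_sqrt zero_le_two
  rcases lt_trichotomy k 0 with hk | rfl | hk
  · have e : ∫ z in x..y, ψ z * trig k z =
        √2 / 2 * ((∫ z in x..y, ψ z * cas k z) - ∫ z in x..y, ψ z * cas (-k) z) := by
      rw [← intervalIntegral.integral_sub (hi _) (hi _), ← intervalIntegral.integral_const_mul]
      congr 1; funext z
      simp [trig, cas, hk.ne, hk.not_gt]; ring
    rw [e, mul_pow, div_pow, h2]
    nlinarith [sq_nonneg ((∫ z in x..y, ψ z * cas k z) + ∫ z in x..y, ψ z * cas (-k) z)]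
  · have e : ∫ z in x..y, ψ z * trig 0 z = ∫ z in x..y, ψ z * cas 0 z := by simp [trig, cas]
    rw [e, neg_zero]
    nlinarith [sq_nonneg (∫ z in x..y, ψ z * cas 0 z)]
  · have e : ∫ z in x..y, ψ z * trig k z =
        √2 / 2 * ((∫ z in x..y, ψ z * cas k z) + ∫ z in x..y, ψ z * cas (-k) z) := by
      rw [← intervalIntegral.integral_add (hi _) (hi _), ← intervalIntegral.integral_const_mul]
      congr 1; funext z
      simp [trig, cas, hk.ne', hk]; ring
    rw [e, mul_pow, div_pow, h2]
    nlinarith [sq_nonneg ((∫ z in x..y, ψ z * cas k z) - ∫ z in x..y, ψ z * cas (-k) z)]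

/-- Bessel's inequality on a subinterval of `[-π, π]`. -/
lemma sum_sq_integral_trig_le {ψ : ℝ → ℝ} (hψ : Continuous ψ) {x y : ℝ}
    (hx : x ∈ Icc (-Real.pi) Real.pi) (hy : y ∈ Icc (-Real.pi) Real.pi) (N : ℕ) :
    ∑ k ∈ modeRange N, (∫ z in x..y, ψ z * trig k z) ^ 2 ≤
      4 * Real.pi * |∫ z in x..y, ψ z ^ 2| := by
  wlog hxy : x ≤ y generalizing x y
  · have h := this hy hx (le_of_not_ge hxy)
    rw [intervalIntegral.integral_symm x y, abs_neg] at h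
    refine le_trans (le_of_eq ?_) h
    refine Finset.sum_congr rfl fun k _ => ?_
    rw [intervalIntegral.integral_symm y x, neg_sq]
  have h0 := sum_sq_integral_cas_le hψ hx.1 hxy hy.2 (modeRange N)
  calc _ ≤ ∑ k ∈ modeRange N, ((∫ z in x..y, ψ z * cas k z) ^ 2 +
        (∫ z in x..y, ψ z * cas (-k) z) ^ 2) :=
        Finset.sum_le_sum fun k _ => sq_integral_trig_le hψ x y k
    _ = 2 * ∑ k ∈ modeRange N, (∫ z in x..y, ψ z * cas k z) ^ 2 := by
        rw [Finset.sum_add_distrib,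
          sum_modeRange_neg (fun k => (∫ z in x..y, ψ z * cas k z) ^ 2), two_mul]
    _ ≤ 2 * (2 * Real.pi * ∫ z in x..y, ψ z ^ 2) := by gcongr
    _ ≤ _ := by
        have := mul_le_mul_of_nonneg_left (le_abs_self (∫ z in x..y, ψ z ^ 2)) Real.pi_pos.le
        linarith

/-! ### The coefficients of the iterated integral -/

/-- `∫_x^y (φ_k(z) - φ_k(x)) dφ_l(z)` for the trigonometric functions `φ_k`. -/
noncomputable def trigCoeff (k l : ℤ) (x y : ℝ) : ℝ :=
  ∫ z in x..y, (trig k z - trig k x) * (l * trig (-l) z)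

/-- Integration by parts. It is the source of geometricity, and it allows the indices to be
exchanged in `sum_trigCoeff_sq_mul_le'`. -/
lemma trigCoeff_add_comm (k l : ℤ) (x y : ℝ) :
    trigCoeff k l x y + trigCoeff l k x y = (trig k y - trig k x) * (trig l y - trig l x) := by
  have hk := continuous_trig k
  have hl := continuous_trig l
  have hk' := continuous_trig (-k)
  have hl' := continuous_trig (-l)
  have h := intervalIntegral.integral_eq_sub_of_hasDerivAt (a := x) (b := y)
    (f := fun z => (trig k z - trig k x) * (trig l z - trig l x))
    (fun z _ => ((hasDerivAt_trig k z).sub_const _).mul ((hasDerivAt_trig l z).sub_const _))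
    (Continuous.intervalIntegrable (by fun_prop) _ _)
  simp only [sub_self, mul_zero, sub_zero] at h
  rw [← h, trigCoeff, trigCoeff, ← intervalIntegral.integral_add
    (Continuous.intervalIntegrable (by fun_prop) _ _)
    (Continuous.intervalIntegrable (by fun_prop) _ _)]
  congr 1; funext z; ring

/-- `trigCoeff k l` is `l` times a Fourier coefficient of `trig k - trig k x` on `[x, y]`; the
weight compensates `l²`, and Bessel's inequality sums over `l`. -/
lemma sum_trigCoeff_sq_le {x y : ℝ} (hx : x ∈ Icc (-Real.pi) Real.pi)
    (hy : y ∈ Icc (-Real.pi) Real.pi) (k : ℤ) (N : ℕ) :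
    ∑ l ∈ modeRange N, trigCoeff k l x y ^ 2 * modeWeight l ≤
      4 * Real.pi * |∫ z in x..y, (trig k z - trig k x) ^ 2| := by
  have hψ : Continuous fun z => trig k z - trig k x := (continuous_trig k).sub continuous_const
  refine le_trans ?_ (sum_sq_integral_trig_le hψ hx hy N)
  rw [← sum_modeRange_neg fun l => (∫ z in x..y, (trig k z - trig k x) * trig l z) ^ 2]
  refine Finset.sum_le_sum fun l _ => ?_
  have e : trigCoeff k l x y = l * ∫ z in x..y, (trig k z - trig k x) * trig (-l) z := by
    rw [trigCoeff, ← intervalIntegral.integral_const_mul]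
    congr 1; funext z; ring
  have hl : (l : ℝ) ^ 2 * modeWeight l ≤ 1 := by
    unfold modeWeight
    rw [mul_inv_le_iff₀ (by positivity)]
    linarith
  rw [e, mul_pow]
  nlinarith [mul_nonneg (sub_nonneg.2 hl)
    (sq_nonneg (∫ z in x..y, (trig k z - trig k x) * trig (-l) z))]

/-- The small parameter sits on the first index. After Bessel in `l` there remain squared increments
of `trig k`, integrated over `[x, y]`, whose weighted sum over `k` has order `min m |y - x|`. The
constant is `4π · 8 · 9`. -/
lemma sum_trigCoeff_sq_mul_le {x y : ℝ} (hx : x ∈ Icc (-Real.pi) Real.pi)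
    (hy : y ∈ Icc (-Real.pi) Real.pi) {m : ℝ} (hm : 0 ≤ m) (N : ℕ) :
    ∑ k ∈ modeRange N, ∑ l ∈ modeRange N,
        trigCoeff k l x y ^ 2 * (min (m ^ 2) (modeWeight k) * modeWeight l) ≤
      288 * Real.pi * (|y - x| * min m |y - x|) := by
  have hpi := Real.pi_pos
  calc _ ≤ ∑ k ∈ modeRange N, 32 * Real.pi * |y - x| *
        min (min (m ^ 2) (|y - x| ^ 2)) (modeWeight k) := ?_
    _ ≤ 32 * Real.pi * |y - x| * (9 * min m |y - x|) := by
        rw [← Finset.mul_sum]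
        gcongr
        exact sum_min_min_modeWeight_le hm (abs_nonneg _) N
    _ = _ := by ring
  refine Finset.sum_le_sum fun k _ => ?_
  have hw := (modeWeight_pos k).le
  have hmin : 0 ≤ min (m ^ 2) (modeWeight k) := le_min (sq_nonneg _) hw
  have h1 := sum_trigCoeff_sq_le hx hy k N
  have h2 : |∫ z in x..y, (trig k z - trig k x) ^ 2 * min (m ^ 2) (modeWeight k)| ≤
      (8 * min (min (m ^ 2) (|y - x| ^ 2)) (modeWeight k)) * |y - x| := by
    rw [← Real.norm_eq_abs]
    refine intervalIntegral.norm_integral_le_of_norm_le_const fun z hz => ?_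
    rw [Real.norm_eq_abs, abs_of_nonneg (by positivity)]
    refine (trig_sub_sq_mul_le k x z (sq_nonneg m)).trans ?_
    have hz' : |z - x| ≤ |y - x| := abs_sub_left_of_mem_uIcc (uIoc_subset_uIcc hz)
    gcongr
  rw [intervalIntegral.integral_mul_const, abs_mul, abs_of_nonneg hmin] at h2
  calc _ = min (m ^ 2) (modeWeight k) * ∑ l ∈ modeRange N, trigCoeff k l x y ^ 2 * modeWeight l := by
        rw [Finset.mul_sum]
        exact Finset.sum_congr rfl fun l _ => by ring
    _ ≤ min (m ^ 2) (modeWeight k) * (4 * Real.pi * |∫ z in x..y, (trig k z - trig k x) ^ 2|) := by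
        gcongr
    _ = 4 * Real.pi * (|∫ z in x..y, (trig k z - trig k x) ^ 2| * min (m ^ 2) (modeWeight k)) := by
        ring
    _ ≤ 4 * Real.pi * ((8 * min (min (m ^ 2) (|y - x| ^ 2)) (modeWeight k)) * |y - x|) := by
        gcongr
    _ = _ := by ring

lemma sum_trig_sub_sq_mul_le (x y : ℝ) {m : ℝ} (hm : 0 ≤ m) (N : ℕ) :
    ∑ k ∈ modeRange N, (trig k y - trig k x) ^ 2 * min (m ^ 2) (modeWeight k) ≤
      72 * min m |y - x| := by
  calc _ ≤ ∑ k ∈ modeRange N, 8 * min (min (m ^ 2) (|y - x| ^ 2)) (modeWeight k) :=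
        Finset.sum_le_sum fun k _ => trig_sub_sq_mul_le k x y (sq_nonneg m)
    _ ≤ 8 * (9 * min m |y - x|) := by
        rw [← Finset.mul_sum]
        gcongr
        exact sum_min_min_modeWeight_le hm (abs_nonneg _) N
    _ = _ := by ring

lemma sum_trig_sq_mul_le (x : ℝ) {m : ℝ} (hm : 0 ≤ m) (N : ℕ) :
    ∑ k ∈ modeRange N, trig k x ^ 2 * min (m ^ 2) (modeWeight k) ≤ 18 * m := by
  calc _ ≤ ∑ k ∈ modeRange N, 2 * min (m ^ 2) (modeWeight k) := by
        refine Finset.sum_le_sum fun k _ => mul_le_mul_of_nonneg_right (trig_sq_le k x) ?_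
        exact le_min (sq_nonneg _) (modeWeight_pos k).le
    _ ≤ 2 * (9 * m) := by
        rw [← Finset.mul_sum]
        gcongr
        exact sum_min_sq_modeWeight_le hm N
    _ = _ := by ring

/-- With the small parameter on the second index, Bessel's inequality in `l` would lose it.
`trigCoeff_add_comm` exchanges the indices at the cost of a product of increments, whose double sum
factorises. -/
lemma sum_trigCoeff_sq_mul_le' {x y : ℝ} (hx : x ∈ Icc (-Real.pi) Real.pi)
    (hy : y ∈ Icc (-Real.pi) Real.pi) {m : ℝ} (hm : 0 ≤ m) (N : ℕ) :
    ∑ k ∈ modeRange N, ∑ l ∈ modeRange N,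
        trigCoeff k l x y ^ 2 * (modeWeight k * min (m ^ 2) (modeWeight l)) ≤
      (2 * 72 ^ 2 + 2 * (288 * Real.pi)) * (|y - x| * min m |y - x|) := by
  have h1 := sum_trigCoeff_sq_mul_le hx hy hm N
  have h2 := sum_trig_sub_sq_mul_le x y hm N
  have h3 := sum_trig_sub_sq_mul_le x y zero_le_one N
  simp_rw [one_pow, min_eq_right (modeWeight_le_one _)] at h3
  have h3' := h3.trans (mul_le_mul_of_nonneg_left (min_le_right 1 |y - x|) (by norm_num))
  have hw := fun k => (modeWeight_pos k).le
  have hmin : ∀ k, 0 ≤ min (m ^ 2) (modeWeight k) := fun k => le_min (sq_nonneg _) (hw k)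
  have key : ∀ k l, trigCoeff k l x y ^ 2 * (modeWeight k * min (m ^ 2) (modeWeight l)) ≤
      2 * (((trig k y - trig k x) ^ 2 * modeWeight k) *
        ((trig l y - trig l x) ^ 2 * min (m ^ 2) (modeWeight l))) +
      2 * (trigCoeff l k x y ^ 2 * (min (m ^ 2) (modeWeight l) * modeWeight k)) := by
    intro k l
    have e := trigCoeff_add_comm k l x y
    have h : trigCoeff k l x y ^ 2 ≤ 2 * ((trig k y - trig k x) ^ 2 * (trig l y - trig l x) ^ 2) +
        2 * trigCoeff l k x y ^ 2 := by
      rw [← mul_pow, ← e]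
      nlinarith [sq_nonneg (trigCoeff k l x y + 2 * trigCoeff l k x y)]
    have := mul_le_mul_of_nonneg_right h (mul_nonneg (hw k) (hmin l))
    linarith
  calc _ ≤ ∑ k ∈ modeRange N, ∑ l ∈ modeRange N,
        (2 * (((trig k y - trig k x) ^ 2 * modeWeight k) *
          ((trig l y - trig l x) ^ 2 * min (m ^ 2) (modeWeight l))) +
        2 * (trigCoeff l k x y ^ 2 * (min (m ^ 2) (modeWeight l) * modeWeight k))) :=
        Finset.sum_le_sum fun k _ => Finset.sum_le_sum fun l _ => key k l
    _ = 2 * ((∑ k ∈ modeRange N, (trig k y - trig k x) ^ 2 * modeWeight k) *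
          ∑ l ∈ modeRange N, (trig l y - trig l x) ^ 2 * min (m ^ 2) (modeWeight l)) +
        2 * ∑ k ∈ modeRange N, ∑ l ∈ modeRange N,
          trigCoeff k l x y ^ 2 * (min (m ^ 2) (modeWeight k) * modeWeight l) := by
        simp_rw [Finset.sum_add_distrib, Finset.sum_mul_sum, Finset.mul_sum]
        congr 1
        rw [Finset.sum_comm]
    _ ≤ 2 * ((72 * |y - x|) * (72 * min m |y - x|)) +
        2 * (288 * Real.pi * (|y - x| * min m |y - x|)) := by
        gcongr
        exact Finset.sum_nonneg fun l _ => mul_nonneg (sq_nonneg _) (hmin l)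
    _ = _ := by ring

end RoughHeat

namespace RoughHeat

/-! ### Truncated Fourier series -/

section Truncated

variable {Ω : Type*} {n : ℕ}

/-- The Fourier mode `k` of component `j`. -/
noncomputable def mode (B : ℤ × Fin n → ℝ≥0 → Ω → ℝ) (θ : Modes) (t : ℝ≥0) (k : ℤ) (j : Fin n)
    (ω : Ω) : ℝ := ou (θ.a k) (θ.b k) t (B (k, j) · ω)

/-- Component `j` of the truncated series for the solution. -/
noncomputable def fieldComp (B : ℤ × Fin n → ℝ≥0 → Ω → ℝ) (θ : Modes) (N : ℕ) (t : ℝ≥0) (x : ℝ)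
    (j : Fin n) (ω : Ω) : ℝ :=
  (√(2 * Real.pi))⁻¹ * ∑ k ∈ modeRange N, trig k x * mode B θ t k j ω

/-- Entry `(i, j)` of the truncated series for the iterated integral. -/
noncomputable def areaComp (B : ℤ × Fin n → ℝ≥0 → Ω → ℝ) (θ : Modes) (N : ℕ) (t : ℝ≥0) (x y : ℝ)
    (i j : Fin n) (ω : Ω) : ℝ :=
  (2 * Real.pi)⁻¹ * ∑ k ∈ modeRange N, ∑ l ∈ modeRange N,
    trigCoeff k l x y * (mode B θ t k i ω * mode B θ t l j ω)

variable {B : ℤ × Fin n → ℝ≥0 → Ω → ℝ}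

lemma mode_zero (t : ℝ≥0) (k : ℤ) (j : Fin n) (ω : Ω) : mode B Modes.zero t k j ω = 0 := by
  simp [mode, ou, Modes.zero]

/-- For equal components the two Gaussian families coincide and cannot be decoupled, but
symmetrising the double sum leaves a perfect square. -/
lemma areaComp_diag (θ : Modes) (N : ℕ) (t : ℝ≥0) (x y : ℝ) (i : Fin n) (ω : Ω) :
    areaComp B θ N t x y i i ω =
      1 / 2 * (fieldComp B θ N t y i ω - fieldComp B θ N t x i ω) ^ 2 := by
  have hpi : (√(2 * Real.pi))⁻¹ ^ 2 = (2 * Real.pi)⁻¹ := by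
    rw [inv_pow, Real.sq_sqrt (by positivity)]
  unfold areaComp fieldComp
  set z : ℤ → ℝ := fun k => mode B θ t k i ω
  have e1 : ∑ k ∈ modeRange N, ∑ l ∈ modeRange N, trigCoeff k l x y * (z k * z l) =
      ∑ k ∈ modeRange N, ∑ l ∈ modeRange N, trigCoeff l k x y * (z k * z l) := by
    rw [Finset.sum_comm]
    exact Finset.sum_congr rfl fun k _ => Finset.sum_congr rfl fun l _ => by ring
  have e2 : 2 * ∑ k ∈ modeRange N, ∑ l ∈ modeRange N, trigCoeff k l x y * (z k * z l) =
      (∑ k ∈ modeRange N, (trig k y - trig k x) * z k) ^ 2 := by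
    rw [two_mul]
    nth_rewrite 2 [e1]
    rw [sq, Finset.sum_mul_sum]
    simp_rw [← Finset.sum_add_distrib, ← add_mul, trigCoeff_add_comm]
    exact Finset.sum_congr rfl fun k _ => Finset.sum_congr rfl fun l _ => by ring
  have e3 : ∑ k ∈ modeRange N, (trig k y - trig k x) * z k =
      ∑ k ∈ modeRange N, trig k y * z k - ∑ k ∈ modeRange N, trig k x * z k := by
    simp_rw [sub_mul, Finset.sum_sub_distrib]
  rw [← mul_sub, mul_pow, hpi, ← e3, ← e2]
  ring

/-- Over `[y, z]` the integrands differ only in the subtracted constants `trig k x` and `trig k y`.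
-/
lemma trigCoeff_chen (k l : ℤ) (x y z : ℝ) :
    trigCoeff k l x z - trigCoeff k l x y - trigCoeff k l y z =
      (trig k y - trig k x) * (trig l z - trig l y) := by
  have hk := continuous_trig k
  have hl := continuous_trig (-l)
  have hi : ∀ u a b, IntervalIntegrable (fun z => (trig k z - trig k u) * (l * trig (-l) z))
      volume a b := fun u a b => Continuous.intervalIntegrable (by fun_prop) _ _
  have h := intervalIntegral.integral_eq_sub_of_hasDerivAt (a := y) (b := z)
    (fun z _ => hasDerivAt_trig l z) (Continuous.intervalIntegrable (by fun_prop) _ _)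
  unfold trigCoeff
  rw [intervalIntegral.integral_interval_sub_left (hi _ _ _) (hi _ _ _),
    ← intervalIntegral.integral_sub (hi _ _ _) (hi _ _ _), ← h,
    ← intervalIntegral.integral_const_mul]
  congr 1; funext z; ring

lemma areaComp_chen (θ : Modes) (N : ℕ) (t : ℝ≥0) (x y z : ℝ) (i j : Fin n) (ω : Ω) :
    areaComp B θ N t x z i j ω - areaComp B θ N t x y i j ω - areaComp B θ N t y z i j ω =
      (fieldComp B θ N t y i ω - fieldComp B θ N t x i ω) *
        (fieldComp B θ N t z j ω - fieldComp B θ N t y j ω) := by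
  have hpi : (√(2 * Real.pi))⁻¹ * (√(2 * Real.pi))⁻¹ = (2 * Real.pi)⁻¹ := by
    rw [← mul_inv, Real.mul_self_sqrt (by positivity)]
  unfold areaComp fieldComp
  set u : ℤ → ℝ := fun k => mode B θ t k i ω
  set v : ℤ → ℝ := fun k => mode B θ t k j ω
  rw [← mul_sub, ← mul_sub, ← mul_sub, ← mul_sub, mul_mul_mul_comm, hpi]
  simp_rw [← Finset.sum_sub_distrib, ← sub_mul, trigCoeff_chen]
  rw [Finset.sum_mul_sum]
  congr 1
  exact Finset.sum_congr rfl fun k _ => Finset.sum_congr rfl fun l _ => by ring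

/-! ### Moments of differences of truncated series -/

/-- The distance of two Gaussian mode families. -/
def ModeDist (θ : Modes) (t : ℝ≥0) (θ' : Modes) (t' : ℝ≥0) (C m : ℝ) : Prop :=
  ∀ k, kerVar (θ.a k) (θ.b k) t (θ'.a k) (θ'.b k) t' ≤ C * min (m ^ 2) (modeWeight k)

variable [MeasurableSpace Ω] {P : Measure Ω}

lemma measurable_mode (hB : IsBrownianFamily P B) {θ : Modes} (hθ : ∀ k, 0 ≤ θ.a k)
    (t : ℝ≥0) (k : ℤ) (j : Fin n) : Measurable (mode B θ t k j) :=
  hB.measurable_ou _ (hθ k) _ _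

lemma measurable_fieldComp (hB : IsBrownianFamily P B) {θ : Modes} (hθ : ∀ k, 0 ≤ θ.a k)
    (N : ℕ) (t : ℝ≥0) (x : ℝ) (j : Fin n) : Measurable (fieldComp B θ N t x j) := by
  have := fun k => measurable_mode hB hθ t k j
  unfold fieldComp
  fun_prop

lemma measurable_areaComp (hB : IsBrownianFamily P B) {θ : Modes} (hθ : ∀ k, 0 ≤ θ.a k)
    (N : ℕ) (t : ℝ≥0) (x y : ℝ) (i j : Fin n) : Measurable (areaComp B θ N t x y i j) := by
  have := fun k j => measurable_mode hB hθ t k j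
  unfold areaComp
  fun_prop

variable [IsProbabilityMeasure P]

/-- The common core of the first-order estimates: values and spatial increments correspond to
different coefficients `c`. The factor `(2π)⁻¹` in the variance is estimated by `1`. -/
lemma mom_sum_mode_le (hB : IsBrownianFamily P B) {θ θ' : Modes} (hθ : ∀ k, 0 ≤ θ.a k)
    (hθ' : ∀ k, 0 ≤ θ'.a k) {t t' : ℝ≥0} {C m : ℝ} (hd : ModeDist θ t θ' t' C m)
    (N : ℕ) (c : ℤ → ℝ) (j : Fin n) {r : ℝ} (hr : 0 < r) {V : ℝ} (hC : 0 ≤ C)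
    (hV : ∑ k ∈ modeRange N, c k ^ 2 * min (m ^ 2) (modeWeight k) ≤ V) :
    mom P r (fun ω => ‖(√(2 * Real.pi))⁻¹ * (∑ k ∈ modeRange N, c k * mode B θ t k j ω) -
      (√(2 * Real.pi))⁻¹ * ∑ k ∈ modeRange N, c k * mode B θ' t' k j ω‖ₑ) ≤
      gaussMom r * ENNReal.ofReal (C * V) ^ (1 / 2 : ℝ) := by
  have hU := hB.isGaussLimit (a := fun p => θ.a p.1) (a' := fun p => θ'.a p.1)
    (fun p => hθ p.1) (fun p => hθ' p.1) (fun p => θ.b p.1) (fun p => θ'.b p.1)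
    (fun _ => t) (fun _ => t')
  have h := hU.mom_sum_le (modeRange N ×ˢ {j}) (fun p => (√(2 * Real.pi))⁻¹ * c p.1) hr
  simp only [Finset.sum_product, Finset.sum_singleton] at h
  have hpi : (√(2 * Real.pi))⁻¹ ^ 2 ≤ 1 := by
    rw [inv_pow, Real.sq_sqrt (by positivity)]
    exact inv_le_one_of_one_le₀ (by linarith [Real.pi_gt_three])
  refine le_trans (le_of_eq ?_) (h.trans ?_)
  · congr 1; funext ω; congr 1
    rw [← mul_sub, ← Finset.sum_sub_distrib, Finset.mul_sum]
    exact Finset.sum_congr rfl fun k _ => by unfold mode; ring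
  · gcongr
    refine le_trans ?_ (mul_le_mul_of_nonneg_left hV hC)
    rw [Finset.mul_sum]
    refine Finset.sum_le_sum fun k _ => ?_
    have hk := kerVar_nonneg (θ.a k) (θ.b k) t (θ'.a k) (θ'.b k) t'
    calc _ = (√(2 * Real.pi))⁻¹ ^ 2 * (c k ^ 2 * kerVar (θ.a k) (θ.b k) t (θ'.a k) (θ'.b k) t') := by
          ring
      _ ≤ 1 * (c k ^ 2 * (C * min (m ^ 2) (modeWeight k))) := by
          gcongr
          exact hd k
      _ = _ := by ring

lemma mom_fieldComp_sub_le (hB : IsBrownianFamily P B) {θ θ' : Modes} (hθ : ∀ k, 0 ≤ θ.a k)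
    (hθ' : ∀ k, 0 ≤ θ'.a k) {t t' : ℝ≥0} {C m : ℝ} (hd : ModeDist θ t θ' t' C m)
    (hC : 0 ≤ C) (hm : 0 ≤ m) (N : ℕ) (x : ℝ) (j : Fin n) {r : ℝ} (hr : 0 < r) :
    mom P r (fun ω => ‖fieldComp B θ N t x j ω - fieldComp B θ' N t' x j ω‖ₑ) ≤
      gaussMom r * ENNReal.ofReal (72 * C) ^ (1 / 2 : ℝ) * ENNReal.ofReal m ^ (1 / 2 : ℝ) := by
  refine (mom_sum_mode_le hB hθ hθ' hd N (fun k => trig k x) j hr hC (V := 72 * m)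
    ((sum_trig_sq_mul_le x hm N).trans (by linarith))).trans (le_of_eq ?_)
  rw [mul_assoc, ← ENNReal.mul_rpow_of_nonneg _ _ (by norm_num),
    ← ENNReal.ofReal_mul (by positivity)]
  congr 3; ring

lemma mom_fieldComp_incr_le (hB : IsBrownianFamily P B) {θ θ' : Modes} (hθ : ∀ k, 0 ≤ θ.a k)
    (hθ' : ∀ k, 0 ≤ θ'.a k) {t t' : ℝ≥0} {C m : ℝ} (hd : ModeDist θ t θ' t' C m)
    (hC : 0 ≤ C) (hm : 0 ≤ m) (N : ℕ) (x y : ℝ) (j : Fin n) {r : ℝ} (hr : 0 < r) :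
    mom P r (fun ω => ‖(fieldComp B θ N t y j ω - fieldComp B θ N t x j ω) -
      (fieldComp B θ' N t' y j ω - fieldComp B θ' N t' x j ω)‖ₑ) ≤
      gaussMom r * ENNReal.ofReal (72 * C) ^ (1 / 2 : ℝ) *
        min (ENNReal.ofReal m) (edist x y) ^ (1 / 2 : ℝ) := by
  have h := mom_sum_mode_le hB hθ hθ' hd N (fun k => trig k y - trig k x) j hr hC
    (sum_trig_sub_sq_mul_le x y hm N)
  refine le_trans (le_of_eq ?_) (h.trans (le_of_eq ?_))
  · congr 1; funext ω; congr 1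
    unfold fieldComp
    simp_rw [sub_mul, Finset.sum_sub_distrib]
    ring
  · rw [edist_comm, edist_dist, Real.dist_eq, ← ENNReal.ofReal_min, mul_assoc (gaussMom r),
      ← ENNReal.mul_rpow_of_nonneg _ _ (by norm_num), ← ENNReal.ofReal_mul (by positivity)]
    congr 3; ring

lemma mom_bilin_mode_le (hB : IsBrownianFamily P B) {i j : Fin n} (hij : i ≠ j)
    {θ₁ θ₁' θ₂ θ₂' : Modes} (h₁ : ∀ k, 0 ≤ θ₁.a k) (h₁' : ∀ k, 0 ≤ θ₁'.a k)
    (h₂ : ∀ k, 0 ≤ θ₂.a k) (h₂' : ∀ k, 0 ≤ θ₂'.a k) {t₁ t₁' t₂ t₂' : ℝ≥0} {C m₁ m₂ : ℝ}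
    (hd₁ : ModeDist θ₁ t₁ θ₁' t₁' C m₁) (hd₂ : ModeDist θ₂ t₂ θ₂' t₂' C m₂) (hC : 0 ≤ C)
    (N : ℕ) (c : ℤ → ℤ → ℝ) {r : ℝ} (hr : 2 ≤ r) {V : ℝ}
    (hV : ∑ k ∈ modeRange N, ∑ l ∈ modeRange N, c k l ^ 2 *
      (min (m₁ ^ 2) (modeWeight k) * min (m₂ ^ 2) (modeWeight l)) ≤ V) :
    mom P r (fun ω => ‖∑ k ∈ modeRange N, ∑ l ∈ modeRange N, c k l *
      ((mode B θ₁ t₁ k i ω - mode B θ₁' t₁' k i ω) *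
        (mode B θ₂ t₂ l j ω - mode B θ₂' t₂' l j ω))‖ₑ) ≤
      gaussMom r ^ 2 * ENNReal.ofReal (C ^ 2 * V) ^ (1 / 2 : ℝ) := by
  -- One Gaussian family serves both factors: component `i` carries the first pair of systems, the
  -- other components the second. The blocks of `i` and `j` are disjoint.
  have hU := hB.isGaussLimit (a := fun p => if p.2 = i then θ₁.a p.1 else θ₂.a p.1)
    (a' := fun p => if p.2 = i then θ₁'.a p.1 else θ₂'.a p.1)
    (fun p => by split_ifs; exacts [h₁ _, h₂ _])
    (fun p => by split_ifs; exacts [h₁' _, h₂' _])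
    (fun p => if p.2 = i then θ₁.b p.1 else θ₂.b p.1)
    (fun p => if p.2 = i then θ₁'.b p.1 else θ₂'.b p.1)
    (fun p => if p.2 = i then t₁ else t₂) (fun p => if p.2 = i then t₁' else t₂')
  have hdis : Disjoint (modeRange N ×ˢ ({i} : Finset (Fin n))) (modeRange N ×ˢ {j}) := by
    rw [Finset.disjoint_product]
    right
    simpa using hij
  have h := hU.mom_bilin_le hdis (fun p q => c p.1 q.1) hr
  simp only [Finset.sum_product, Finset.sum_singleton, if_true, hij.symm, if_false] at h
  refine h.trans ?_
  gcongr
  refine le_trans ?_ (mul_le_mul_of_nonneg_left hV (sq_nonneg C))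
  simp_rw [Finset.mul_sum]
  refine Finset.sum_le_sum fun k _ => Finset.sum_le_sum fun l _ => ?_
  calc _ ≤ c k l ^ 2 * ((C * min (m₁ ^ 2) (modeWeight k)) * (C * min (m₂ ^ 2) (modeWeight l))) := by
        have hw := fun k => (modeWeight_pos k).le
        gcongr
        · exact kerVar_nonneg _ _ _ _ _ _
        · exact mul_nonneg hC (le_min (sq_nonneg _) (hw _))
        · exact hd₁ k
        · exact hd₂ l
    _ = _ := by ring

/-- The constant in the bound of `sum_trigCoeff_sq_mul_le'`. -/
noncomputable def areaConst : ℝ := 2 * 72 ^ 2 + 2 * (288 * Real.pi)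

lemma mom_areaComp_sub_le_offDiag (hB : IsBrownianFamily P B) {i j : Fin n} (hij : i ≠ j)
    {θ θ' : Modes} (hθ : ∀ k, 0 ≤ θ.a k) (hθ' : ∀ k, 0 ≤ θ'.a k) {t t' : ℝ≥0} {C m : ℝ}
    (hd : ModeDist θ t θ' t' C m) (h0 : ModeDist θ t Modes.zero t C 1)
    (h0' : ModeDist θ' t' Modes.zero t' C 1) (hC : 0 ≤ C) (hm : 0 ≤ m) (N : ℕ) {x y : ℝ}
    (hx : x ∈ Icc (-Real.pi) Real.pi) (hy : y ∈ Icc (-Real.pi) Real.pi) {r : ℝ} (hr : 2 ≤ r) :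
    mom P r (fun ω => ‖areaComp B θ N t x y i j ω - areaComp B θ' N t' x y i j ω‖ₑ) ≤
      2 * gaussMom r ^ 2 * ENNReal.ofReal (C ^ 2 * areaConst) ^ (1 / 2 : ℝ) *
        (edist x y ^ (1 / 2 : ℝ) * min (ENNReal.ofReal m) (edist x y) ^ (1 / 2 : ℝ)) := by
  have hr0 : 0 < r := by linarith
  have hpi := Real.pi_pos
  have hA : 0 ≤ areaConst := by unfold areaConst; positivity
  have hz : ∀ k, 0 ≤ Modes.zero.a k := fun k => le_rfl
  set V := areaConst * (|y - x| * min m |y - x|) with hV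
  have hV0 : 0 ≤ |y - x| * min m |y - x| :=
    mul_nonneg (abs_nonneg _) (le_min hm (abs_nonneg _))
  have hone : ∀ k, min ((1 : ℝ) ^ 2) (modeWeight k) = modeWeight k := fun k => by
    rw [one_pow, min_eq_right (modeWeight_le_one k)]
  have hpi' : (2 * Real.pi)⁻¹ ^ 2 ≤ 1 := by
    refine pow_le_one₀ (by positivity) (inv_le_one_of_one_le₀ (by linarith [Real.pi_gt_three]))
  set c : ℤ → ℤ → ℝ := fun k l => (2 * Real.pi)⁻¹ * trigCoeff k l x y with hc
  have hcle : ∀ k l, c k l ^ 2 ≤ trigCoeff k l x y ^ 2 := fun k l => by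
    rw [hc, mul_pow]; exact mul_le_of_le_one_left (sq_nonneg _) hpi'
  have hw := fun k => (modeWeight_pos k).le
  have hmin : ∀ k, 0 ≤ min (m ^ 2) (modeWeight k) := fun k => le_min (sq_nonneg _) (hw k)
  have v1 : ∑ k ∈ modeRange N, ∑ l ∈ modeRange N, c k l ^ 2 *
      (min (m ^ 2) (modeWeight k) * min (1 ^ 2) (modeWeight l)) ≤ V := by
    simp_rw [hone]
    refine le_trans (Finset.sum_le_sum fun k _ => Finset.sum_le_sum fun l _ =>
      mul_le_mul_of_nonneg_right (hcle k l) (mul_nonneg (hmin k) (hw l)))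
      ((sum_trigCoeff_sq_mul_le hx hy hm N).trans ?_)
    refine mul_le_mul_of_nonneg_right ?_ hV0
    unfold areaConst
    linarith
  have v2 : ∑ k ∈ modeRange N, ∑ l ∈ modeRange N, c k l ^ 2 *
      (min (1 ^ 2) (modeWeight k) * min (m ^ 2) (modeWeight l)) ≤ V := by
    simp_rw [hone]
    exact le_trans (Finset.sum_le_sum fun k _ => Finset.sum_le_sum fun l _ =>
      mul_le_mul_of_nonneg_right (hcle k l) (mul_nonneg (hw k) (hmin l)))
      (sum_trigCoeff_sq_mul_le' hx hy hm N)
  -- Split `u v - u' v' = (u - u') v + u' (v - v')`. The factor without difference is a difference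
  -- with the system without noise, with `m = 1`.
  have b1 := mom_bilin_mode_le hB hij hθ hθ' hθ hz hd h0 hC N c hr v1
  have b2 := mom_bilin_mode_le hB hij hθ' hz hθ hθ' h0' hd hC N c hr v2
  simp_rw [mode_zero, sub_zero] at b1 b2
  have hmode := fun {θ : Modes} (hθ : ∀ k, 0 ≤ θ.a k) t k j =>
    measurable_mode hB hθ t k j
  have e : ∀ ω, areaComp B θ N t x y i j ω - areaComp B θ' N t' x y i j ω =
      (∑ k ∈ modeRange N, ∑ l ∈ modeRange N, c k l *
        ((mode B θ t k i ω - mode B θ' t' k i ω) * mode B θ t l j ω)) +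
      ∑ k ∈ modeRange N, ∑ l ∈ modeRange N, c k l *
        (mode B θ' t' k i ω * (mode B θ t l j ω - mode B θ' t' l j ω)) := by
    intro ω
    unfold areaComp
    rw [← mul_sub, ← Finset.sum_sub_distrib, ← Finset.sum_add_distrib, Finset.mul_sum]
    refine Finset.sum_congr rfl fun k _ => ?_
    rw [← Finset.sum_sub_distrib, ← Finset.sum_add_distrib, Finset.mul_sum]
    exact Finset.sum_congr rfl fun l _ => by rw [hc]; ring
  have i1 := fun k => hmode hθ t k i
  have i2 := fun k => hmode hθ t k j
  have i3 := fun k => hmode hθ' t' k i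
  have i4 := fun k => hmode hθ' t' k j
  simp_rw [e]
  calc _ ≤ gaussMom r ^ 2 * ENNReal.ofReal (C ^ 2 * V) ^ (1 / 2 : ℝ) +
        gaussMom r ^ 2 * ENNReal.ofReal (C ^ 2 * V) ^ (1 / 2 : ℝ) := by
        refine (mom_mono hr0 fun ω => enorm_add_le _ _).trans
          ((mom_add_le (by linarith) ?_ ?_).trans (add_le_add b1 b2))
        · exact Measurable.aemeasurable (by fun_prop)
        · exact Measurable.aemeasurable (by fun_prop)
    _ = _ := by
        rw [hV, ← mul_assoc (C ^ 2), ENNReal.ofReal_mul (by positivity),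
          ENNReal.ofReal_mul (abs_nonneg _), ENNReal.ofReal_min,
          ENNReal.mul_rpow_of_nonneg _ _ (by norm_num),
          ENNReal.mul_rpow_of_nonneg _ _ (by norm_num), edist_comm x y, edist_dist, Real.dist_eq]
        ring

lemma mom_areaComp_sub_le_diag (hB : IsBrownianFamily P B) (i : Fin n)
    {θ θ' : Modes} (hθ : ∀ k, 0 ≤ θ.a k) (hθ' : ∀ k, 0 ≤ θ'.a k) {t t' : ℝ≥0} {C m : ℝ}
    (hd : ModeDist θ t θ' t' C m) (h0 : ModeDist θ t Modes.zero t C 1)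
    (h0' : ModeDist θ' t' Modes.zero t' C 1) (hC : 0 ≤ C) (hm : 0 ≤ m) (N : ℕ) (x y : ℝ)
    {r : ℝ} (hr : 2 ≤ r) :
    mom P r (fun ω => ‖areaComp B θ N t x y i i ω - areaComp B θ' N t' x y i i ω‖ₑ) ≤
      2 * (gaussMom (2 * r) * ENNReal.ofReal (72 * C) ^ (1 / 2 : ℝ)) ^ 2 *
        (edist x y ^ (1 / 2 : ℝ) * min (ENNReal.ofReal m) (edist x y) ^ (1 / 2 : ℝ)) := by
  have hr0 : 0 < r := by linarith
  have hz : ∀ k, 0 ≤ Modes.zero.a k := fun k => le_rfl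
  set G := gaussMom (2 * r) * ENNReal.ofReal (72 * C) ^ (1 / 2 : ℝ) with hG
  set F : Ω → ℝ := fun ω => fieldComp B θ N t y i ω - fieldComp B θ N t x i ω with hF
  set F' : Ω → ℝ := fun ω => fieldComp B θ' N t' y i ω - fieldComp B θ' N t' x i ω with hF'
  have mF : Measurable F :=
    (measurable_fieldComp hB hθ N t y i).sub (measurable_fieldComp hB hθ N t x i)
  have mF' : Measurable F' :=
    (measurable_fieldComp hB hθ' N t' y i).sub (measurable_fieldComp hB hθ' N t' x i)
  have b := mom_fieldComp_incr_le hB hθ hθ' hd hC hm N x y i (r := 2 * r) (by linarith)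
  have c := mom_fieldComp_incr_le hB hθ hz h0 hC zero_le_one N x y i (r := 2 * r) (by linarith)
  have c' := mom_fieldComp_incr_le hB hθ' hz h0' hC zero_le_one N x y i (r := 2 * r) (by linarith)
  have fz : ∀ s u ω, fieldComp B Modes.zero N s u i ω = 0 := fun s u ω => by
    simp [fieldComp, mode_zero]
  simp only [fz, sub_zero] at c c'
  have c1 : mom P (2 * r) (fun ω => ‖F ω‖ₑ) ≤ G * edist x y ^ (1 / 2 : ℝ) := by
    refine c.trans ?_
    gcongr
    exact min_le_right _ _
  have c1' : mom P (2 * r) (fun ω => ‖F' ω‖ₑ) ≤ G * edist x y ^ (1 / 2 : ℝ) := by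
    refine c'.trans ?_
    gcongr
    exact min_le_right _ _
  -- `F² / 2 - F'² / 2 = (F + F') (F - F') / 2`; Cauchy–Schwarz then calls for moments of order `2r`
  -- of the increments.
  have e : ∀ ω, ‖areaComp B θ N t x y i i ω - areaComp B θ' N t' x y i i ω‖ₑ ≤
      ‖F ω‖ₑ * ‖F ω - F' ω‖ₑ + ‖F' ω‖ₑ * ‖F ω - F' ω‖ₑ := by
    intro ω
    rw [areaComp_diag, areaComp_diag, ← add_mul]
    have : 1 / 2 * (fieldComp B θ N t y i ω - fieldComp B θ N t x i ω) ^ 2 -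
        1 / 2 * (fieldComp B θ' N t' y i ω - fieldComp B θ' N t' x i ω) ^ 2 =
        (1 / 2 * (F ω + F' ω)) * (F ω - F' ω) := by rw [hF, hF']; ring
    rw [this, enorm_mul]
    gcongr
    rw [enorm_mul]
    have h2 : ‖(1 / 2 : ℝ)‖ₑ ≤ 1 := by
      rw [Real.enorm_eq_ofReal (by norm_num)]
      exact ENNReal.ofReal_le_one.2 (by norm_num)
    calc _ ≤ 1 * ‖F ω + F' ω‖ₑ := by gcongr
      _ ≤ _ := by rw [one_mul]; exact enorm_add_le _ _
  have m1 : AEMeasurable (fun ω => ‖F ω‖ₑ) P := mF.enorm.aemeasurable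
  have m1' : AEMeasurable (fun ω => ‖F' ω‖ₑ) P := mF'.enorm.aemeasurable
  have m2 : AEMeasurable (fun ω => ‖F ω - F' ω‖ₑ) P := (mF.sub mF').enorm.aemeasurable
  refine (mom_mono hr0 e).trans ((mom_add_le (by linarith) (m1.mul m2) (m1'.mul m2)).trans ?_)
  refine (add_le_add (mom_mul_le hr0 m1 m2) (mom_mul_le hr0 m1' m2)).trans ?_
  calc _ ≤ (G * edist x y ^ (1 / 2 : ℝ)) * (G * min (ENNReal.ofReal m) (edist x y) ^ (1 / 2 : ℝ)) +
        (G * edist x y ^ (1 / 2 : ℝ)) * (G * min (ENNReal.ofReal m) (edist x y) ^ (1 / 2 : ℝ)) := by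
        gcongr
    _ = _ := by ring

end Truncated

end RoughHeat

namespace RoughHeat

/-! ### Moment bounds for truncated Fourier series -/

section Bounds

/-- Used with the distance of the systems, the time lag and the space lag as the three bounds, over
which the exponent `s = 1/2` is distributed. -/
lemma ennreal_interpolation {u p q v : ℝ≥0∞} (hp : u ≤ p) (hq : u ≤ q) (hv : u ≤ v)
    {a b c s : ℝ} (ha : 0 ≤ a) (hb : 0 ≤ b) (hc : 0 ≤ c) (h : a + b + c = s) :
    u ^ s ≤ p ^ a * q ^ b * v ^ c := by
  rw [← h, ENNReal.rpow_add_of_nonneg _ _ (by positivity) hc, ENNReal.rpow_add_of_nonneg _ _ ha hb]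
  gcongr

lemma enorm_le_sum_enorm {ι : Type*} [Fintype ι] (v : EuclideanSpace ℝ ι) :
    ‖v‖ₑ ≤ ∑ i, ‖v i‖ₑ := by
  have h : ‖v‖ ≤ ∑ i, ‖v i‖ := by
    rw [EuclideanSpace.norm_eq]
    refine Real.sqrt_le_iff.2 ⟨Finset.sum_nonneg fun i _ => norm_nonneg _, ?_⟩
    exact Finset.sum_sq_le_sq_sum_of_nonneg fun i _ => norm_nonneg _
  rw [← ofReal_norm]
  refine (ENNReal.ofReal_le_ofReal h).trans (le_of_eq ?_)
  rw [ENNReal.ofReal_sum_of_nonneg fun i _ => norm_nonneg _]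
  simp_rw [ofReal_norm]

variable {Ω : Type*} {n : ℕ}

/-- The truncated series for the solution. -/
noncomputable def field (B : ℤ × Fin n → ℝ≥0 → Ω → ℝ) (θ : Modes) (N : ℕ) (ω : Ω) (t : ℝ≥0)
    (x : Seg) : Vec n := WithLp.toLp 2 fun j => fieldComp B θ N t x j ω

/-- The truncated series for the iterated integral. -/
noncomputable def area (B : ℤ × Fin n → ℝ≥0 → Ω → ℝ) (θ : Modes) (N : ℕ) (ω : Ω) (t : ℝ≥0)
    (x y : Seg) : Ten n := WithLp.toLp 2 fun ij => areaComp B θ N t x y ij.1 ij.2 ω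

variable [MeasurableSpace Ω] {P : Measure Ω} {B : ℤ × Fin n → ℝ≥0 → Ω → ℝ}

/-- Moment bounds on the increments of the difference of two processes, and of their iterated
integrals. -/
structure HasLiftBound (P : Measure Ω) (T : ℝ≥0) (r l₁ l₂ : ℝ) (M : ℝ≥0∞)
    (X : Ω → ℝ≥0 → Seg → Vec n) (XX : Ω → ℝ≥0 → Seg → Seg → Ten n)
    (X' : Ω → ℝ≥0 → Seg → Vec n) (XX' : Ω → ℝ≥0 → Seg → Seg → Ten n) : Prop where
  path : HasIncrementBound P T (2 * r) (l₁ / 4) (l₂ / 2) M (fun ω t x => X ω t x - X' ω t x)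
  area : ∀ x y, ∀ s ≤ T, ∀ t ≤ T, mom P r (fun ω => ‖(XX ω t x y - XX' ω t x y) -
    (XX ω s x y - XX' ω s x y)‖ₑ) ≤ M * edist s t ^ (l₁ / 4) * edist x y ^ l₂

lemma mom_enorm_le_card {ι : Type*} [Fintype ι] {D : Ω → EuclideanSpace ℝ ι} {r : ℝ} (hr : 1 ≤ r)
    (hD : ∀ i, Measurable fun ω => D ω i) {A : ℝ≥0∞}
    (h : ∀ i, mom P r (fun ω => ‖D ω i‖ₑ) ≤ A) :
    mom P r (fun ω => ‖D ω‖ₑ) ≤ Fintype.card ι * A := by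
  refine (mom_mono (by linarith) fun ω => enorm_le_sum_enorm (D ω)).trans
    ((mom_sum_le hr Finset.univ fun i _ => (hD i).enorm.aemeasurable).trans ?_)
  refine (Finset.sum_le_sum fun i _ => h i).trans (le_of_eq ?_)
  simp

/-- With `a, b` the first process at two times and `c, d` the second one, the four terms may be
paired by process or by time; each pairing gives one of the two bounds. -/
lemma mom_rect_le {a b c d : Ω → ℝ} (ha : Measurable a) (hb : Measurable b) (hc : Measurable c)
    (hd : Measurable d) {r : ℝ} (hr : 1 ≤ r) {G p q : ℝ≥0∞} {s : ℝ}
    (hab : mom P r (fun ω => ‖a ω - b ω‖ₑ) ≤ G * p ^ s)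
    (hcd : mom P r (fun ω => ‖c ω - d ω‖ₑ) ≤ G * p ^ s)
    (hac : mom P r (fun ω => ‖a ω - c ω‖ₑ) ≤ G * q ^ s)
    (hbd : mom P r (fun ω => ‖b ω - d ω‖ₑ) ≤ G * q ^ s) :
    mom P r (fun ω => ‖(a ω - c ω) - (b ω - d ω)‖ₑ) ≤ 2 * G * min p q ^ s := by
  have hr0 : 0 < r := by linarith
  have key : ∀ {u v : Ω → ℝ} {A : ℝ≥0∞}, Measurable u → Measurable v →
      mom P r (fun ω => ‖u ω‖ₑ) ≤ A → mom P r (fun ω => ‖v ω‖ₑ) ≤ A →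
      mom P r (fun ω => ‖u ω - v ω‖ₑ) ≤ 2 * A := by
    intro u v A hu hv h1 h2
    refine (mom_mono hr0 fun ω => enorm_sub_le).trans
      ((mom_add_le hr hu.enorm.aemeasurable hv.enorm.aemeasurable).trans ?_)
    rw [two_mul]
    exact add_le_add h1 h2
  rcases le_total p q with h | h
  · rw [min_eq_left h, mul_assoc]
    refine le_trans (le_of_eq ?_) (key (ha.sub hb) (hc.sub hd) hab hcd)
    congr 1; funext ω; congr 1; simp only [Pi.sub_apply]; ring
  · rw [min_eq_right h, mul_assoc]
    exact key (ha.sub hc) (hb.sub hd) hac hbd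

/-- Bounds on the variances of the modes of two systems and of their difference. -/
structure Modes.Comparable (θ θ' : Modes) (C η : ℝ) (T : ℝ≥0) : Prop where
  nonneg : ∀ k, 0 ≤ θ.a k
  nonneg' : ∀ k, 0 ≤ θ'.a k
  time : ∀ s ≤ T, ∀ t ≤ T, ModeDist θ t θ s C (√(dist s t))
  time' : ∀ s ≤ T, ∀ t ≤ T, ModeDist θ' t θ' s C (√(dist s t))
  size : ∀ t ≤ T, ModeDist θ t Modes.zero t C 1
  size' : ∀ t ≤ T, ModeDist θ' t Modes.zero t C 1
  close : ∀ t ≤ T, ModeDist θ t θ' t C η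

lemma ModeDist.mono {θ θ' : Modes} {t t' : ℝ≥0} {C C' m : ℝ} (h : ModeDist θ t θ' t' C m)
    (hC : C ≤ C') : ModeDist θ t θ' t' C' m := fun k =>
  (h k).trans (mul_le_mul_of_nonneg_right hC (le_min (sq_nonneg _) (modeWeight_pos k).le))

lemma Modes.Bounded.comparable {θ θ' : Modes} {c M C η : ℝ} {T : ℝ≥0} (hc : 0 < c)
    (hC : 0 ≤ C) (hθ : θ.Bounded c M) (hθ' : θ'.Bounded c M) (h : θ.Close θ' C η T) :
    θ.Comparable θ' (varConst c M T + C) η T := by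
  have hV := varConst_nonneg hc M T
  have time : ∀ {θ : Modes}, θ.Bounded c M → ∀ s ≤ T, ∀ t ≤ T,
      ModeDist θ t θ s (varConst c M T + C) (√(dist s t)) := by
    intro θ hθ s hs t ht
    refine ModeDist.mono (C := varConst c M T) (fun k => ?_) (by linarith)
    rw [Real.sq_sqrt dist_nonneg]
    exact hθ.kerVar_time hc T k hs ht
  have size : ∀ {θ : Modes}, θ.Bounded c M → ∀ t ≤ T,
      ModeDist θ t Modes.zero t (varConst c M T + C) 1 := fun hθ t ht =>
    ModeDist.mono (C := varConst c M T) (fun k => hθ.close_zero hc T k t ht) (by linarith)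
  exact ⟨hθ.nonneg, hθ'.nonneg, time hθ, time hθ', size hθ, size hθ', fun t ht =>
    ModeDist.mono (C := C) (fun k => h k t ht) (by linarith)⟩

lemma ofReal_sqrt_dist (s t : ℝ≥0) : ENNReal.ofReal √(dist s t) = edist s t ^ (1 / 2 : ℝ) := by
  rw [Real.sqrt_eq_rpow, ← ENNReal.ofReal_rpow_of_nonneg dist_nonneg (by norm_num), edist_dist]

lemma edist_seg_le (x y : Seg) : edist x y ≤ ENNReal.ofReal (2 * Real.pi) := by
  rw [Subtype.edist_eq, edist_dist, Real.dist_eq]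
  refine ENNReal.ofReal_le_ofReal ?_
  rw [abs_le]
  constructor <;> linarith [x.2.1, x.2.2, y.2.1, y.2.2]

variable [IsProbabilityMeasure P]

/-- The moments of the increments of a difference of two truncated series and of their iterated
integrals. -/
theorem exists_increment_bounds {C : ℝ} (hC : 0 ≤ C) (T : ℝ≥0) {r l₁ l₂ : ℝ} (hr : 2 ≤ r)
    (hl₁ : 0 ≤ l₁) (hl₂ : 0 ≤ l₂) (hl : l₁ + l₂ ≤ 1) :
    ∃ K : ℝ≥0, ∀ (B : ℤ × Fin n → ℝ≥0 → Ω → ℝ), IsBrownianFamily P B → ∀ (θ θ' : Modes) (η : ℝ),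
      0 ≤ η → θ.Comparable θ' C η T → ∀ N : ℕ,
      HasLiftBound P T r l₁ l₂ (K * ENNReal.ofReal η ^ (1 / 2 * (1 - l₁ - l₂)))
        (field B θ N) (area B θ N) (field B θ' N) (area B θ' N) := by
  have hr0 : 0 < r := by linarith
  have hpi := Real.pi_pos
  have hA : 0 ≤ areaConst := by unfold areaConst; positivity
  set G₁ := gaussMom (2 * r) * ENNReal.ofReal (72 * C) ^ (1 / 2 : ℝ) with hG₁
  set G₂ := 2 * gaussMom r ^ 2 * ENNReal.ofReal (C ^ 2 * areaConst) ^ (1 / 2 : ℝ) + 2 * G₁ ^ 2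
    with hG₂
  have g1 := gaussMom_ne_top hr0
  have g2 := gaussMom_ne_top (r := 2 * r) (by linarith)
  have fG₁ : G₁ ≠ ⊤ := by finiteness
  have fG₂ : G₂ ≠ ⊤ := by finiteness
  -- `1/2 = κ + l₁/2 + l₂/2`; the power `l₁/2` of `|t - s|^{1/2}` is the exponent `l₁/4` in time.
  set κ := 1 / 2 * (1 - l₁ - l₂) with hκ
  have hκ0 : 0 ≤ κ := by rw [hκ]; linarith
  -- At a fixed point there is no space lag; its share `l₂/2` is given to `√T`, which dominates `|t
  -- - s|^{1/2}`.
  set S := ENNReal.ofReal √T ^ (l₂ / 2) with hS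
  -- The iterated integral yields `|x - y|^{1/2 + l₂/2}`; the surplus over the exponent `l₂` is
  -- absorbed by the diameter.
  set Q := ENNReal.ofReal (2 * Real.pi) ^ (1 / 2 - l₂ / 2) with hQ
  set K := (Fintype.card (Fin n) : ℝ≥0∞) * (2 * G₁) * (S + 1) +
    (Fintype.card (Fin n × Fin n) : ℝ≥0∞) * (2 * G₂) * Q with hK
  have fS : S ≠ ⊤ := by rw [hS]; finiteness
  have fQ : Q ≠ ⊤ := ENNReal.rpow_ne_top_of_nonneg (by linarith) (by finiteness)
  have fK : K ≠ ⊤ := by rw [hK]; finiteness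
  refine ⟨K.toNNReal, fun B hB θ θ' η hη h N => ?_⟩
  rw [ENNReal.coe_toNNReal fK]
  have K1 : (Fintype.card (Fin n) : ℝ≥0∞) * (2 * G₁) * S ≤ K :=
    le_trans (by gcongr; exact le_self_add) le_self_add
  have K2 : (Fintype.card (Fin n) : ℝ≥0∞) * (2 * G₁) ≤ K := by
    refine le_trans ?_ le_self_add
    nth_rewrite 1 [← mul_one ((Fintype.card (Fin n) : ℝ≥0∞) * (2 * G₁))]
    gcongr
    exact le_add_self
  have K3 : (Fintype.card (Fin n × Fin n) : ℝ≥0∞) * (2 * G₂) * Q ≤ K := le_add_self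
  have mf := fun {θ : Modes} (hθ : ∀ k, 0 ≤ θ.a k) t (x : Seg) j =>
    measurable_fieldComp hB hθ N t x j
  have ma := fun {θ : Modes} (hθ : ∀ k, 0 ≤ θ.a k) t (x y : Seg) i j =>
    measurable_areaComp hB hθ N t x y i j
  have hsqrt : ∀ s t : ℝ≥0, 0 ≤ √(dist s t) := fun s t => Real.sqrt_nonneg _
  have hρ : ∀ s t : ℝ≥0, (edist s t ^ (1 / 2 : ℝ)) ^ (l₁ / 2) = edist s t ^ (l₁ / 4) := by
    intro s t
    rw [← ENNReal.rpow_mul]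
    congr 1; ring
  have n1 := h.nonneg
  have n2 := h.nonneg'
  refine ⟨⟨fun x s hs t ht => ?_, fun x y s hs t ht => ?_⟩, fun x y s hs t ht => ?_⟩
  · have key : ∀ j, mom P (2 * r) (fun ω =>
        ‖(fieldComp B θ N t x j ω - fieldComp B θ' N t x j ω) -
          (fieldComp B θ N s x j ω - fieldComp B θ' N s x j ω)‖ₑ) ≤
        2 * G₁ * (ENNReal.ofReal η ^ κ * edist s t ^ (l₁ / 4) * S) := by
      intro j
      refine (mom_rect_le (mf n1 t x j) (mf n1 s x j) (mf n2 t x j) (mf n2 s x j) (by linarith)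
        (mom_fieldComp_sub_le hB n1 n1 (h.time s hs t ht) hC (hsqrt _ _) N x j (by linarith))
        (mom_fieldComp_sub_le hB n2 n2 (h.time' s hs t ht) hC (hsqrt _ _) N x j (by linarith))
        (mom_fieldComp_sub_le hB n1 n2 (h.close t ht) hC hη N x j (by linarith))
        (mom_fieldComp_sub_le hB n1 n2 (h.close s hs) hC hη N x j (by linarith))).trans ?_
      gcongr
      rw [← hρ, hS, ofReal_sqrt_dist]
      refine ennreal_interpolation (min_le_right _ _) (min_le_left _ _) ?_ hκ0 (by linarith)
        (by linarith) (by rw [hκ]; ring)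
      refine (min_le_left _ _).trans ?_
      rw [← ofReal_sqrt_dist]
      refine ENNReal.ofReal_le_ofReal (Real.sqrt_le_sqrt ?_)
      have h3 : (s : ℝ) ≤ T := hs
      have h4 : (t : ℝ) ≤ T := ht
      rw [NNReal.dist_eq, abs_le]
      constructor <;> linarith [s.coe_nonneg, t.coe_nonneg]
    refine (mom_enorm_le_card (by linarith) (fun j => ?_) key).trans ?_
    · exact ((mf n1 t x j).sub (mf n2 t x j)).sub ((mf n1 s x j).sub (mf n2 s x j))
    · calc _ = ((Fintype.card (Fin n) : ℝ≥0∞) * (2 * G₁) * S) *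
            (ENNReal.ofReal η ^ κ * edist s t ^ (l₁ / 4)) := by ring
        _ ≤ K * (ENNReal.ofReal η ^ κ * edist s t ^ (l₁ / 4)) := by gcongr
        _ = _ := by ring
  · have key : ∀ j, mom P (2 * r) (fun ω =>
        ‖((fieldComp B θ N t y j ω - fieldComp B θ N t x j ω) -
            (fieldComp B θ' N t y j ω - fieldComp B θ' N t x j ω)) -
          ((fieldComp B θ N s y j ω - fieldComp B θ N s x j ω) -
            (fieldComp B θ' N s y j ω - fieldComp B θ' N s x j ω))‖ₑ) ≤
        2 * G₁ * (ENNReal.ofReal η ^ κ * edist s t ^ (l₁ / 4) * edist x y ^ (l₂ / 2)) := by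
      intro j
      have b1 := mom_fieldComp_incr_le hB n1 n1 (h.time s hs t ht) hC (hsqrt _ _) N x y j
        (r := 2 * r) (by linarith)
      have b2 := mom_fieldComp_incr_le hB n2 n2 (h.time' s hs t ht) hC (hsqrt _ _) N x y j
        (r := 2 * r) (by linarith)
      have b3 := mom_fieldComp_incr_le hB n1 n2 (h.close t ht) hC hη N x y j
        (r := 2 * r) (by linarith)
      have b4 := mom_fieldComp_incr_le hB n1 n2 (h.close s hs) hC hη N x y j
        (r := 2 * r) (by linarith)
      refine (mom_rect_le ((mf n1 t y j).sub (mf n1 t x j)) ((mf n1 s y j).sub (mf n1 s x j))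
        ((mf n2 t y j).sub (mf n2 t x j)) ((mf n2 s y j).sub (mf n2 s x j)) (by linarith)
        b1 b2 b3 b4).trans ?_
      gcongr
      rw [← hρ, ofReal_sqrt_dist]
      exact ennreal_interpolation ((min_le_right _ _).trans (min_le_left _ _))
        ((min_le_left _ _).trans (min_le_left _ _)) ((min_le_left _ _).trans (min_le_right _ _))
        hκ0 (by linarith) (by linarith) (by rw [hκ]; ring)
    have hm : ∀ j, Measurable fun ω =>
        ((fieldComp B θ N t y j ω - fieldComp B θ N t x j ω) -
            (fieldComp B θ' N t y j ω - fieldComp B θ' N t x j ω)) -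
          ((fieldComp B θ N s y j ω - fieldComp B θ N s x j ω) -
            (fieldComp B θ' N s y j ω - fieldComp B θ' N s x j ω)) := fun j =>
      (((mf n1 t y j).sub (mf n1 t x j)).sub ((mf n2 t y j).sub (mf n2 t x j))).sub
        (((mf n1 s y j).sub (mf n1 s x j)).sub ((mf n2 s y j).sub (mf n2 s x j)))
    have e : ∀ ω, (field B θ N ω t y - field B θ' N ω t y -
        (field B θ N ω t x - field B θ' N ω t x)) - (field B θ N ω s y - field B θ' N ω s y -
        (field B θ N ω s x - field B θ' N ω s x)) = WithLp.toLp 2 fun j =>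
        ((fieldComp B θ N t y j ω - fieldComp B θ N t x j ω) -
            (fieldComp B θ' N t y j ω - fieldComp B θ' N t x j ω)) -
          ((fieldComp B θ N s y j ω - fieldComp B θ N s x j ω) -
            (fieldComp B θ' N s y j ω - fieldComp B θ' N s x j ω)) := by
      intro ω
      ext j
      simp only [field, PiLp.sub_apply]
      ring
    simp_rw [e]
    refine (mom_enorm_le_card (by linarith) hm key).trans ?_
    calc _ = ((Fintype.card (Fin n) : ℝ≥0∞) * (2 * G₁)) *
            (ENNReal.ofReal η ^ κ * edist s t ^ (l₁ / 4) * edist x y ^ (l₂ / 2)) := by ring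
      _ ≤ K * (ENNReal.ofReal η ^ κ * edist s t ^ (l₁ / 4) * edist x y ^ (l₂ / 2)) := by gcongr
      _ = _ := by ring
  · have bound : ∀ {θ θ' : Modes} (i j : Fin n), (∀ k, 0 ≤ θ.a k) → (∀ k, 0 ≤ θ'.a k) →
        ∀ {t t' : ℝ≥0} {m : ℝ}, 0 ≤ m → ModeDist θ t θ' t' C m → ModeDist θ t Modes.zero t C 1 →
        ModeDist θ' t' Modes.zero t' C 1 →
        mom P r (fun ω => ‖areaComp B θ N t x y i j ω - areaComp B θ' N t' x y i j ω‖ₑ) ≤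
          G₂ * edist x y ^ (1 / 2 : ℝ) *
            min (ENNReal.ofReal m) (edist x y) ^ (1 / 2 : ℝ) := by
      intro θ θ' i j hθ hθ' t t' m hm hd h0 h0'
      rw [mul_assoc]
      by_cases hij : i = j
      · subst hij
        refine (mom_areaComp_sub_le_diag hB i hθ hθ' hd h0 h0' hC hm N x y hr).trans ?_
        rw [← hG₁]
        refine mul_le_mul' le_add_self (le_of_eq ?_)
        rfl
      · refine (mom_areaComp_sub_le_offDiag hB hij hθ hθ' hd h0 h0' hC hm N x.2 y.2 hr).trans ?_
        refine mul_le_mul' le_self_add (le_of_eq ?_)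
        rfl
    have key : ∀ ij : Fin n × Fin n, mom P r (fun ω =>
        ‖(areaComp B θ N t x y ij.1 ij.2 ω - areaComp B θ' N t x y ij.1 ij.2 ω) -
          (areaComp B θ N s x y ij.1 ij.2 ω - areaComp B θ' N s x y ij.1 ij.2 ω)‖ₑ) ≤
        2 * G₂ * (ENNReal.ofReal η ^ κ * edist s t ^ (l₁ / 4) * (Q * edist x y ^ l₂)) := by
      rintro ⟨i, j⟩
      refine (mom_rect_le (ma n1 t x y i j) (ma n1 s x y i j) (ma n2 t x y i j) (ma n2 s x y i j)
        (by linarith)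
        (bound i j n1 n1 (hsqrt _ _) (h.time s hs t ht) (h.size t ht) (h.size s hs))
        (bound i j n2 n2 (hsqrt _ _) (h.time' s hs t ht) (h.size' t ht) (h.size' s hs))
        (bound i j n1 n2 hη (h.close t ht) (h.size t ht) (h.size' t ht))
        (bound i j n1 n2 hη (h.close s hs) (h.size s hs) (h.size' s hs))).trans ?_
      rw [← mul_assoc 2 G₂, mul_assoc (2 * G₂)]
      refine mul_le_mul_right ?_ _
      have h1 : edist x y ^ (1 / 2 : ℝ) * edist x y ^ (l₂ / 2) ≤ Q * edist x y ^ l₂ := by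
        rw [← ENNReal.rpow_add_of_nonneg _ _ (by norm_num) (by linarith)]
        have : (1 / 2 + l₂ / 2 : ℝ) = (1 / 2 - l₂ / 2) + l₂ := by ring
        rw [this, ENNReal.rpow_add_of_nonneg _ _ (by linarith) hl₂, hQ]
        have h2 : (0 : ℝ) ≤ 1 / 2 - l₂ / 2 := by linarith
        gcongr
        exact edist_seg_le x y
      calc _ ≤ edist x y ^ (1 / 2 : ℝ) *
            (ENNReal.ofReal η ^ κ * edist s t ^ (l₁ / 4) * edist x y ^ (l₂ / 2)) := by
            refine mul_le_mul_right ?_ _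
            rw [← hρ, ofReal_sqrt_dist]
            exact ennreal_interpolation ((min_le_right _ _).trans (min_le_left _ _))
              ((min_le_left _ _).trans (min_le_left _ _))
              ((min_le_left _ _).trans (min_le_right _ _))
              hκ0 (by linarith) (by linarith) (by rw [hκ]; ring)
        _ = ENNReal.ofReal η ^ κ * edist s t ^ (l₁ / 4) *
            (edist x y ^ (1 / 2 : ℝ) * edist x y ^ (l₂ / 2)) := by ring
        _ ≤ _ := mul_le_mul_right h1 _
    refine (mom_enorm_le_card (by linarith) (fun ij => ?_) key).trans ?_
    · exact ((ma n1 t x y ij.1 ij.2).sub (ma n2 t x y ij.1 ij.2)).sub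
        ((ma n1 s x y ij.1 ij.2).sub (ma n2 s x y ij.1 ij.2))
    · calc _ = ((Fintype.card (Fin n × Fin n) : ℝ≥0∞) * (2 * G₂) * Q) *
            (ENNReal.ofReal η ^ κ * edist s t ^ (l₁ / 4) * edist x y ^ l₂) := by ring
        _ ≤ K * (ENNReal.ofReal η ^ κ * edist s t ^ (l₁ / 4) * edist x y ^ l₂) := by gcongr
        _ = _ := by ring

end Bounds

end RoughHeat

namespace RoughHeat

/-! ### Moment bounds for processes and iterated integrals -/

section LiftBound

variable {Ω : Type*} [MeasurableSpace Ω] {P : Measure Ω} {n : ℕ}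

variable {X X' : Ω → ℝ≥0 → Seg → Vec n} {XX XX' : Ω → ℝ≥0 → Seg → Seg → Ten n}

/-- Norms of a difference of lifts which satisfies moment bounds have a majorant with finite
moments. -/
theorem exists_norm_majorant [IsProbabilityMeasure P] {p α₁ α₂ l₁ l₂ : ℝ} (hp : 1 ≤ p)
    (hα₁ : 0 < α₁) (hα₂ : 0 < α₂) (h₁ : α₁ < l₁ / 4) (h₂ : α₂ < l₂ / 2) :
    ∃ r : ℝ, 2 ≤ r ∧ ∀ (T K : ℝ≥0), ∃ K' : ℝ≥0, ∀ (X X' : Ω → ℝ≥0 → Seg → Vec n)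
      (XX XX' : Ω → ℝ≥0 → Seg → Seg → Ten n) (M : ℝ≥0∞), IsEnhanced X XX → IsEnhanced X' XX' →
      HasLiftBound P T r l₁ l₂ K X XX 0 0 → HasLiftBound P T r l₁ l₂ K X' XX' 0 0 →
      HasLiftBound P T r l₁ l₂ M X XX X' XX' →
      ∃ H : Ω → ℝ≥0∞, Measurable H ∧ mom P p H ≤ K' * M ∧ ∀ ω,
        HasPathBound T α₁ α₂ (fun t x => X ω t x - X' ω t x) (H ω) ∧
        ∀ x y, pathNorm α₁ T (fun t => XX ω t x y - XX' ω t x y) ≤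
          H ω * edist x y ^ (2 * α₂) := by
  have d₁ : 0 < l₁ / 4 - α₁ := by linarith
  have d₂ : 0 < l₂ / 2 - α₂ := by linarith
  -- `r` must beat the gaps between the exponents; `2 / gap` instead of `1 / gap` makes the
  -- conditions of the Kolmogorov criterion strict. It is fixed before `K`, which bounds moments
  -- whose order depends on `r`.
  obtain ⟨r, hr⟩ : ∃ r : ℝ, max (max 2 p) (max (2 / (l₁ / 4 - α₁)) (2 / (l₂ / 2 - α₂))) ≤ r :=
    ⟨_, le_rfl⟩
  simp only [max_le_iff, div_le_iff₀ d₁, div_le_iff₀ d₂] at hr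
  obtain ⟨⟨hr2, hrp⟩, hr₁, hr₂⟩ := hr
  refine ⟨r, hr2, fun T K => ?_⟩
  obtain ⟨C₁, hC₁⟩ := exists_hasPathBound (Ω := Ω) (P := P) (n := n) (r := 2 * r) (β₁ := l₁ / 4)
    (β₂ := l₂ / 2) hα₁ hα₂ (by linarith) (by linarith) (by linarith) T
  obtain ⟨C₂, hC₂⟩ := exists_iterated_majorant (Ω := Ω) (P := P) (n := n) (r := r) (β₁ := l₁ / 4)
    (β₂ := l₂ / 2) (β₃ := l₂) hα₁ hα₂ (by linarith) (by linarith) (by linarith) (by linarith) T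
  refine ⟨C₁ + C₂ * (1 + K), fun X X' XX XX' M hX hX' bX bX' b => ?_⟩
  obtain ⟨H₁, m₁, q₁, p₁⟩ := hC₁ (fun ω t x => X ω t x - X' ω t x) M
    (fun ω => (hX.cont ω).sub (hX'.cont ω)) (fun ω x => by rw [hX.zero, hX'.zero, sub_zero])
    (fun t x => (hX.meas t x).sub (hX'.meas t x)) b.path
  have z : ∀ {Y : Ω → ℝ≥0 → Seg → Vec n},
      HasIncrementBound P T (2 * r) (l₁ / 4) (l₂ / 2) K
        (fun ω t x => Y ω t x - (0 : Ω → ℝ≥0 → Seg → Vec n) ω t x) →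
      HasIncrementBound P T (2 * r) (l₁ / 4) (l₂ / 2) K Y := fun h => by simpa using h
  obtain ⟨H₂, m₂, q₂, p₂⟩ := hC₂ X X' XX XX' M K hX hX' (z bX.path) (z bX'.path) b.path b.area
  refine ⟨fun ω => H₁ ω + H₂ ω, m₁.add m₂, ?_, fun ω => ⟨⟨fun x => ?_, fun x y => ?_⟩,
    fun x y => ?_⟩⟩
  · refine (mom_add_le hp m₁.aemeasurable m₂.aemeasurable).trans ?_
    have s1 := (mom_le_mom (P := P) (by linarith) (hrp.trans (by linarith : r ≤ 2 * r))
      m₁.aemeasurable).trans q₁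
    have s2 := (mom_le_mom (P := P) (by linarith) hrp m₂.aemeasurable).trans q₂
    refine (add_le_add s1 s2).trans (le_of_eq ?_)
    push_cast
    ring
  · exact ((p₁ ω).point x).trans le_self_add
  · exact ((p₁ ω).incr x y).trans (mul_le_mul_left le_self_add _)
  · exact (p₂ ω x y).trans (mul_le_mul_left le_add_self _)

/-- Moment bounds pass to pointwise limits. -/
lemma HasLiftBound.of_tendsto {T : ℝ≥0} {r l₁ l₂ : ℝ} (hr : 0 < r) {M : ℝ≥0∞}
    {Y Y' : ℕ → Ω → ℝ≥0 → Seg → Vec n} {YY YY' : ℕ → Ω → ℝ≥0 → Seg → Seg → Ten n}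
    (mY : ∀ m t x, Measurable fun ω => Y m ω t x) (mY' : ∀ m t x, Measurable fun ω => Y' m ω t x)
    (mYY : ∀ m t x y, Measurable fun ω => YY m ω t x y)
    (mYY' : ∀ m t x y, Measurable fun ω => YY' m ω t x y)
    (hX : ∀ᵐ ω ∂P, ∀ t x, Tendsto (fun m => Y m ω t x) atTop (𝓝 (X ω t x)))
    (hX' : ∀ᵐ ω ∂P, ∀ t x, Tendsto (fun m => Y' m ω t x) atTop (𝓝 (X' ω t x)))
    (hXX : ∀ᵐ ω ∂P, ∀ t x y, Tendsto (fun m => YY m ω t x y) atTop (𝓝 (XX ω t x y)))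
    (hXX' : ∀ᵐ ω ∂P, ∀ t x y, Tendsto (fun m => YY' m ω t x y) atTop (𝓝 (XX' ω t x y)))
    (h : ∀ m, HasLiftBound P T r l₁ l₂ M (Y m) (YY m) (Y' m) (YY' m)) :
    HasLiftBound P T r l₁ l₂ M X XX X' XX' := by
  have hr2 : 0 < 2 * r := by linarith
  refine ⟨⟨fun x s hs t ht => ?_, fun x y s hs t ht => ?_⟩, fun x y s hs t ht => ?_⟩
  · refine mom_le_of_tendsto hr2 (fun m => ?_) ?_ (fun m => (h m).path.time x s hs t ht)
      tendsto_const_nhds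
    · exact (((mY m t x).sub (mY' m t x)).sub ((mY m s x).sub (mY' m s x))).enorm.aemeasurable
    · filter_upwards [hX, hX'] with ω h1 h2
      exact (((h1 t x).sub (h2 t x)).sub ((h1 s x).sub (h2 s x))).enorm
  · refine mom_le_of_tendsto hr2 (fun m => ?_) ?_ (fun m => (h m).path.rect x y s hs t ht)
      tendsto_const_nhds
    · exact ((((mY m t y).sub (mY' m t y)).sub ((mY m t x).sub (mY' m t x))).sub
        (((mY m s y).sub (mY' m s y)).sub ((mY m s x).sub (mY' m s x)))).enorm.aemeasurable
    · filter_upwards [hX, hX'] with ω h1 h2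
      exact ((((h1 t y).sub (h2 t y)).sub ((h1 t x).sub (h2 t x))).sub
        (((h1 s y).sub (h2 s y)).sub ((h1 s x).sub (h2 s x)))).enorm
  · refine mom_le_of_tendsto hr (fun m => ?_) ?_ (fun m => (h m).area x y s hs t ht)
      tendsto_const_nhds
    · exact (((mYY m t x y).sub (mYY' m t x y)).sub
        ((mYY m s x y).sub (mYY' m s x y))).enorm.aemeasurable
    · filter_upwards [hXX, hXX'] with ω h1 h2
      exact (((h1 t x y).sub (h2 t x y)).sub ((h1 s x y).sub (h2 s x y))).enorm

end LiftBound

/-! ### Limits of the truncated series -/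

section Limit

variable {Ω : Type*} {n : ℕ} {B : ℤ × Fin n → ℝ≥0 → Ω → ℝ}

/-- The base point is both a limit of integration and a parameter of the integrand; expanding the
product leaves primitives and values of `trig`. -/
lemma continuous_trigCoeff (k l : ℤ) : Continuous fun q : ℝ × ℝ => trigCoeff k l q.1 q.2 := by
  have hk := continuous_trig k
  have hl := continuous_trig (-l)
  have hl' := continuous_trig l
  set g : ℝ → ℝ := fun z => trig k z * (l * trig (-l) z) with hg
  have gc : Continuous g := by fun_prop
  have prim : Continuous fun y : ℝ => ∫ z in (0 : ℝ)..y, g z :=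
    intervalIntegral.continuous_primitive (fun a b => gc.intervalIntegrable a b) 0
  have e : (fun q : ℝ × ℝ => trigCoeff k l q.1 q.2) = fun q : ℝ × ℝ =>
      ((∫ z in (0 : ℝ)..q.2, g z) - ∫ z in (0 : ℝ)..q.1, g z) -
        trig k q.1 * (trig l q.2 - trig l q.1) := by
    funext q
    have h := intervalIntegral.integral_eq_sub_of_hasDerivAt (a := q.1) (b := q.2)
      (fun z _ => hasDerivAt_trig l z) (Continuous.intervalIntegrable (by fun_prop) _ _)
    rw [intervalIntegral.integral_interval_sub_left (gc.intervalIntegrable _ _)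
      (gc.intervalIntegrable _ _), ← h, ← intervalIntegral.integral_const_mul,
      ← intervalIntegral.integral_sub (gc.intervalIntegrable _ _)
        (Continuous.intervalIntegrable (by fun_prop) _ _)]
    unfold trigCoeff
    congr 1; funext z
    rw [hg]; ring
  rw [e]
  fun_prop

lemma areaComp_add_comm (θ : Modes) (N : ℕ) (t : ℝ≥0) (x y : ℝ) (i j : Fin n) (ω : Ω) :
    areaComp B θ N t x y i j ω + areaComp B θ N t x y j i ω =
      (fieldComp B θ N t y i ω - fieldComp B θ N t x i ω) *
        (fieldComp B θ N t y j ω - fieldComp B θ N t x j ω) := by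
  have hpi : (√(2 * Real.pi))⁻¹ * (√(2 * Real.pi))⁻¹ = (2 * Real.pi)⁻¹ := by
    rw [← mul_inv, Real.mul_self_sqrt (by positivity)]
  unfold areaComp fieldComp
  have e1 : ∑ k ∈ modeRange N, ∑ l ∈ modeRange N, trigCoeff k l x y * (mode B θ t k j ω * mode B θ t l i ω) =
      ∑ k ∈ modeRange N, ∑ l ∈ modeRange N, 
        trigCoeff l k x y * (mode B θ t k i ω * mode B θ t l j ω) := by
    rw [Finset.sum_comm]
    exact Finset.sum_congr rfl fun k _ => Finset.sum_congr rfl fun l _ => by ring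
  rw [← mul_sub, ← mul_sub, mul_mul_mul_comm, hpi, ← mul_add, e1]
  simp_rw [← Finset.sum_sub_distrib, ← sub_mul, Finset.sum_mul_sum, ← Finset.sum_add_distrib,
    ← add_mul, trigCoeff_add_comm]
  congr 1
  exact Finset.sum_congr rfl fun k _ => Finset.sum_congr rfl fun l _ => by ring

lemma area_add_transp (θ : Modes) (N : ℕ) (ω : Ω) (t : ℝ≥0) (x y : Seg) :
    area B θ N ω t x y + transp (area B θ N ω t x y) =
      tensor (field B θ N ω t y - field B θ N ω t x) (field B θ N ω t y - field B θ N ω t x) := by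
  ext ij
  simp only [area, field, transp, tensor_apply, PiLp.add_apply, PiLp.sub_apply]
  exact areaComp_add_comm θ N t x y ij.1 ij.2 ω

lemma field_zero (N : ℕ) : field B Modes.zero N = 0 := by
  funext ω t x
  ext j
  simp [field, fieldComp, mode_zero]

lemma area_zero (N : ℕ) : area B Modes.zero N = 0 := by
  funext ω t x y
  ext j
  simp [area, areaComp, mode_zero]

lemma sum_modeRange_trunc {A : Type*} [AddCommMonoid A] {N M : ℕ} (h : N ≤ M) (g g' : ℤ → A)
    (hg : ∀ k : ℤ, |k| ≤ N → g' k = g k) (hg' : ∀ k : ℤ, ¬|k| ≤ N → g' k = 0) :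
    ∑ k ∈ modeRange M, g' k = ∑ k ∈ modeRange N, g k := by
  have hmem : ∀ {k : ℤ} {K : ℕ}, k ∈ modeRange K ↔ |k| ≤ K := by
    intro k K; rw [modeRange, Finset.mem_Icc, abs_le]
  rw [← Finset.sum_subset (s₁ := modeRange N) (s₂ := modeRange M) (f := g')]
  · exact Finset.sum_congr rfl fun k hk => hg k (hmem.1 hk)
  · intro k hk
    rw [hmem] at hk ⊢
    exact hk.trans (by exact_mod_cast h)
  · intro k _ hk
    rw [hmem] at hk
    exact hg' k hk

lemma mode_trunc_of_le (θ : Modes) {N : ℕ} {k : ℤ} (hk : |k| ≤ N) (t : ℝ≥0) (j : Fin n) (ω : Ω) :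
    mode B (θ.trunc N) t k j ω = mode B θ t k j ω := by
  simp [mode, Modes.trunc, hk]

lemma mode_trunc_of_not_le (θ : Modes) {N : ℕ} {k : ℤ} (hk : ¬|k| ≤ N) (t : ℝ≥0) (j : Fin n)
    (ω : Ω) : mode B (θ.trunc N) t k j ω = 0 := by
  simp [mode, Modes.trunc, hk, ou]

lemma fieldComp_trunc (θ : Modes) {N M : ℕ} (h : N ≤ M) (t : ℝ≥0) (x : ℝ) (j : Fin n) (ω : Ω) :
    fieldComp B (θ.trunc N) M t x j ω = fieldComp B θ N t x j ω := by
  unfold fieldComp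
  rw [sum_modeRange_trunc h]
  · intro k hk; rw [mode_trunc_of_le θ hk]
  · intro k hk; rw [mode_trunc_of_not_le θ hk, mul_zero]

lemma areaComp_trunc (θ : Modes) {N M : ℕ} (h : N ≤ M) (t : ℝ≥0) (x y : ℝ) (i j : Fin n) (ω : Ω) :
    areaComp B (θ.trunc N) M t x y i j ω = areaComp B θ N t x y i j ω := by
  unfold areaComp
  rw [sum_modeRange_trunc h]
  · intro k hk
    rw [sum_modeRange_trunc h]
    · intro l hl; rw [mode_trunc_of_le θ hk, mode_trunc_of_le θ hl]
    · intro l hl; rw [mode_trunc_of_not_le θ hl, mul_zero, mul_zero]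
  · intro k hk
    refine Finset.sum_eq_zero fun l _ => ?_
    rw [mode_trunc_of_not_le θ hk, zero_mul, mul_zero]

/-- Cutting the series amounts to switching off the noise in the high modes. Two truncation levels
thus become two systems at a common level, to which `exists_increment_bounds` applies. -/
lemma field_trunc (θ : Modes) {N M : ℕ} (h : N ≤ M) : field B (θ.trunc N) M = field B θ N := by
  funext ω t x
  ext j
  exact fieldComp_trunc θ h t x j ω

lemma area_trunc (θ : Modes) {N M : ℕ} (h : N ≤ M) : area B (θ.trunc N) M = area B θ N := by
  funext ω t x y
  ext ij
  exact areaComp_trunc θ h t x y ij.1 ij.2 ω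

variable [MeasurableSpace Ω] {P : Measure Ω}

lemma continuous_toLp_of {ι Q : Type*} [Fintype ι] [TopologicalSpace Q] {g : Q → ι → ℝ}
    (h : ∀ i, Continuous fun q => g q i) :
    Continuous fun q => (WithLp.toLp 2 (g q) : EuclideanSpace ℝ ι) :=
  (PiLp.continuous_toLp 2 fun _ : ι => ℝ).comp (continuous_pi h)

lemma measurable_toLp_of {ι Q : Type*} [Fintype ι] [MeasurableSpace Q] {g : Q → ι → ℝ}
    (h : ∀ i, Measurable fun q => g q i) :
    Measurable fun q => (WithLp.toLp 2 (g q) : EuclideanSpace ℝ ι) :=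
  (PiLp.continuous_toLp 2 fun _ : ι => ℝ).measurable.comp (measurable_pi_lambda _ h)

lemma mode_time_zero (hB : IsBrownianFamily P B) (θ : Modes) (k : ℤ) (j : Fin n) (ω : Ω) :
    mode B θ 0 k j ω = 0 := ou_zero _ _ (hB.zero (k, j) ω)

lemma isEnhanced_field (hB : IsBrownianFamily P B) {θ : Modes} (hθ : ∀ k, 0 ≤ θ.a k) (N : ℕ) :
    IsEnhanced (field B θ N) (area B θ N) where
  meas t x := measurable_toLp_of fun j => measurable_fieldComp hB hθ N t x j
  meas₂ t x y := measurable_toLp_of fun ij => measurable_areaComp hB hθ N t x y ij.1 ij.2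
  cont ω := by
    refine continuous_toLp_of fun j => ?_
    have h1 := fun k => continuous_ou (θ.a k) (θ.b k) (hB.cont (k, j) ω)
    have h2 := continuous_trig
    unfold fieldComp mode
    fun_prop
  cont₂ ω := by
    refine continuous_toLp_of fun ij => ?_
    have h1 := fun k j => continuous_ou (θ.a k) (θ.b k) (hB.cont (k, j) ω)
    have h2 : ∀ k l, Continuous fun q : ℝ≥0 × Seg × Seg => trigCoeff k l q.2.1 q.2.2 := fun k l =>
      (continuous_trigCoeff k l).comp
        (f := fun q : ℝ≥0 × Seg × Seg => ((q.2.1 : ℝ), (q.2.2 : ℝ))) (by fun_prop)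
    unfold areaComp mode
    refine continuous_const.mul (continuous_finsetSum _ fun k _ =>
      continuous_finsetSum _ fun l _ => (h2 k l).mul ?_)
    exact ((h1 k ij.1).comp continuous_fst).mul ((h1 l ij.2).comp continuous_fst)
  zero ω x := by
    ext j
    simp [field, fieldComp, mode_time_zero hB]
  zero₂ ω x y := by
    ext ij
    simp [area, areaComp, mode_time_zero hB]
  diag ω t x := by
    ext ij
    simp [area, areaComp, trigCoeff]
  chen ω t x y z := by
    ext ij
    simp only [area, field, tensor_apply, PiLp.sub_apply]
    exact areaComp_chen θ N t x y z ij.1 ij.2 ω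

/-- Summable bounds on `[0, T]`, for integers `T`, make the convergence uniform near every point,
hence the limit continuous. -/
lemma exists_continuous_limit {Y E : Type*} [TopologicalSpace Y] [NormedAddCommGroup E]
    [CompleteSpace E] {u : ℕ → ℝ≥0 × Y → E} (hu : ∀ m, Continuous (u m)) {b : ℕ → ℕ → ℝ≥0∞}
    (hb : ∀ T, ∑' m, b T m ≠ ⊤)
    (h : ∀ (T m : ℕ) (q : ℝ≥0 × Y), q.1 ≤ T → edist (u m q) (u (m + 1) q) ≤ b T m) :
    ∃ v : ℝ≥0 × Y → E, Continuous v ∧ ∀ q, Tendsto (fun m => u m q) atTop (𝓝 (v q)) := by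
  have hlim : ∀ q, ∃ a, Tendsto (fun m => u m q) atTop (𝓝 a) := by
    intro q
    obtain ⟨T, hT⟩ := exists_nat_ge q.1
    exact cauchySeq_tendsto_of_complete
      (cauchySeq_of_edist_le_of_tsum_ne_top (b T) (fun m => h T m q hT) (hb T))
  choose v hv using hlim
  refine ⟨v, ?_, hv⟩
  rw [continuous_iff_continuousAt]
  intro q₀
  obtain ⟨T, hT⟩ := exists_nat_gt q₀.1
  have hopen : IsOpen {q : ℝ≥0 × Y | q.1 < T} := isOpen_lt continuous_fst continuous_const
  have hunif : TendstoUniformlyOn u v atTop {q : ℝ≥0 × Y | q.1 < T} := by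
    rw [EMetric.tendstoUniformlyOn_iff]
    intro ε hε
    have htail := ENNReal.tendsto_sum_nat_add (b T) (hb T)
    filter_upwards [htail.eventually (gt_mem_nhds hε)] with m hm q hq
    rw [edist_comm]
    refine lt_of_le_of_lt ?_ hm
    have := edist_le_tsum_of_edist_le_of_tendsto (b T)
      (fun m => h T m q (le_of_lt hq)) (hv q) m
    simpa [add_comm] using this
  exact (hunif.continuousOn (Frequently.of_forall fun m => (hu m).continuousOn)).continuousAt
    (hopen.mem_nhds hT)

end Limit

end RoughHeat

namespace RoughHeat

/-! ### Existence of the limit of the truncated series -/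

section Existence

variable {n : ℕ}

lemma continuous_tensor : Continuous fun q : Vec n × Vec n => tensor q.1 q.2 := by
  unfold tensor
  exact continuous_toLp_of fun ij => by fun_prop

lemma continuous_transp : Continuous (transp : Ten n → Ten n) := by
  unfold transp
  exact continuous_toLp_of fun ij => by fun_prop

variable {Ω : Type*} [MeasurableSpace Ω] {P : Measure Ω} {B : ℤ × Fin n → ℝ≥0 → Ω → ℝ}

/-- A continuous version of the limit of the truncated series. -/
structure IsLimitLift (P : Measure Ω) (B : ℤ × Fin n → ℝ≥0 → Ω → ℝ) (θ : Modes)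
    (X : Ω → ℝ≥0 → Seg → Vec n) (XX : Ω → ℝ≥0 → Seg → Seg → Ten n) : Prop where
  enhanced : IsEnhanced X XX
  symm : ∀ ω t x y, XX ω t x y + transp (XX ω t x y) =
    tensor (X ω t y - X ω t x) (X ω t y - X ω t x)
  lim : ∀ᵐ ω ∂P, ∀ t x, Tendsto (fun m => field B θ (2 ^ m) ω t x) atTop (𝓝 (X ω t x))
  lim₂ : ∀ᵐ ω ∂P, ∀ t x y, Tendsto (fun m => area B θ (2 ^ m) ω t x y) atTop (𝓝 (XX ω t x y))

lemma tsum_dyadic_rpow_ne_top {κ : ℝ} (hκ : 0 < κ) :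
    ∑' m : ℕ, ENNReal.ofReal (1 / (((2 ^ m : ℕ) : ℝ) + 1)) ^ κ ≠ ⊤ := by
  have h : ∀ m : ℕ, ENNReal.ofReal (1 / (((2 ^ m : ℕ) : ℝ) + 1)) ^ κ ≤
      (ENNReal.ofReal (1 / 2) ^ κ) ^ m := by
    intro m
    rw [← ENNReal.rpow_natCast, ← ENNReal.rpow_mul, mul_comm κ, ENNReal.rpow_mul,
      ENNReal.rpow_natCast, ← ENNReal.ofReal_pow (by norm_num)]
    gcongr
    rw [one_div_pow]
    gcongr
    push_cast
    linarith
  refine ne_top_of_le_ne_top ?_ (ENNReal.tsum_le_tsum h)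
  rw [ENNReal.tsum_geometric]
  refine ENNReal.inv_ne_top.2 (ne_of_gt ?_)
  rw [tsub_pos_iff_lt]
  refine ENNReal.rpow_lt_one ?_ hκ
  rw [ENNReal.ofReal_lt_one]
  norm_num

/-- Between the levels `2^m` and `2^{m+1}` the distance of the systems is about `2^{-m}`. Any
exponents with `l₁ + l₂ < 1` leave a positive power of it; with `1/4` each, the means of the
majorants decay like `2^{-m/4}`. -/
lemma IsBrownianFamily.exists_summable_majorant [IsProbabilityMeasure P]
    (hB : IsBrownianFamily P B) {θ : Modes} {c M : ℝ} (hc : 0 < c) (hM : 0 ≤ M)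
    (hθ : θ.Bounded c M) (T : ℝ≥0) :
    ∃ b : ℕ → Ω → ℝ≥0∞, (∀ m, Measurable (b m)) ∧ (∀ᵐ ω ∂P, ∑' m, b m ω < ⊤) ∧ ∀ m ω, ∀ t ≤ T,
      (∀ x, edist (field B θ (2 ^ m) ω t x) (field B θ (2 ^ (m + 1)) ω t x) ≤ b m ω) ∧
      ∀ x y, edist (area B θ (2 ^ m) ω t x y) (area B θ (2 ^ (m + 1)) ω t x y) ≤ b m ω := by
  have hV := varConst_nonneg hc M T
  obtain ⟨r, hr, hmaj⟩ := exists_norm_majorant (Ω := Ω) (P := P) (n := n) (p := 1) (α₁ := 1 / 32)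
    (α₂ := 1 / 16) (l₁ := 1 / 4) (l₂ := 1 / 4) le_rfl (by norm_num) (by norm_num) (by norm_num)
    (by norm_num)
  obtain ⟨K, hK⟩ := exists_increment_bounds (Ω := Ω) (P := P) (n := n) (l₁ := 1 / 4) (l₂ := 1 / 4)
    (add_nonneg hV hV) T hr (by norm_num) (by norm_num) (by norm_num)
  obtain ⟨K', hK'⟩ := hmaj T K
  have size : ∀ N, HasLiftBound P T r (1 / 4) (1 / 4) K (field B θ N) (area B θ N) 0 0 := by
    intro N
    have := hK B hB θ Modes.zero 1 zero_le_one
      (hθ.comparable hc hV (Modes.bounded_zero hM) (hθ.close_zero hc T)) N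
    simpa [field_zero, area_zero] using this
  have diff : ∀ m : ℕ, HasLiftBound P T r (1 / 4) (1 / 4)
      (K * ENNReal.ofReal (1 / (((2 ^ m : ℕ) : ℝ) + 1)) ^ (1 / 2 * (1 - 1 / 4 - 1 / 4) : ℝ))
      (field B θ (2 ^ (m + 1))) (area B θ (2 ^ (m + 1))) (field B θ (2 ^ m))
      (area B θ (2 ^ m)) := by
    intro m
    have hle : 2 ^ m ≤ 2 ^ (m + 1) := Nat.pow_le_pow_right (by norm_num) (Nat.le_succ m)
    have := hK B hB θ (θ.trunc (2 ^ m)) (1 / (((2 ^ m : ℕ) : ℝ) + 1)) (by positivity)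
      (hθ.comparable hc hV (hθ.trunc hM _) (hθ.close_trunc hc _ T)) (2 ^ (m + 1))
    rwa [field_trunc θ hle, area_trunc θ hle] at this
  choose H mH qH pH using fun m => hK' _ _ _ _ _ (isEnhanced_field hB hθ.nonneg (2 ^ (m + 1)))
    (isEnhanced_field hB hθ.nonneg (2 ^ m)) (size _) (size _) (diff m)
  set D := ENNReal.ofReal (2 * Real.pi) ^ (2 * (1 / 16) : ℝ) with hD
  have fD : D ≠ ⊤ := by rw [hD]; finiteness
  refine ⟨fun m ω => H m ω * (1 + D), fun m => (mH m).mul_const _, ?_, fun m ω t ht =>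
    ⟨fun x => ?_, fun x y => ?_⟩⟩
  · have hsum : ∑' m, ∫⁻ ω, H m ω ∂P ≠ ⊤ := by
      have h1 : ∀ m, ∫⁻ ω, H m ω ∂P ≤ (K' * K) *
          ENNReal.ofReal (1 / (((2 ^ m : ℕ) : ℝ) + 1)) ^ (1 / 2 * (1 - 1 / 4 - 1 / 4) : ℝ) := by
        intro m
        have := qH m
        rw [← mul_assoc] at this
        simpa [mom] using this
      refine ne_top_of_le_ne_top ?_ (ENNReal.tsum_le_tsum h1)
      rw [ENNReal.tsum_mul_left]
      have := tsum_dyadic_rpow_ne_top (κ := 1 / 2 * (1 - 1 / 4 - 1 / 4)) (by norm_num)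
      finiteness
    rw [← lintegral_tsum fun m => (mH m).aemeasurable] at hsum
    filter_upwards [ae_lt_top (Measurable.tsum mH) hsum] with ω hω
    rw [ENNReal.tsum_mul_right]
    exact ENNReal.mul_lt_top hω (by finiteness)
  · rw [edist_comm, edist_eq_enorm_sub]
    refine (enorm_le_pathNorm (α := 1 / 32) (fun t => field B θ (2 ^ (m + 1)) ω t x -
      field B θ (2 ^ m) ω t x) ht).trans (((pH m ω).1.point x).trans ?_)
    exact le_mul_of_one_le_right zero_le le_self_add
  · rw [edist_comm, edist_eq_enorm_sub]
    refine (enorm_le_pathNorm (α := 1 / 32) (fun t => area B θ (2 ^ (m + 1)) ω t x y -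
      area B θ (2 ^ m) ω t x y) ht).trans (((pH m ω).2 x y).trans ?_)
    refine mul_le_mul_right (le_trans ?_ le_add_self) _
    rw [hD]
    gcongr
    exact edist_seg_le x y

theorem exists_isLimitLift [IsProbabilityMeasure P] (hB : IsBrownianFamily P B) {θ : Modes}
    {c M : ℝ} (hc : 0 < c) (hM : 0 ≤ M) (hθ : θ.Bounded c M) :
    ∃ X XX, IsLimitLift P B θ X XX := by
  classical
  choose b mb sb hb using fun T : ℕ => hB.exists_summable_majorant hc hM hθ (T : ℝ≥0)
  have hE := fun N => isEnhanced_field hB hθ.nonneg N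
  -- Off this event of full probability the processes are set to `0`, so that continuity, Chen's
  -- relation and the symmetry hold for every `ω`.
  set G : Set Ω := {ω | ∀ T, ∑' m, b T m ω < ⊤} with hG
  have mG : MeasurableSet G := by
    rw [hG, ofPred_forall]
    exact MeasurableSet.iInter fun T => measurableSet_lt (Measurable.tsum (mb T)) measurable_const
  have aG : ∀ᵐ ω ∂P, ω ∈ G := ae_all_iff.2 sb
  have hv : ∀ ω, ∃ v : ℝ≥0 × Seg → Vec n, Continuous v ∧ ∀ q,
      Tendsto (fun m => if ω ∈ G then field B θ (2 ^ m) ω q.1 q.2 else 0) atTop (𝓝 (v q)) := by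
    intro ω
    by_cases hω : ω ∈ G
    · simp only [hω, if_true]
      exact exists_continuous_limit (u := fun m q => field B θ (2 ^ m) ω q.1 q.2)
        (fun m => (hE (2 ^ m)).cont ω) (fun T => (hω T).ne) fun T m q hq => (hb T m ω q.1 hq).1 q.2
    · simp only [hω, if_false]
      exact ⟨0, continuous_const, fun q => tendsto_const_nhds⟩
  have hvv : ∀ ω, ∃ v : ℝ≥0 × Seg × Seg → Ten n, Continuous v ∧ ∀ q,
      Tendsto (fun m => if ω ∈ G then area B θ (2 ^ m) ω q.1 q.2.1 q.2.2 else 0) atTop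
        (𝓝 (v q)) := by
    intro ω
    by_cases hω : ω ∈ G
    · simp only [hω, if_true]
      refine exists_continuous_limit (E := Ten n) (Y := Seg × Seg)
        (u := fun m q => area B θ (2 ^ m) ω q.1 q.2.1 q.2.2) (b := fun T m => b T m ω)
        (fun m => (hE (2 ^ m)).cont₂ ω) (fun T => (hω T).ne) fun T m q hq => ?_
      exact (hb T m ω q.1 hq).2 q.2.1 q.2.2
    · simp only [hω, if_false]
      exact ⟨0, continuous_const, fun q => tendsto_const_nhds⟩
  choose v vc vl using hv
  choose vv vvc vvl using hvv
  have lim : ∀ ω t x, Tendsto (fun m => if ω ∈ G then field B θ (2 ^ m) ω t x else 0) atTop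
      (𝓝 (v ω (t, x))) := fun ω t x => vl ω (t, x)
  have lim₂ : ∀ ω t x y, Tendsto (fun m => if ω ∈ G then area B θ (2 ^ m) ω t x y else 0) atTop
      (𝓝 (vv ω (t, x, y))) := fun ω t x y => vvl ω (t, x, y)
  have tz : tensor (0 : Vec n) 0 = 0 := by ext i; simp [tensor_apply]
  have trz : transp (0 : Ten n) = 0 := by ext i; simp [transp]
  refine ⟨fun ω t x => v ω (t, x), fun ω t x y => vv ω (t, x, y), ⟨?_, ?_, ?_, ?_, ?_, ?_, ?_, ?_⟩,
    ?_, ?_, ?_⟩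
  · intro t x
    exact measurable_of_tendsto_metrizable
      (fun m => Measurable.ite mG ((hE (2 ^ m)).meas t x) measurable_const)
      (tendsto_pi_nhds.2 fun ω => lim ω t x)
  · intro t x y
    exact measurable_of_tendsto_metrizable
      (fun m => Measurable.ite mG ((hE (2 ^ m)).meas₂ t x y) measurable_const)
      (tendsto_pi_nhds.2 fun ω => lim₂ ω t x y)
  · exact fun ω => vc ω
  · exact fun ω => vvc ω
  · intro ω x
    refine tendsto_nhds_unique (lim ω 0 x) ?_
    simp only [(hE _).zero, ite_self]
    exact tendsto_const_nhds
  · intro ω x y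
    refine tendsto_nhds_unique (lim₂ ω 0 x y) ?_
    simp only [(hE _).zero₂, ite_self]
    exact tendsto_const_nhds
  · intro ω t x
    refine tendsto_nhds_unique (lim₂ ω t x x) ?_
    simp only [(hE _).diag, ite_self]
    exact tendsto_const_nhds
  · intro ω t x y z
    refine tendsto_nhds_unique (((lim₂ ω t x z).sub (lim₂ ω t x y)).sub (lim₂ ω t y z)) ?_
    have h := (continuous_tensor.tendsto (v ω (t, y) - v ω (t, x), v ω (t, z) - v ω (t, y))).comp
      (((lim ω t y).sub (lim ω t x)).prodMk_nhds ((lim ω t z).sub (lim ω t y)))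
    refine h.congr fun m => ?_
    by_cases hω : ω ∈ G
    · simp only [Function.comp, hω, if_true, (hE _).chen]
    · simp only [Function.comp, hω, if_false, sub_self, tz]
  · intro ω t x y
    refine tendsto_nhds_unique ((lim₂ ω t x y).add
      ((continuous_transp.tendsto _).comp (lim₂ ω t x y))) ?_
    have h := (continuous_tensor.tendsto (v ω (t, y) - v ω (t, x), v ω (t, y) - v ω (t, x))).comp
      (((lim ω t y).sub (lim ω t x)).prodMk_nhds ((lim ω t y).sub (lim ω t x)))
    refine h.congr fun m => ?_
    by_cases hω : ω ∈ G
    · simp only [Function.comp, hω, if_true, area_add_transp]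
    · simp only [Function.comp, hω, if_false, sub_self, tz, trz, add_zero]
  · filter_upwards [aG] with ω hω t x
    simpa [hω] using lim ω t x
  · filter_upwards [aG] with ω hω t x y
    simpa [hω] using lim₂ ω t x y

/-- The norms of the difference of the limits of two truncated series. -/
theorem exists_limit_norm_majorant [IsProbabilityMeasure P] {p α₁ α₂ l₁ l₂ : ℝ} (hp : 1 ≤ p)
    (hα₁ : 0 < α₁) (hα₂ : 0 < α₂) (h₁ : α₁ < l₁ / 4) (h₂ : α₂ < l₂ / 2) (hl : l₁ + l₂ ≤ 1)
    (hB : IsBrownianFamily P B) {c M C : ℝ} (hc : 0 < c) (hM : 0 ≤ M) (hC : 0 ≤ C) (T : ℝ≥0) :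
    ∃ K : ℝ≥0, ∀ (θ θ' : Modes) (η : ℝ) (X X' : Ω → ℝ≥0 → Seg → Vec n)
      (XX XX' : Ω → ℝ≥0 → Seg → Seg → Ten n), θ.Bounded c M → θ'.Bounded c M → 0 ≤ η →
      θ.Close θ' C η T → IsLimitLift P B θ X XX → IsLimitLift P B θ' X' XX' →
      ∃ H : Ω → ℝ≥0∞, Measurable H ∧
        mom P p H ≤ K * ENNReal.ofReal η ^ (1 / 2 * (1 - l₁ - l₂)) ∧ ∀ ω,
        HasPathBound T α₁ α₂ (fun t x => X ω t x - X' ω t x) (H ω) ∧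
        ∀ x y, pathNorm α₁ T (fun t => XX ω t x y - XX' ω t x y) ≤
          H ω * edist x y ^ (2 * α₂) := by
  have hV := varConst_nonneg hc M T
  have hl₁ : 0 ≤ l₁ := by linarith
  have hl₂ : 0 ≤ l₂ := by linarith
  obtain ⟨r, hr, hmaj⟩ := exists_norm_majorant (Ω := Ω) (P := P) (n := n) hp hα₁ hα₂ h₁ h₂
  obtain ⟨K₁, hK₁⟩ := exists_increment_bounds (Ω := Ω) (P := P) (n := n)
    (add_nonneg hV hV) T hr hl₁ hl₂ hl
  obtain ⟨K₂, hK₂⟩ := exists_increment_bounds (Ω := Ω) (P := P) (n := n)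
    (add_nonneg hV hC) T hr hl₁ hl₂ hl
  obtain ⟨K', hK'⟩ := hmaj T K₁
  refine ⟨K' * K₂, fun θ θ' η X X' XX XX' hθ hθ' hη hcl hX hX' => ?_⟩
  have hr0 : 0 < r := by linarith
  have mf := fun {θ : Modes} (hθ : θ.Bounded c M) m => isEnhanced_field hB hθ.nonneg (2 ^ m)
  have size : ∀ {θ : Modes} {X : Ω → ℝ≥0 → Seg → Vec n} {XX : Ω → ℝ≥0 → Seg → Seg → Ten n},
      θ.Bounded c M → IsLimitLift P B θ X XX → HasLiftBound P T r l₁ l₂ K₁ X XX 0 0 := by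
    intro θ X XX hθ hX
    have h := fun m : ℕ => hK₁ B hB θ Modes.zero 1 zero_le_one
      (hθ.comparable hc hV (Modes.bounded_zero hM) (hθ.close_zero hc T)) (2 ^ m)
    simp only [field_zero, area_zero, ENNReal.ofReal_one, ENNReal.one_rpow, mul_one] at h
    exact HasLiftBound.of_tendsto hr0 (Y' := fun _ => 0) (YY' := fun _ => 0)
      (fun m => (mf hθ m).meas) (fun m t x => measurable_const) (fun m => (mf hθ m).meas₂)
      (fun m t x y => measurable_const) hX.lim
      (Eventually.of_forall fun ω t x => tendsto_const_nhds) hX.lim₂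
      (Eventually.of_forall fun ω t x y => tendsto_const_nhds) h
  -- The moment bounds are uniform in the truncation level and pass to the limit; the Kolmogorov
  -- criterion is applied afterwards, to the limit itself.
  have diff := HasLiftBound.of_tendsto hr0 (fun m => (mf hθ m).meas) (fun m => (mf hθ' m).meas)
      (fun m => (mf hθ m).meas₂) (fun m => (mf hθ' m).meas₂) hX.lim hX'.lim hX.lim₂ hX'.lim₂
      (fun m => hK₂ B hB θ θ' η hη (hθ.comparable hc hC hθ' hcl) (2 ^ m))
  obtain ⟨H, mH, qH, pH⟩ := hK' X X' XX XX' _ hX.enhanced hX'.enhanced (size hθ hX) (size hθ' hX')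
    diff
  refine ⟨H, mH, qH.trans (le_of_eq ?_), pH⟩
  push_cast
  ring

end Existence

end RoughHeat

namespace RoughHeat

/-! ### Convergence of the truncated series in mean square -/

section MeanSquare

variable {Ω : Type*} [MeasurableSpace Ω] {P : Measure Ω} {n : ℕ}
  {B : ℤ × Fin n → ℝ≥0 → Ω → ℝ}

lemma tendsto_rpow_trunc {A : ℝ≥0∞} (hA : A ≠ ⊤) :
    Tendsto (fun N : ℕ => A * ENNReal.ofReal (1 / ((N : ℝ) + 1)) ^ (1 / 2 : ℝ)) atTop (𝓝 0) := by
  have h1 : Tendsto (fun N : ℕ => ENNReal.ofReal (1 / ((N : ℝ) + 1))) atTop (𝓝 0) := by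
    rw [← ENNReal.ofReal_zero]
    exact ENNReal.tendsto_ofReal tendsto_one_div_add_atTop_nhds_zero_nat
  have h2 := (ENNReal.continuous_rpow_const (y := (1 / 2 : ℝ))).tendsto 0 |>.comp h1
  rw [ENNReal.zero_rpow_of_pos (by norm_num)] at h2
  simpa using ENNReal.Tendsto.const_mul h2 (Or.inr hA)

lemma le_two_pow_add (N m : ℕ) : N ≤ 2 ^ (m + N) :=
  Nat.lt_two_pow_self.le.trans (Nat.pow_le_pow_right (by norm_num) (Nat.le_add_left N m))

/-- A family whose truncations are close to the limit of a dyadic subsequence converges. -/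
lemma tendsto_mom_of_trunc {u : ℕ → Ω → ℝ} {v : Ω → ℝ} (hu : ∀ N, Measurable (u N))
    (hlim : ∀ᵐ ω ∂P, Tendsto (fun m => u (2 ^ m) ω) atTop (𝓝 (v ω))) {A : ℝ≥0∞} (hA : A ≠ ⊤)
    (h : ∀ N M, N ≤ M → mom P 2 (fun ω => ‖u M ω - u N ω‖ₑ) ≤
      A * ENNReal.ofReal (1 / ((N : ℝ) + 1)) ^ (1 / 2 : ℝ)) :
    Tendsto (fun N => mom P 2 fun ω => ‖u N ω - v ω‖ₑ) atTop (𝓝 0) := by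
  refine tendsto_of_tendsto_of_tendsto_of_le_of_le tendsto_const_nhds (tendsto_rpow_trunc hA)
    (fun _ => zero_le) fun N => ?_
  -- Pointwise convergence is known only along `2^m`. Comparing `u N` with later dyadic terms and
  -- applying Fatou's lemma gives a rate for every `N`.
  refine mom_le_of_tendsto (by norm_num) (f := fun m ω => ‖u N ω - u (2 ^ (m + N)) ω‖ₑ)
    (fun m => ((hu _).sub (hu _)).enorm.aemeasurable) ?_ (fun m => ?_) tendsto_const_nhds
  · filter_upwards [hlim] with ω hω
    exact (tendsto_const_nhds.sub (hω.comp (tendsto_add_atTop_nat N))).enorm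
  · refine le_trans (le_of_eq ?_) (h N _ (le_two_pow_add N m))
    congr 1; funext ω
    rw [← enorm_neg, neg_sub]

variable [IsProbabilityMeasure P]

lemma IsLimitLift.tendsto_fieldComp {X : Ω → ℝ≥0 → Seg → Vec n}
    {XX : Ω → ℝ≥0 → Seg → Seg → Ten n} (hB : IsBrownianFamily P B) {θ : Modes} {c M : ℝ}
    (hc : 0 < c) (hM : 0 ≤ M) (hθ : θ.Bounded c M) (hX : IsLimitLift P B θ X XX) (t : ℝ≥0)
    (x : Seg) (j : Fin n) :
    Tendsto (fun N => mom P 2 fun ω => ‖fieldComp B θ N t x j ω - X ω t x j‖ₑ) atTop (𝓝 0) := by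
  have hV := varConst_nonneg hc M t
  refine tendsto_mom_of_trunc (fun N => measurable_fieldComp hB hθ.nonneg N t x j) ?_
    (A := gaussMom 2 * ENNReal.ofReal (72 * varConst c M t) ^ (1 / 2 : ℝ)) ?_ fun N N' h => ?_
  · filter_upwards [hX.lim] with ω hω
    exact ((PiLp.continuous_apply 2 _ j).tendsto _).comp (hω t x)
  · have := gaussMom_ne_top (r := 2) (by norm_num)
    finiteness
  · simp_rw [← fieldComp_trunc (B := B) θ h]
    exact mom_fieldComp_sub_le hB hθ.nonneg (hθ.trunc hM N).nonneg
      (fun k => hθ.close_trunc hc N t k t le_rfl) hV (by positivity) N' x j (by norm_num)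

lemma IsLimitLift.tendsto_areaComp {X : Ω → ℝ≥0 → Seg → Vec n}
    {XX : Ω → ℝ≥0 → Seg → Seg → Ten n} (hB : IsBrownianFamily P B) {θ : Modes} {c M : ℝ}
    (hc : 0 < c) (hM : 0 ≤ M) (hθ : θ.Bounded c M) (hX : IsLimitLift P B θ X XX) (t : ℝ≥0)
    (x y : Seg) (i j : Fin n) :
    Tendsto (fun N => mom P 2 fun ω => ‖areaComp B θ N t x y i j ω - XX ω t x y (i, j)‖ₑ) atTop
      (𝓝 0) := by
  have hV := varConst_nonneg hc M t
  have g2 := gaussMom_ne_top (r := 2) (by norm_num)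
  have g4 := gaussMom_ne_top (r := 2 * 2) (by norm_num)
  set D := edist x y ^ (1 / 2 : ℝ) with hD
  have fD : D ≠ ⊤ := by
    have := edist_ne_top x y
    finiteness
  set A₁ := 2 * gaussMom 2 ^ 2 * ENNReal.ofReal (varConst c M t ^ 2 * areaConst) ^ (1 / 2 : ℝ)
  set A₂ := 2 * (gaussMom (2 * 2) * ENNReal.ofReal (72 * varConst c M t) ^ (1 / 2 : ℝ)) ^ 2
  have f₁ : A₁ ≠ ⊤ := by finiteness
  have f₂ : A₂ ≠ ⊤ := by finiteness
  refine tendsto_mom_of_trunc (fun N => measurable_areaComp hB hθ.nonneg N t x y i j) ?_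
    (A := (A₁ + A₂) * D) (by finiteness) fun N N' h => ?_
  · filter_upwards [hX.lim₂] with ω hω
    exact ((PiLp.continuous_apply 2 _ (i, j)).tendsto _).comp (hω t x y)
  · simp_rw [← areaComp_trunc (B := B) θ h]
    have hd : ModeDist θ t (θ.trunc N) t (varConst c M t) (1 / ((N : ℝ) + 1)) :=
      fun k => hθ.close_trunc hc N t k t le_rfl
    have h0 : ModeDist θ t Modes.zero t (varConst c M t) 1 :=
      fun k => hθ.close_zero hc t k t le_rfl
    have h0' : ModeDist (θ.trunc N) t Modes.zero t (varConst c M t) 1 :=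
      fun k => (hθ.trunc hM N).close_zero hc t k t le_rfl
    set m : ℝ := 1 / ((N : ℝ) + 1)
    have hm : 0 ≤ m := by positivity
    have hle : edist (x : ℝ) y ^ (1 / 2 : ℝ) *
        min (ENNReal.ofReal m) (edist (x : ℝ) y) ^ (1 / 2 : ℝ) ≤
        D * ENNReal.ofReal m ^ (1 / 2 : ℝ) := by
      refine mul_le_mul' (le_of_eq rfl) ?_
      gcongr
      exact min_le_left _ _
    rw [mul_assoc]
    by_cases hij : i = j
    · subst hij
      exact (mom_areaComp_sub_le_diag hB i hθ.nonneg (hθ.trunc hM N).nonneg hd h0 h0' hV hm N' x y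
        le_rfl).trans (mul_le_mul' le_add_self hle)
    · exact (mom_areaComp_sub_le_offDiag hB hij hθ.nonneg (hθ.trunc hM N).nonneg hd h0 h0' hV hm N'
        x.2 y.2 le_rfl).trans (mul_le_mul' le_self_add hle)

end MeanSquare

/-! ### The noise -/

section NoiseModes

variable {Ω : Type*} [MeasurableSpace Ω] {P : Measure Ω} {n : ℕ}
  {w : ℤ → Fin n → ℝ≥0 → Ω → ℂ}

lemma IsFourierNoise.measurable_realMode (hw : IsFourierNoise P w) (i : ℤ × Fin n) (t : ℝ≥0) :
    Measurable (realMode w i t) := by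
  unfold realMode
  split_ifs
  · exact Complex.measurable_re.comp (hw.meas _ _ _)
  · exact (Complex.measurable_re.comp (hw.meas _ _ _)).const_mul _
  · exact (Complex.measurable_im.comp (hw.meas _ _ _)).const_mul _

/-- The real modes of the noise have versions with continuous paths which start at `0`. -/
lemma IsFourierNoise.exists_isBrownianFamily (hw : IsFourierNoise P w) :
    ∃ B : ℤ × Fin n → ℝ≥0 → Ω → ℝ, IsBrownianFamily P B ∧
      ∀ᵐ ω ∂P, ∀ i t, B i t ω = realMode w i t ω := by
  classical
  have hgood : ∀ i, ∀ᵐ ω ∂P, Continuous (fun t => realMode w i t ω) ∧ realMode w i 0 ω = 0 :=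
    fun i => (hw.brownian i).cont.and (hw.brownian i).toIsPreBrownianReal.eval_zero_ae_eq_zero
  -- For each index the paths are replaced by `0` off a measurable event of full probability; laws
  -- and independence are unaffected.
  choose G aG mG hG using fun i => (hgood i).exists_measurable_mem
  set B : ℤ × Fin n → ℝ≥0 → Ω → ℝ := fun i t ω => if ω ∈ G i then realMode w i t ω else 0 with hB
  have ae : ∀ i, ∀ᵐ ω ∂P, ∀ t, B i t ω = realMode w i t ω := fun i => by
    filter_upwards [aG i] with ω hω t
    simp [hB, hω]
  refine ⟨B, ⟨fun i t => ?_, fun i ω => ?_, fun i ω => ?_, fun i => ?_, ?_⟩, ae_all_iff.2 ae⟩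
  · exact Measurable.ite (mG i) (hw.measurable_realMode i t) measurable_const
  · by_cases hω : ω ∈ G i
    · simp only [hB, hω, if_true]; exact (hG i ω hω).1
    · simp only [hB, hω, if_false]; exact continuous_const
  · by_cases hω : ω ∈ G i
    · simp only [hB, hω, if_true]; exact (hG i ω hω).2
    · simp only [hB, hω, if_false]
  · refine (hw.brownian i).toIsPreBrownianReal.congr fun t => ?_
    filter_upwards [ae i] with ω hω
    exact (hω t).symm
  · refine hw.indep.congr fun i => ?_
    filter_upwards [ae i] with ω hω
    funext t
    exact (hω t).symm

/-- The complex Fourier coefficients of a trigonometric series. -/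
noncomputable def fourierCoef (u : ℤ → ℝ) (k : ℤ) : ℂ :=
  if k = 0 then (u 0 : ℂ)
  else if 0 < k then ((√2)⁻¹ : ℝ) * (u k + Complex.I * u (-k))
  else ((√2)⁻¹ : ℝ) * (u (-k) - Complex.I * u k)

lemma inv_sqrt_two_mul : ((√2)⁻¹ : ℝ) * 2 = √2 := by
  rw [inv_mul_eq_div, div_eq_iff (by positivity), Real.mul_self_sqrt zero_le_two]

lemma exp_I_mul (k : ℤ) (x : ℝ) : Complex.exp (Complex.I * k * x) =
    (Real.cos (k * x) : ℂ) + (Real.sin (k * x) : ℂ) * Complex.I := by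
  rw [mul_assoc, mul_comm Complex.I, Complex.exp_mul_I]
  push_cast
  rfl

/-- The terms `k` and `-k` are conjugate: `(e^{ikx} (u + iv) + e^{-ikx} (u - iv)) / √2 = √2 (u cos
kx - v sin kx)`, and the sign is that of `sin (-kx)` in `trig (-k)`. -/
lemma sum_exp_fourierCoef (u : ℤ → ℝ) (N : ℕ) (x : ℝ) :
    ∑ k ∈ modeRange N, Complex.exp (Complex.I * k * x) * fourierCoef u k =
      ((∑ k ∈ modeRange N, trig k x * u k : ℝ) : ℂ) := by
  induction N with
  | zero => simp [modeRange, fourierCoef, trig]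
  | succ N ih =>
    rw [sum_modeRange_succ, sum_modeRange_succ, ih]
    set k : ℤ := (N : ℤ) + 1 with hk
    have kpos : 0 < k := by omega
    have e : Complex.exp (Complex.I * k * x) * fourierCoef u k +
        Complex.exp (Complex.I * (-k : ℤ) * x) * fourierCoef u (-k) =
        ((trig k x * u k + trig (-k) x * u (-k) : ℝ) : ℂ) := by
      rw [exp_I_mul, exp_I_mul]
      have h2 : ((√2 : ℝ) : ℂ)⁻¹ * 2 = ((√2 : ℝ) : ℂ) := by exact_mod_cast inv_sqrt_two_mul
      simp only [fourierCoef, trig, kpos.ne', kpos, if_true, if_false, neg_eq_zero, neg_neg,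
        Int.neg_pos, not_lt.2 kpos.le]
      push_cast
      simp only [neg_mul, Complex.cos_neg, Complex.sin_neg]
      linear_combination (Complex.cos (k * x) * u k - Complex.sin (k * x) * u (-k)) * h2 +
        (2 * ((√2 : ℝ) : ℂ)⁻¹ * Complex.sin (k * x) * u (-k)) * Complex.I_sq
    rw [← add_assoc, e]
    push_cast
    ring

/-- The derivative in `x` of `sum_exp_fourierCoef`, checked again on the pairs `±k`. -/
lemma sum_deriv_fourierCoef (u : ℤ → ℝ) (N : ℕ) (x : ℝ) :
    ∑ k ∈ modeRange N, (Complex.I * k * Complex.exp (Complex.I * k * x)) * fourierCoef u k =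
      ((∑ k ∈ modeRange N, (k * trig (-k) x) * u k : ℝ) : ℂ) := by
  induction N with
  | zero => simp [modeRange]
  | succ N ih =>
    rw [sum_modeRange_succ, sum_modeRange_succ, ih]
    set k : ℤ := (N : ℤ) + 1 with hk
    have kpos : 0 < k := by omega
    have e : (Complex.I * k * Complex.exp (Complex.I * k * x)) * fourierCoef u k +
        (Complex.I * (-k : ℤ) * Complex.exp (Complex.I * (-k : ℤ) * x)) * fourierCoef u (-k) =
        (((k * trig (-k) x) * u k + ((-k : ℤ) * trig (-(-k)) x) * u (-k) : ℝ) : ℂ) := by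
      rw [exp_I_mul, exp_I_mul]
      have h2 : ((√2 : ℝ) : ℂ)⁻¹ * 2 = ((√2 : ℝ) : ℂ) := by exact_mod_cast inv_sqrt_two_mul
      simp only [fourierCoef, trig, kpos.ne', kpos, if_true, if_false, neg_eq_zero, neg_neg,
        Int.neg_pos, not_lt.2 kpos.le]
      push_cast
      simp only [neg_mul, Complex.cos_neg, Complex.sin_neg]
      linear_combination (2 * ((√2 : ℝ) : ℂ)⁻¹ * k * (Complex.sin (k * x) * u k +
        Complex.cos (k * x) * u (-k))) * Complex.I_sq - (k * (Complex.sin (k * x) * u k +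
        Complex.cos (k * x) * u (-k))) * h2
    rw [← add_assoc, e]
    push_cast
    ring

end NoiseModes

end RoughHeat

namespace RoughHeat

/-! ### The complex Fourier series -/

section ComplexSeries

/-- With the finite sums under the integral, the integrand is an increment of one series times the
derivative of another, and both factors are real. -/
lemma sum_sum_integral_fourierCoef (u v : ℤ → ℝ) (N : ℕ) (x y : ℝ) :
    ∑ k ∈ modeRange N, ∑ l ∈ modeRange N, fourierCoef u k * fourierCoef v l *
      ∫ z in x..y, (Complex.exp (Complex.I * k * z) - Complex.exp (Complex.I * k * x)) *
        (Complex.I * l * Complex.exp (Complex.I * l * z)) =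
      ((∑ k ∈ modeRange N, ∑ l ∈ modeRange N, trigCoeff k l x y * (u k * v l) : ℝ) : ℂ) := by
  have h1 : ∀ z : ℝ, ∑ k ∈ modeRange N, ∑ l ∈ modeRange N, fourierCoef u k * fourierCoef v l *
      ((Complex.exp (Complex.I * k * z) - Complex.exp (Complex.I * k * x)) *
        (Complex.I * l * Complex.exp (Complex.I * l * z))) =
      ((∑ k ∈ modeRange N, ∑ l ∈ modeRange N, (u k * v l) *
        ((trig k z - trig k x) * (l * trig (-l) z)) : ℝ) : ℂ) := by
    intro z
    have a1 := sum_exp_fourierCoef u N z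
    have a2 := sum_exp_fourierCoef u N x
    have a3 := sum_deriv_fourierCoef v N z
    have e1 : ∑ k ∈ modeRange N, ∑ l ∈ modeRange N, fourierCoef u k * fourierCoef v l *
        ((Complex.exp (Complex.I * k * z) - Complex.exp (Complex.I * k * x)) *
          (Complex.I * l * Complex.exp (Complex.I * l * z))) =
        (∑ k ∈ modeRange N, Complex.exp (Complex.I * k * z) * fourierCoef u k -
          ∑ k ∈ modeRange N, Complex.exp (Complex.I * k * x) * fourierCoef u k) *
        ∑ l ∈ modeRange N, (Complex.I * l * Complex.exp (Complex.I * l * z)) *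
          fourierCoef v l := by
      rw [← Finset.sum_sub_distrib, Finset.sum_mul_sum]
      exact Finset.sum_congr rfl fun k _ => Finset.sum_congr rfl fun l _ => by ring
    have e2 : ∑ k ∈ modeRange N, ∑ l ∈ modeRange N, (u k * v l) *
        ((trig k z - trig k x) * (l * trig (-l) z)) =
        (∑ k ∈ modeRange N, trig k z * u k - ∑ k ∈ modeRange N, trig k x * u k) *
        ∑ l ∈ modeRange N, (l * trig (-l) z) * v l := by
      rw [← Finset.sum_sub_distrib, Finset.sum_mul_sum]
      exact Finset.sum_congr rfl fun k _ => Finset.sum_congr rfl fun l _ => by ring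
    rw [e1, e2, a1, a2, a3]
    push_cast
    ring
  have h2 : ∀ k l : ℤ, IntervalIntegrable (fun z : ℝ => fourierCoef u k * fourierCoef v l *
      ((Complex.exp (Complex.I * k * z) - Complex.exp (Complex.I * k * x)) *
        (Complex.I * l * Complex.exp (Complex.I * l * z)))) volume x y := fun k l =>
    Continuous.intervalIntegrable (by fun_prop) _ _
  have h3 : ∀ k l : ℤ, IntervalIntegrable (fun z : ℝ => (u k * v l) *
      ((trig k z - trig k x) * (l * trig (-l) z))) volume x y := fun k l => by
    have hk := continuous_trig k
    have hl := continuous_trig (-l)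
    exact Continuous.intervalIntegrable (by fun_prop) _ _
  have h4 : ∑ k ∈ modeRange N, ∑ l ∈ modeRange N, trigCoeff k l x y * (u k * v l) =
      ∫ z in x..y, ∑ k ∈ modeRange N, ∑ l ∈ modeRange N, (u k * v l) *
        ((trig k z - trig k x) * (l * trig (-l) z)) := by
    rw [intervalIntegral.integral_finsetSum]
    · refine Finset.sum_congr rfl fun k _ => ?_
      rw [intervalIntegral.integral_finsetSum fun l _ => h3 k l]
      refine Finset.sum_congr rfl fun l _ => ?_
      rw [intervalIntegral.integral_const_mul, trigCoeff, mul_comm]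
    · intro k _
      have := IntervalIntegrable.sum (modeRange N) (fun l _ => h3 k l)
      simpa [Finset.sum_fn] using this
  rw [h4, ← intervalIntegral.integral_ofReal]
  simp_rw [← h1]
  rw [intervalIntegral.integral_finsetSum]
  · refine Finset.sum_congr rfl fun k _ => ?_
    rw [intervalIntegral.integral_finsetSum fun l _ => h2 k l]
    refine Finset.sum_congr rfl fun l _ => ?_
    rw [intervalIntegral.integral_const_mul]
  · intro k _
    have := IntervalIntegrable.sum (modeRange N) (fun l _ => h2 k l)
    simpa [Finset.sum_fn] using this

lemma fourierCoef_congr {u v : ℤ → ℝ} {k : ℤ} (h : u k = v k) (h' : u (-k) = v (-k)) :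
    fourierCoef u k = fourierCoef v k := by
  unfold fourierCoef
  split_ifs with h0
  · subst h0; rw [h]
  · rw [h, h']
  · rw [h, h']

lemma fourierCoef_add (u v : ℤ → ℝ) (k : ℤ) :
    fourierCoef (fun k => u k + v k) k = fourierCoef u k + fourierCoef v k := by
  unfold fourierCoef
  split_ifs <;> push_cast <;> ring

lemma fourierCoef_sub (u v : ℤ → ℝ) (k : ℤ) :
    fourierCoef (fun k => u k - v k) k = fourierCoef u k - fourierCoef v k := by
  unfold fourierCoef
  split_ifs <;> push_cast <;> ring

lemma fourierCoef_const_mul (a : ℝ) (u : ℤ → ℝ) (k : ℤ) :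
    fourierCoef (fun k => a * u k) k = a * fourierCoef u k := by
  unfold fourierCoef
  split_ifs <;> push_cast <;> ring

lemma fourierCoef_sum {ι : Type*} (s : Finset ι) (u : ι → ℤ → ℝ) (k : ℤ) :
    fourierCoef (fun k => ∑ i ∈ s, u i k) k = ∑ i ∈ s, fourierCoef (u i) k := by
  classical
  induction s using Finset.induction_on with
  | empty => simp [fourierCoef]
  | insert a s ha ih => simp_rw [Finset.sum_insert ha, fourierCoef_add, ih]

lemma enorm_fourierCoef_le (u : ℤ → ℝ) (k : ℤ) :
    ‖fourierCoef u k‖ₑ ≤ ‖u k‖ₑ + ‖u (-k)‖ₑ := by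
  have h2 : ‖(((√2)⁻¹ : ℝ) : ℂ)‖ₑ ≤ 1 := by
    rw [← ofReal_norm, ENNReal.ofReal_le_one, Complex.norm_real, Real.norm_eq_abs,
      abs_of_pos (by positivity)]
    exact inv_le_one_of_one_le₀ (Real.one_le_sqrt.2 one_le_two)
  have hr : ∀ a : ℝ, ‖(a : ℂ)‖ₑ = ‖a‖ₑ := fun a => by
    rw [← ofReal_norm, ← ofReal_norm, Complex.norm_real]
  have hI : ∀ a : ℝ, ‖Complex.I * a‖ₑ = ‖a‖ₑ := fun a => by
    rw [← ofReal_norm, ← ofReal_norm, norm_mul, Complex.norm_I, one_mul, Complex.norm_real]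
  unfold fourierCoef
  split_ifs with h0
  · subst h0
    rw [hr]
    exact le_self_add
  · rw [enorm_mul, ← hr (u k), ← hI (u (-k))]
    calc _ ≤ 1 * (‖(u k : ℂ)‖ₑ + ‖Complex.I * u (-k)‖ₑ) := by
          gcongr
          exact enorm_add_le _ _
      _ = _ := one_mul _
  · rw [enorm_mul, ← hr (u (-k)), ← hI (u k), add_comm]
    calc _ ≤ 1 * (‖(u (-k) : ℂ)‖ₑ + ‖Complex.I * u k‖ₑ) := by
          gcongr
          exact enorm_sub_le
      _ = _ := one_mul _

end ComplexSeries

/-! ### The Fourier modes of the solution -/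

section ModeFamily

variable {Ω : Type*} [MeasurableSpace Ω] {P : Measure Ω} {n : ℕ}
  {w : ℤ → Fin n → ℝ≥0 → Ω → ℂ} {B : ℤ × Fin n → ℝ≥0 → Ω → ℝ} {f : ℝ → ℝ≥0∞} {h : ℝ → ℝ}

lemma eLpNorm_two_eq_mom {E : Type*} [NormedAddCommGroup E] (g : Ω → E) :
    eLpNorm g 2 P = mom P 2 fun ω => ‖g ω‖ₑ := by
  rw [eLpNorm_eq_lintegral_rpow_enorm_toReal (by norm_num) (by norm_num), mom]
  simp

lemma ae_eq_of_tendsto_eLpNorm {E : Type*} [NormedAddCommGroup E] {S : ℕ → Ω → E} {I I' : Ω → E}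
    (hS : ∀ m, AEStronglyMeasurable (S m) P) (hI : AEStronglyMeasurable I P)
    (hI' : AEStronglyMeasurable I' P)
    (h1 : Tendsto (fun m => eLpNorm (fun ω => S m ω - I ω) 2 P) atTop (𝓝 0))
    (h2 : Tendsto (fun m => eLpNorm (fun ω => S m ω - I' ω) 2 P) atTop (𝓝 0)) : I =ᵐ[P] I' := by
  have h : eLpNorm (fun ω => I ω - I' ω) 2 P ≤ 0 := by
    have h3 := h2.add h1
    rw [add_zero] at h3
    refine ge_of_tendsto' h3 fun m => ?_
    have e : (fun ω => I ω - I' ω) = (fun ω => S m ω - I' ω) - fun ω => S m ω - I ω := by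
      funext ω; simp
    rw [e]
    exact eLpNorm_sub_le ((hS m).sub hI') ((hS m).sub hI) (by norm_num)
  rw [nonpos_iff_eq_zero] at h
  filter_upwards [(eLpNorm_eq_zero_iff (hI.sub hI') two_ne_zero).1 h] with ω hω
  exact sub_eq_zero.1 hω

lemma IsFourierNoise.ae_eq_fourierCoef (hw : IsFourierNoise P w)
    (hBw : ∀ᵐ ω ∂P, ∀ i t, B i t ω = realMode w i t ω) (k : ℤ) (j : Fin n) (t : ℝ≥0) :
    ∀ᵐ ω ∂P, w k j t ω = fourierCoef (fun k => B (k, j) t ω) k := by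
  have hs : √2 / 2 * √2 = 1 := by
    rw [div_mul_eq_mul_div, Real.mul_self_sqrt zero_le_two, div_self two_ne_zero]
  filter_upwards [hBw, hw.conj_symm (-k) j t] with ω h1 h2
  simp_rw [h1]
  rw [neg_neg] at h2
  rcases lt_trichotomy k 0 with hk | rfl | hk
  · have hk' : 0 < -k := by omega
    simp only [fourierCoef, realMode, hk.ne, hk.not_gt, hk', hk'.ne', if_false, if_true]
    rw [h2]
    apply Complex.ext
    · simp [← mul_assoc, hs]
    · simp [← mul_assoc, hs]
  · simp only [fourierCoef, realMode, if_true]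
    apply Complex.ext
    · simp
    · have := congrArg Complex.im h2
      simp only [neg_zero, Complex.conj_im] at this
      rw [Complex.ofReal_im]
      linarith
  · have hk' : ¬0 < -k := by omega
    have hk'' : -k ≠ 0 := by omega
    simp only [fourierCoef, realMode, hk.ne', hk, hk', hk'', if_false, if_true, neg_neg]
    apply Complex.ext
    · simp [← mul_assoc, hs]
    · simp [← mul_assoc, hs]

/-- The case `s = t` is excluded: for `f = ⊤` the convention `∞ · 0 = 0` makes the left side `h (ε
k)` there, whereas the right side is `0`. -/
lemma CutoffAssumptions.modeKernel_eq (hfh : CutoffAssumptions f h) (ε : ℝ≥0) (k : ℤ) {s t : ℝ≥0}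
    (hst : s < t) :
    modeKernel f h ε k t s = ouKer ((heatModes f h ε).a k) ((heatModes f h ε).b k) t s := by
  unfold modeKernel ouKer heatModes
  dsimp only
  have hts : ((t - s : ℝ≥0) : ℝ≥0∞) ≠ 0 := by
    rw [ENNReal.coe_ne_zero]; exact (tsub_pos_of_lt hst).ne'
  by_cases hf : f (ε * k) = ⊤
  · have hk : (k : ℝ) ≠ 0 := by
      intro h0
      rw [h0, mul_zero, hfh.f_zero] at hf
      exact ENNReal.one_ne_top hf
    have hk2 : ENNReal.ofReal ((k : ℝ) ^ 2) ≠ 0 := by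
      rw [ne_eq, ENNReal.ofReal_eq_zero, not_le]; positivity
    rw [if_pos hf, zero_mul, hf, ENNReal.mul_top hk2, ENNReal.top_mul hts, expNeg, if_pos rfl,
      zero_mul]
  · have hne : ENNReal.ofReal ((k : ℝ) ^ 2) * f (ε * k) * ((t - s : ℝ≥0) : ℝ≥0∞) ≠ ⊤ := by
      finiteness
    rw [if_neg hf, expNeg, if_neg hne, ENNReal.toReal_mul, ENNReal.toReal_mul,
      ENNReal.toReal_ofReal (sq_nonneg _), ENNReal.coe_toReal, NNReal.coe_sub hst.le, mul_comm]

/-- `fourierCoef u k` mixes the indices `k` and `-k`; evenness gives them the same kernel, so that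
it commutes with integration. -/
lemma CutoffAssumptions.heatModes_neg (hfh : CutoffAssumptions f h) (ε : ℝ≥0) (k : ℤ) :
    (heatModes f h ε).a (-k) = (heatModes f h ε).a k ∧
      (heatModes f h ε).b (-k) = (heatModes f h ε).b k := by
  unfold heatModes
  dsimp only
  push_cast
  rw [mul_neg, hfh.f_even, hfh.h_even, neg_sq]
  exact ⟨rfl, rfl⟩

variable [IsProbabilityMeasure P]

lemma mom_mode_ne_top (hB : IsBrownianFamily P B) {θ : Modes} (hθ : ∀ k, 0 ≤ θ.a k) (t : ℝ≥0)
    (k : ℤ) (j : Fin n) : mom P 2 (fun ω => ‖mode B θ t k j ω‖ₑ) ≠ ⊤ := by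
  have hU := hB.isGaussLimit (a := fun p => θ.a p.1) (a' := fun _ => 0)
    (fun p => hθ p.1) (fun _ => le_rfl) (fun p => θ.b p.1) (fun _ => 0)
    (fun _ => t) (fun _ => t)
  have h := hU.mom_sum_le {(k, j)} (fun _ => 1) (r := 2) (by norm_num)
  have hz : ∀ β : ℝ≥0 → ℝ, ou 0 0 t β = 0 := fun β => by simp [ou]
  simp only [Finset.sum_singleton, one_mul, hz, sub_zero] at h
  refine ne_top_of_le_ne_top ?_ h
  have := gaussMom_ne_top (r := 2) (by norm_num)
  finiteness

lemma measurable_fourierCoef {u : ℤ → Ω → ℝ} (hu : ∀ k, Measurable (u k)) (k : ℤ) :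
    Measurable fun ω => fourierCoef (fun k => u k ω) k := by
  unfold fourierCoef
  split_ifs <;> fun_prop

theorem CutoffAssumptions.isModeFamily (hfh : CutoffAssumptions f h) (hw : IsFourierNoise P w)
    (hB : IsBrownianFamily P B) (hBw : ∀ᵐ ω ∂P, ∀ i t, B i t ω = realMode w i t ω) (ε : ℝ≥0) :
    IsModeFamily P f h w ε
      fun k j t ω => fourierCoef (fun k => mode B (heatModes f h ε) t k j ω) k := by
  intro k j t
  set θ := heatModes f h ε with hθ
  have ha : ∀ k, 0 ≤ θ.a k := fun k => mul_nonneg (sq_nonneg _) ENNReal.toReal_nonneg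
  have mm : ∀ k, Measurable (mode B θ t k j) := fun k => measurable_mode hB ha t k j
  refine ⟨⟨(measurable_fourierCoef mm k).aestronglyMeasurable, ?_⟩, ?_⟩
  · rw [eLpNorm_two_eq_mom]
    refine lt_of_le_of_lt ((mom_mono (by norm_num) fun ω => enorm_fourierCoef_le _ k).trans
      (mom_add_le (by norm_num) (mm k).enorm.aemeasurable (mm (-k)).enorm.aemeasurable)) ?_
    exact ENNReal.add_lt_top.2 ⟨(mom_mode_ne_top hB ha t k j).lt_top,
      (mom_mode_ne_top hB ha t (-k) j).lt_top⟩
  set R : ℕ → ℤ → Ω → ℝ := fun m k' ω =>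
    rsum (θ.a k') (θ.b k') m t (B (k', j) · ω) - mode B θ t k' j ω with hR
  have mR : ∀ m k', Measurable (R m k') := fun m k' => (hB.measurable_rsum _ _ _ _ _).sub (mm k')
  have lim : ∀ k', Tendsto (fun m => mom P 2 fun ω => ‖R m k' ω‖ₑ) atTop (𝓝 0) := fun k' =>
    hB.tendsto_mom_rsum (k', j) (ha k') (θ.b k') t
  have lim2 := (lim k).add (lim (-k))
  rw [add_zero] at lim2
  refine tendsto_of_tendsto_of_tendsto_of_le_of_le tendsto_const_nhds lim2 (fun _ => zero_le)
    fun m => ?_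
  -- Left end points of cells lie strictly before `t`, unless `t = 0`, when the increments vanish.
  have hker : ∀ i ∈ Finset.range m, ∀ a b : ℂ, (t = 0 → a = b) →
      (modeKernel f h ε k t (t * i / m) : ℂ) * (a - b) =
        (ouKer (θ.a k) (θ.b k) t (t * i / m) : ℂ) * (a - b) := by
    intro i hi a b hab
    rcases eq_or_ne t 0 with rfl | ht
    · rw [hab rfl, sub_self, mul_zero, mul_zero]
    · have hi' := Finset.mem_range.1 hi
      have hm : (0 : ℝ≥0) < m := by exact_mod_cast (Nat.zero_le i).trans_lt hi'
      rw [hfh.modeKernel_eq ε k]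
      rw [div_lt_iff₀ hm]
      exact mul_lt_mul_of_pos_left (by exact_mod_cast hi') (pos_iff_ne_zero.2 ht)
  have hae : ∀ᵐ ω ∂P, (∑ i ∈ Finset.range m, (modeKernel f h ε k t (t * i / m) : ℂ) *
      (w k j (t * (i + 1) / m) ω - w k j (t * i / m) ω)) -
      fourierCoef (fun k => mode B θ t k j ω) k = fourierCoef (fun k' => R m k' ω) k := by
    have h1 : ∀ᵐ ω ∂P, ∀ i : ℕ, w k j (t * (i + 1) / m) ω =
        fourierCoef (fun k => B (k, j) (t * (i + 1) / m) ω) k :=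
      ae_all_iff.2 fun i => hw.ae_eq_fourierCoef hBw k j _
    have h2 : ∀ᵐ ω ∂P, ∀ i : ℕ, w k j (t * i / m) ω =
        fourierCoef (fun k => B (k, j) (t * i / m) ω) k :=
      ae_all_iff.2 fun i => hw.ae_eq_fourierCoef hBw k j _
    filter_upwards [h1, h2] with ω h1 h2
    have e1 : fourierCoef (fun k' => R m k' ω) k = fourierCoef (fun k' =>
        (∑ i ∈ Finset.range m, ouKer (θ.a k) (θ.b k) t (t * i / m) *
          (B (k', j) (t * (i + 1) / m) ω - B (k', j) (t * i / m) ω)) - mode B θ t k' j ω) k := by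
      refine fourierCoef_congr rfl ?_
      simp only [hR, rsum, (hfh.heatModes_neg ε k).1, (hfh.heatModes_neg ε k).2, hθ]
    rw [e1, fourierCoef_sub, fourierCoef_sum]
    congr 1
    refine Finset.sum_congr rfl fun i hi => ?_
    rw [fourierCoef_const_mul, fourierCoef_sub, ← h1, ← h2]
    refine hker i hi _ _ ?_
    rintro rfl
    simp
  rw [eLpNorm_congr_ae hae, eLpNorm_two_eq_mom]
  exact (mom_mono (by norm_num) fun ω => enorm_fourierCoef_le _ k).trans
    (mom_add_le (by norm_num) (mR m k).enorm.aemeasurable (mR m (-k)).enorm.aemeasurable)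

omit [IsProbabilityMeasure P] in
lemma IsModeFamily.ae_eq (hw : IsFourierNoise P w) {ε : ℝ≥0} {Z Z' : ℤ → Fin n → ℝ≥0 → Ω → ℂ}
    (hZ : IsModeFamily P f h w ε Z) (hZ' : IsModeFamily P f h w ε Z') (k : ℤ) (j : Fin n)
    (t : ℝ≥0) : Z k j t =ᵐ[P] Z' k j t := by
  refine ae_eq_of_tendsto_eLpNorm (fun m => ?_) (hZ k j t).1.1 (hZ' k j t).1.1 (hZ k j t).2
    (hZ' k j t).2
  refine Measurable.aestronglyMeasurable (Finset.measurable_fun_sum _ fun i _ => ?_)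
  exact ((hw.meas _ _ _).sub (hw.meas _ _ _)).const_mul _

end ModeFamily

/-! ### Existence and uniqueness of the lift -/

section Lift

variable {Ω : Type*} {n : ℕ}
  {w : ℤ → Fin n → ℝ≥0 → Ω → ℂ} {B : ℤ × Fin n → ℝ≥0 → Ω → ℝ} {f : ℝ → ℝ≥0∞} {h : ℝ → ℝ}

lemma partialX_fourierCoef (θ : Modes) (N : ℕ) (t : ℝ≥0) (x : ℝ) (j : Fin n) (ω : Ω) :
    partialX (fun k j t ω => fourierCoef (fun k => mode B θ t k j ω) k) N t x j ω =
      (fieldComp B θ N t x j ω : ℂ) := by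
  unfold partialX fieldComp
  rw [sum_exp_fourierCoef]
  push_cast
  rfl

lemma partialXX_fourierCoef (θ : Modes) (N : ℕ) (t : ℝ≥0) (x y : ℝ) (i j : Fin n) (ω : Ω) :
    partialXX (fun k j t ω => fourierCoef (fun k => mode B θ t k j ω) k) N t x y i j ω =
      (areaComp B θ N t x y i j ω : ℂ) := by
  unfold partialXX areaComp
  rw [sum_sum_integral_fourierCoef]
  push_cast
  rfl

variable [MeasurableSpace Ω] {P : Measure Ω}

lemma eLpNorm_ofReal_sub (u v : Ω → ℝ) :
    eLpNorm (fun ω => (u ω : ℂ) - (v ω : ℂ)) 2 P = mom P 2 fun ω => ‖u ω - v ω‖ₑ := by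
  rw [eLpNorm_two_eq_mom]
  congr 1; funext ω
  rw [← ofReal_norm, ← ofReal_norm, ← Complex.ofReal_sub, Complex.norm_real]

/-- The exceptional null sets are collected over a countable dense set only. -/
lemma ae_eq_of_continuous {Q E : Type*} [TopologicalSpace Q] [TopologicalSpace.SeparableSpace Q]
    [TopologicalSpace E] [T2Space E] {u v : Ω → Q → E} (hu : ∀ ω, Continuous (u ω))
    (hv : ∀ ω, Continuous (v ω)) (h : ∀ q, ∀ᵐ ω ∂P, u ω q = v ω q) : ∀ᵐ ω ∂P, u ω = v ω := by
  obtain ⟨s, hs, hd⟩ := TopologicalSpace.exists_countable_dense Q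
  filter_upwards [(ae_ball_iff hs).2 fun q _ => h q] with ω hω
  exact Continuous.ext_on hd (hu ω) (hv ω) hω

variable [IsProbabilityMeasure P]

theorem IsLimitLift.isHeatLift (hfh : CutoffAssumptions f h) (hw : IsFourierNoise P w)
    (hB : IsBrownianFamily P B) (hBw : ∀ᵐ ω ∂P, ∀ i t, B i t ω = realMode w i t ω) {ε : ℝ≥0}
    {X : Ω → ℝ≥0 → Seg → Vec n} {XX : Ω → ℝ≥0 → Seg → Seg → Ten n} {c M : ℝ} (hc : 0 < c)
    (hM : 0 ≤ M) (hθ : (heatModes f h ε).Bounded c M)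
    (hX : IsLimitLift P B (heatModes f h ε) X XX) : IsHeatLift P f h w ε X XX where
  meas := hX.enhanced.meas
  meas₂ := hX.enhanced.meas₂
  cont := hX.enhanced.cont
  cont₂ := hX.enhanced.cont₂
  series := by
    refine ⟨_, hfh.isModeFamily hw hB hBw ε, fun t x j => ?_, fun t x y i j => ?_⟩
    · simp_rw [partialX_fourierCoef, eLpNorm_ofReal_sub]
      exact hX.tendsto_fieldComp hB hc hM hθ t x j
    · simp_rw [partialXX_fourierCoef, eLpNorm_ofReal_sub]
      exact hX.tendsto_areaComp hB hc hM hθ t x y i j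

/-- All lifts agree almost surely with the limit of the truncated series. -/
theorem IsHeatLift.ae_eq (hfh : CutoffAssumptions f h) (hw : IsFourierNoise P w)
    (hB : IsBrownianFamily P B) (hBw : ∀ᵐ ω ∂P, ∀ i t, B i t ω = realMode w i t ω) {ε : ℝ≥0}
    {X X₀ : Ω → ℝ≥0 → Seg → Vec n} {XX XX₀ : Ω → ℝ≥0 → Seg → Seg → Ten n} {c M : ℝ} (hc : 0 < c)
    (hM : 0 ≤ M) (hθ : (heatModes f h ε).Bounded c M)
    (hX₀ : IsLimitLift P B (heatModes f h ε) X₀ XX₀) (hX : IsHeatLift P f h w ε X XX) :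
    ∀ᵐ ω ∂P, X ω = X₀ ω ∧ XX ω = XX₀ ω := by
  obtain ⟨Z, hZ, hZX, hZXX⟩ := hX.series
  set θ := heatModes f h ε
  set Z₀ : ℤ → Fin n → ℝ≥0 → Ω → ℂ :=
    fun k j t ω => fourierCoef (fun k => mode B θ t k j ω) k with hZ₀
  -- The modes `Z` of a lift are determined up to null sets; at a fixed time only countably many of
  -- them occur.
  have hZZ : ∀ t, ∀ᵐ ω ∂P, ∀ k j, Z k j t ω = Z₀ k j t ω := fun t =>
    ae_all_iff.2 fun k => ae_all_iff.2 fun j =>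
      hZ.ae_eq hw (hfh.isModeFamily hw hB hBw ε) k j t
  have mre : ∀ {u : Ω → ℝ}, Measurable u → AEStronglyMeasurable (fun ω => (u ω : ℂ)) P :=
    fun hu => (Complex.measurable_ofReal.comp hu).aestronglyMeasurable
  have mcoord : ∀ {ι : Type} [Fintype ι] {u : Ω → EuclideanSpace ℝ ι} (i : ι), Measurable u →
      Measurable fun ω => u ω i := fun i hu => (PiLp.continuous_apply 2 _ i).measurable.comp hu
  have e1 : ∀ q : ℝ≥0 × Seg, ∀ᵐ ω ∂P, X ω q.1 q.2 = X₀ ω q.1 q.2 := by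
    rintro ⟨t, x⟩
    have : ∀ j, ∀ᵐ ω ∂P, X ω t x j = X₀ ω t x j := by
      intro j
      have h0 := hX₀.tendsto_fieldComp hB hc hM hθ t x j
      have h1 := hZX t x j
      simp_rw [← eLpNorm_ofReal_sub] at h0
      have hcongr : ∀ N, eLpNorm (fun ω => partialX Z N t x j ω - (X ω t x j : ℂ)) 2 P =
          eLpNorm (fun ω => (fieldComp B θ N t x j ω : ℂ) - (X ω t x j : ℂ)) 2 P := by
        intro N
        refine eLpNorm_congr_ae ?_
        filter_upwards [hZZ t] with ω hω
        rw [← partialX_fourierCoef]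
        simp only [partialX, hω, hZ₀]
      simp_rw [hcongr] at h1
      have := ae_eq_of_tendsto_eLpNorm
        (fun N => mre (measurable_fieldComp hB hθ.nonneg N t x j))
        (mre (mcoord j (hX.meas t x))) (mre (mcoord j (hX₀.enhanced.meas t x))) h1 h0
      filter_upwards [this] with ω hω
      exact_mod_cast hω
    filter_upwards [ae_all_iff.2 this] with ω hω
    ext j
    exact hω j
  have e2 : ∀ q : ℝ≥0 × Seg × Seg, ∀ᵐ ω ∂P, XX ω q.1 q.2.1 q.2.2 = XX₀ ω q.1 q.2.1 q.2.2 := by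
    rintro ⟨t, x, y⟩
    have : ∀ ij, ∀ᵐ ω ∂P, XX ω t x y ij = XX₀ ω t x y ij := by
      rintro ⟨i, j⟩
      have h0 := hX₀.tendsto_areaComp hB hc hM hθ t x y i j
      have h1 := hZXX t x y i j
      simp_rw [← eLpNorm_ofReal_sub] at h0
      have hcongr : ∀ N, eLpNorm (fun ω => partialXX Z N t x y i j ω -
          (XX ω t x y (i, j) : ℂ)) 2 P =
          eLpNorm (fun ω => (areaComp B θ N t x y i j ω : ℂ) - (XX ω t x y (i, j) : ℂ)) 2 P := by
        intro N
        refine eLpNorm_congr_ae ?_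
        filter_upwards [hZZ t] with ω hω
        rw [← partialXX_fourierCoef]
        simp only [partialXX, hω, hZ₀]
      simp_rw [hcongr] at h1
      have := ae_eq_of_tendsto_eLpNorm
        (fun N => mre (measurable_areaComp hB hθ.nonneg N t x y i j))
        (mre (mcoord (i, j) (hX.meas₂ t x y))) (mre (mcoord (i, j) (hX₀.enhanced.meas₂ t x y)))
        h1 h0
      filter_upwards [this] with ω hω
      exact_mod_cast hω
    filter_upwards [ae_all_iff.2 this] with ω hω
    ext ij
    exact hω ij
  have E1 := ae_eq_of_continuous (u := fun ω (q : ℝ≥0 × Seg) => X ω q.1 q.2)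
    (v := fun ω q => X₀ ω q.1 q.2) hX.cont hX₀.enhanced.cont e1
  have E2 := ae_eq_of_continuous (u := fun ω (q : ℝ≥0 × Seg × Seg) => XX ω q.1 q.2.1 q.2.2)
    (v := fun ω q => XX₀ ω q.1 q.2.1 q.2.2) hX.cont₂ hX₀.enhanced.cont₂ e2
  filter_upwards [E1, E2] with ω h1 h2
  refine ⟨?_, ?_⟩
  · funext t x; exact congrFun h1 (t, x)
  · funext t x y; exact congrFun h2 (t, x, y)

end Lift

end RoughHeat

namespace RoughHeat

/-! ### Norms of the lifts -/

section Final

variable {Ω : Type*} [MeasurableSpace Ω] {P : Measure Ω} {n : ℕ} {B : ℤ × Fin n → ℝ≥0 → Ω → ℝ}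

/-- Comparison with the system without noise turns bounds on differences into bounds on the
processes themselves. -/
lemma isLimitLift_zero (hB : IsBrownianFamily P B) : IsLimitLift P B Modes.zero 0 0 where
  enhanced := by
    have := isEnhanced_field hB (θ := Modes.zero) (fun _ => le_rfl) 0
    rwa [field_zero, area_zero] at this
  symm ω t x y := by
    have := area_add_transp (B := B) Modes.zero 0 ω t x y
    rwa [field_zero, area_zero] at this
  lim := Eventually.of_forall fun ω t x => by simp only [field_zero]; exact tendsto_const_nhds
  lim₂ := Eventually.of_forall fun ω t x y => by simp only [area_zero]; exact tendsto_const_nhds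

lemma holderSemi_le {α : ℝ} {V : Type*} [NormedAddCommGroup V] {u : Seg → V} {H : ℝ≥0∞}
    (h : ∀ x y, ‖u x - u y‖ₑ ≤ H * edist x y ^ α) : holderSemi α u ≤ H :=
  iSup_le fun x => iSup_le fun y => iSup_le fun _ => ENNReal.div_le_of_le_mul (h x y)

lemma bNorm_le {α : ℝ} {V : Type*} [NormedAddCommGroup V] {R : Seg → Seg → V} {H : ℝ≥0∞}
    (h : ∀ x y, ‖R x y‖ₑ ≤ H * edist x y ^ α) : bNorm α R ≤ H :=
  iSup_le fun x => iSup_le fun y => iSup_le fun _ => ENNReal.div_le_of_le_mul (h x y)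

lemma lintegral_rpow_le_of_majorant {p : ℝ} (hp : 0 < p) {F H : Ω → ℝ≥0∞} {a K : ℝ≥0∞}
    (ha : a ≠ ⊤) (hF : ∀ᵐ ω ∂P, F ω ≤ a * H ω) (hH : mom P p H ≤ K) :
    ∫⁻ ω, F ω ^ p ∂P ≤ (a * K) ^ p := by
  rw [← mom_le_iff hp]
  refine (mom_mono_ae hp hF).trans ?_
  rw [mom_const_mul hp ha]
  gcongr

variable [IsProbabilityMeasure P]

theorem IsLimitLift.ae_isGeometricRoughPath (hB : IsBrownianFamily P B) {θ : Modes} {c M : ℝ}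
    (hc : 0 < c) (hM : 0 ≤ M) (hθ : θ.Bounded c M) {X : Ω → ℝ≥0 → Seg → Vec n}
    {XX : Ω → ℝ≥0 → Seg → Seg → Ten n} (hX : IsLimitLift P B θ X XX) {α : ℝ} (hα : 0 < α)
    (hα' : α < 1 / 2) : ∀ᵐ ω ∂P, ∀ t, IsGeometricRoughPath α (X ω t) (XX ω t) := by
  -- The bounds are on norms of paths in time, so one null set serves all `t ≤ T`, and integers `T`
  -- exhaust all times.
  have hmaj : ∀ T : ℕ, ∀ᵐ ω ∂P, ∃ H : ℝ≥0∞, H < ⊤ ∧ ∀ t : ℝ≥0, t ≤ T →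
      (∀ x y, ‖X ω t x - X ω t y‖ₑ ≤ H * edist x y ^ α) ∧
      ∀ x y, ‖XX ω t x y‖ₑ ≤ H * edist x y ^ (2 * α) := by
    intro T
    -- `l₂ = α + 1/2` satisfies `α < l₂ / 2` exactly because `α < 1/2`, and `l₁ + l₂ = 3/4 + α/2 ≤
    -- 1`.
    obtain ⟨K, hK⟩ := exists_limit_norm_majorant (p := 1) (α₁ := (1 / 2 - α) / 16) (α₂ := α)
      (l₁ := (1 / 2 - α) / 2) (l₂ := α + 1 / 2) le_rfl (by linarith) hα (by linarith)
      (by linarith) (by linarith) hB hc hM (varConst_nonneg hc M T) T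
    obtain ⟨H, mH, qH, pH⟩ := hK θ Modes.zero 1 X 0 XX 0 hθ (Modes.bounded_zero hM) zero_le_one
      (hθ.close_zero hc T) hX (isLimitLift_zero hB)
    have hfin : ∫⁻ ω, H ω ∂P ≠ ⊤ := by
      refine ne_top_of_le_ne_top (ENNReal.coe_ne_top (r := K)) ?_
      simpa [mom] using qH
    filter_upwards [ae_lt_top mH hfin] with ω hω
    refine ⟨H ω, hω, fun t ht => ⟨fun x y => ?_, fun x y => ?_⟩⟩
    · have h1 := (pH ω).1.incr y x
      simp only [Pi.zero_apply, sub_zero] at h1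
      rw [edist_comm]
      exact (enorm_le_pathNorm (fun t => X ω t x - X ω t y) ht).trans h1
    · have h1 := (pH ω).2 x y
      simp only [Pi.zero_apply, sub_zero] at h1
      exact (enorm_le_pathNorm (fun t => XX ω t x y) ht).trans h1
  filter_upwards [ae_all_iff.2 hmaj] with ω hω t
  obtain ⟨T, hT⟩ := exists_nat_ge t
  obtain ⟨H, hH, hb⟩ := hω T
  obtain ⟨b1, b2⟩ := hb t hT
  exact
    { cont := (hX.enhanced.cont ω).comp (f := fun x => (t, x)) (by fun_prop)
      holder := (holderSemi_le b1).trans_lt hH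
      cont₂ := (hX.enhanced.cont₂ ω).comp (f := fun q : Seg × Seg => (t, q.1, q.2)) (by fun_prop)
      diag := hX.enhanced.diag ω t
      holder₂ := (bNorm_le b2).trans_lt hH
      consistency := hX.enhanced.chen ω t
      symm_part := fun x y => by rw [hX.symm] }

/-- Moments of the norms of a difference of limits. -/
theorem exists_norm_moment_bound {p α₁ α₂ l₁ l₂ : ℝ} (hp : 1 ≤ p)
    (hα₁ : 0 < α₁) (hα₂ : 0 < α₂) (h₁ : α₁ < l₁ / 4) (h₂ : α₂ < l₂ / 2) (hl : l₁ + l₂ ≤ 1)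
    (hB : IsBrownianFamily P B) {c M C : ℝ} (hc : 0 < c) (hM : 0 ≤ M) (hC : 0 ≤ C) (T : ℝ≥0) :
    ∃ K : ℝ≥0, ∀ (θ θ' : Modes) (η : ℝ) (X X' : Ω → ℝ≥0 → Seg → Vec n)
      (XX XX' : Ω → ℝ≥0 → Seg → Seg → Ten n), θ.Bounded c M → θ'.Bounded c M → 0 ≤ η →
      θ.Close θ' C η T → IsLimitLift P B θ X XX → IsLimitLift P B θ' X' XX' →
      ∫⁻ ω, timeNorm (cNorm α₂) α₁ T (X ω - X' ω) ^ p ∂P ≤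
        K * ENNReal.ofReal (η ^ (1 / 2 * (1 - l₁ - l₂) * p)) ∧
      ∫⁻ ω, timeNorm (bNorm (2 * α₂)) α₁ T (XX ω - XX' ω) ^ p ∂P ≤
        K * ENNReal.ofReal (η ^ (1 / 2 * (1 - l₁ - l₂) * p)) := by
  have hp0 : 0 < p := by linarith
  obtain ⟨K, hK⟩ := exists_limit_norm_majorant hp hα₁ hα₂ h₁ h₂ hl hB hc hM hC T
  refine ⟨(4 * K) ^ p, fun θ θ' η X X' XX XX' hθ hθ' hη hcl hX hX' => ?_⟩
  obtain ⟨H, mH, qH, pH⟩ := hK θ θ' η X X' XX XX' hθ hθ' hη hcl hX hX'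
  have e : (4 * (K * ENNReal.ofReal η ^ (1 / 2 * (1 - l₁ - l₂)))) ^ p =
      (((4 * K) ^ p : ℝ≥0) : ℝ≥0∞) * ENNReal.ofReal (η ^ (1 / 2 * (1 - l₁ - l₂) * p)) := by
    have hκ : 0 ≤ 1 / 2 * (1 - l₁ - l₂) := by linarith
    rw [← mul_assoc, ENNReal.mul_rpow_of_nonneg _ _ hp0.le, ← ENNReal.rpow_mul,
      ENNReal.ofReal_rpow_of_nonneg hη (mul_nonneg hκ hp0.le), ENNReal.coe_rpow_of_nonneg _ hp0.le]
    push_cast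
    rfl
  rw [← e]
  refine ⟨lintegral_rpow_le_of_majorant hp0 (by norm_num) (Eventually.of_forall fun ω => ?_) qH,
    lintegral_rpow_le_of_majorant hp0 (by norm_num) (Eventually.of_forall fun ω => ?_) qH⟩
  · exact (pH ω).1.timeNorm_le
  · refine (timeNorm_bNorm_le (pH ω).2).trans ?_
    gcongr
    norm_num

end Final

end RoughHeat

/-! ### The theorem, for all lifts at once -/

theorem lemma3p3 {Ω : Type*} [MeasurableSpace Ω] (P : Measure Ω) [IsProbabilityMeasure P]
    (n : ℕ) (f : ℝ → ℝ≥0∞) (h : ℝ → ℝ) (hfh : RoughHeat.CutoffAssumptions f h)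
    (w : ℤ → Fin n → ℝ≥0 → Ω → ℂ) (hw : RoughHeat.IsFourierNoise P w) :
    -- continuous versions of the processes exist for every `ε ≥ 0`
    (∀ ε : ℝ≥0, ∃ X XX, RoughHeat.IsHeatLift P f h w ε X XX) ∧
    -- and whichever are chosen, the following holds
    ∀ (X : ℝ≥0 → Ω → ℝ≥0 → RoughHeat.Seg → RoughHeat.Vec n)
      (XX : ℝ≥0 → Ω → ℝ≥0 → RoughHeat.Seg → RoughHeat.Seg → RoughHeat.Ten n),
      (∀ ε, RoughHeat.IsHeatLift P f h w ε (X ε) (XX ε)) →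
      (∀ α : ℝ, 1 / 3 < α → α < 1 / 2 → ∀ ε : ℝ≥0, ∀ᵐ ω ∂P, ∀ t : ℝ≥0,
        RoughHeat.IsGeometricRoughPath α (X ε ω t) (XX ε ω t)) ∧
      ∀ (T : ℝ≥0) (p α₁ α₂ l₁ l₂ : ℝ), 1 ≤ p → 0 < α₁ → 0 < α₂ → 0 < l₁ → 0 < l₂ →
        l₁ + l₂ ≤ 1 → α₁ < l₁ / 4 → α₂ < l₂ / 2 →
        ∃ C : ℝ≥0, ∀ ε : ℝ≥0,
          (∫⁻ ω, RoughHeat.timeNorm (RoughHeat.cNorm α₂) α₁ T (X ε ω) ^ p ∂P ≤ C) ∧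
          (∫⁻ ω, RoughHeat.timeNorm (RoughHeat.cNorm α₂) α₁ T (X ε ω - X 0 ω) ^ p ∂P
            ≤ C * ENNReal.ofReal ((ε : ℝ) ^ (1 / 2 * (1 - l₁ - l₂) * p))) ∧
          (∫⁻ ω, RoughHeat.timeNorm (RoughHeat.bNorm (2 * α₂)) α₁ T (XX ε ω) ^ p ∂P ≤ C) ∧
          (∫⁻ ω, RoughHeat.timeNorm (RoughHeat.bNorm (2 * α₂)) α₁ T (XX ε ω - XX 0 ω) ^ p ∂P
            ≤ C * ENNReal.ofReal ((ε : ℝ) ^ (1 / 2 * (1 - l₁ - l₂) * p))) := by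
  obtain ⟨B, hB, hBw⟩ := hw.exists_isBrownianFamily
  obtain ⟨c, M, hc, hM, hθ⟩ := hfh.exists_bounded
  choose X₀ XX₀ hX₀ using fun ε => RoughHeat.exists_isLimitLift hB hc hM (hθ ε)
  refine ⟨fun ε => ⟨X₀ ε, XX₀ ε, (hX₀ ε).isHeatLift hfh hw hB hBw hc hM (hθ ε)⟩,
    fun X XX hX => ?_⟩
  have hae : ∀ ε, ∀ᵐ ω ∂P, X ε ω = X₀ ε ω ∧ XX ε ω = XX₀ ε ω := fun ε =>
    (hX ε).ae_eq hfh hw hB hBw hc hM (hθ ε) (hX₀ ε)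
  refine ⟨fun α hα hα' ε => ?_, ?_⟩
  · filter_upwards [hae ε,
      (hX₀ ε).ae_isGeometricRoughPath hB hc hM (hθ ε) (by linarith) hα'] with ω h1 h2 t
    rw [h1.1, h1.2]
    exact h2 t
  · intro T p α₁ α₂ l₁ l₂ hp hα₁ hα₂ hl₁ hl₂ hl h₁ h₂
    obtain ⟨C, hC, hclose⟩ := hfh.exists_close T
    obtain ⟨K₁, hK₁⟩ := RoughHeat.exists_norm_moment_bound hp hα₁ hα₂ h₁ h₂ hl hB hc hM
      (RoughHeat.varConst_nonneg hc M T) T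
    obtain ⟨K₂, hK₂⟩ := RoughHeat.exists_norm_moment_bound hp hα₁ hα₂ h₁ h₂ hl hB hc hM hC T
    -- `K₁` bounds the norms themselves, as distances from the system without noise with `η = 1`;
    -- `K₂` bounds the differences, with `η = ε`.
    refine ⟨K₁ + K₂, fun ε => ?_⟩
    obtain ⟨a1, a2⟩ := hK₁ _ _ 1 _ _ _ _ (hθ ε) (RoughHeat.Modes.bounded_zero hM) zero_le_one
      ((hθ ε).close_zero hc T) (hX₀ ε) (RoughHeat.isLimitLift_zero hB)
    obtain ⟨b1, b2⟩ := hK₂ _ _ ε _ _ _ _ (hθ ε) (hθ 0) ε.2 (hclose ε) (hX₀ ε) (hX₀ 0)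
    simp only [Real.one_rpow, ENNReal.ofReal_one, mul_one, Pi.zero_apply, sub_zero] at a1 a2
    have hK1 : (K₁ : ℝ≥0∞) ≤ ((K₁ + K₂ : ℝ≥0) : ℝ≥0∞) := by push_cast; exact le_self_add
    have hK2 : (K₂ : ℝ≥0∞) ≤ ((K₁ + K₂ : ℝ≥0) : ℝ≥0∞) := by push_cast; exact le_add_self
    refine ⟨le_trans (le_of_eq (lintegral_congr_ae ?_)) (a1.trans hK1),
      le_trans (le_of_eq (lintegral_congr_ae ?_)) (b1.trans (mul_le_mul_left hK2 _)),
      le_trans (le_of_eq (lintegral_congr_ae ?_)) (a2.trans hK1),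
      le_trans (le_of_eq (lintegral_congr_ae ?_)) (b2.trans (mul_le_mul_left hK2 _))⟩
    · filter_upwards [hae ε] with ω h1
      rw [h1.1]
    · filter_upwards [hae ε, hae 0] with ω h1 h2
      rw [h1.1, h2.1]
    · filter_upwards [hae ε] with ω h1
      rw [h1.2]
    · filter_upwards [hae ε, hae 0] with ω h1 h2
      rw [h1.2, h2.2]
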